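/- **Setting.** $\Lambda$ is the set of $\lambda$-terms, with size $|x|=1$, $|\lambda x.t|=|t|+1$, $|tu|=|t|+|u|$; values are variables and abstractions. Weak call-by-value reduction is generated by $(\lambda x.t)v\to t[v/x]$ ($v$ a value) and is closed under both sides of application (not under $\lambda$). A step $t\to u$ costs $\max\{|u|-|t|,1\}$; $t\Downarrow$ means that $t$ reduces to a value, $Time(t)$ is the (unique) total cost of doing so, and $TS(t)=Time(t)+|t|$. Write $t\langle u_1/x_1,\dots,u_n/x_n\rangle=(\lambda x_1\cdots x_n.t)u_1\cdots u_n$ ($x_i$ distinct), and let $\theta,\xi$ range over lists of bindings $u/x$. *Formulas.* Linear formulas: $L,M::=\alpha\mid\forall\alpha L\mid\mu\alpha L\mid L\multimap M$, where $\mu\alpha L$ requires that $\alpha$ occurs only positively in $L$. Formulas: $A,B::=L\mid\forall\alpha A\mid L\multimap B\mid A\Rightarrow B$. *The system DIAL.* In a judgment $\Gamma;\Delta\vdash t:A$ the contexts are unordered, all declared variables are distinct, and $\Delta$ contains only linear formulas. Axioms: $x:A;\vdash x:A$ and $;x:L\vdash x:L$. Rules: - from $\Gamma;\Delta\vdash t:\mu\alpha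 L$ infer $\Gamma;\Delta\vdash t:L[\mu\alpha L/\alpha]$, and conversely; - from $\Gamma;\Delta\vdash t:A$ with $\alpha$ not free in $\Gamma;\Delta$ infer $\Gamma;\Delta\vdash t:\forall\alpha A$; from $\Gamma;\Delta\vdash t:\forall\alpha A$ infer $\Gamma;\Delta\vdash t:A[L/\alpha]$; - from $\Gamma_1;\Delta\vdash t:A\Rightarrow B$ and $\Gamma_2;\vdash u:A$ infer $\Gamma_1,\Gamma_2;\Delta\vdash tu:B$; from $\Gamma,z:A;\Delta\vdash t:B$ infer $\Gamma;\Delta\vdash\lambda z.t:A\Rightarrow B$; - from $\Gamma_1;\Delta_1\vdash t:L\multimap B$ and $\Gamma_2;\Delta_2\vdash u:L$ infer $\Gamma_1,\Gamma_2;\Delta_1,\Delta_2\vdash tu:B$; from $\Gamma;\Delta,z:L\vdash t:B$ infer $\Gamma;\Delta\vdash\lambda z.t:L\multimap B$; - from $\Gamma,x:A,y:A;\Delta\vdash t:B$ infer $\Gamma,z:A;\Delta\vdash t[z/x,z/y]:B$; from $\Gamma;\Delta,x:L\vdash t:B$ infer $\Gamma,x:L;\Delta\vdash t:B$; from $\Gamma;\Delta\vdash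 t:B$ infer $\Gamma,\Gamma';\Delta,\Delta'\vdash t:B$. *Higher order (additive) polynomials* are the simply typed $\lambda$-terms over one base type $o$, with constants $n:o$ ($n\in\mathbb N$) and $+:o\to o\to o$, identified up to $\alpha\beta\eta$-equivalence and the laws of addition (commutative monoid, and $m+n$ computed in $\mathbb N$). For $\tau=\tau_1\to\cdots\to\tau_k\to o$, $p:\tau$ and $q:o$ put $p+q=\lambda x_1\cdots x_k.(p\,x_1\cdots x_k+q)$, $0_\tau=\lambda x_1\cdots x_k.0$ and $\downarrow p=p\,0_{\tau_1}\cdots0_{\tau_k}:o$; for closed $p$, $\downarrow p$ is a natural number. Put $o(L)=o$ for linear $L$, $o(L\multimap A)=o(A)$, $o(\forall\alpha A)=o(A)$, $o(A\Rightarrow B)=o(A)\to o(B)$. *Saturated sets.* A (possibly empty) set $X$ of pairs $(t,p)$, with $t\in\Lambda$ and $p$ a closed polynomial of type $\tau$, is saturated of type $\tau$ if for all $(t,p)\in X$: $t\Downarrow$ and $TS(t)\le\downarrow p$; $(t,p+n)\in X$ for all $n\in\mathbb N$; and, for all terms $t_0,t_1$ and lists $\vec u$ of terms, - if $t=t_0\langle\theta,v_1/y_1,v_2/y_2,\xi\rangle\vec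 u$ then $(t_0\langle\theta,v_2/y_2,v_1/y_1,\xi\rangle\vec u,\,p)\in X$; - if $t=t_0\langle\theta\rangle\vec u$, $z\notin FV(t_0)$, $z$ is not bound in $\theta$ and $w\Downarrow$, then $(t_0\langle\theta,w/z\rangle\vec u,\,p+TS(w)+2)\in X$; - if $t=t_0\langle\theta,w/z_1,w/z_2\rangle\vec u$, and $z$ is not bound in $\theta$ and not free in $t_0$ unless it is $z_1$ or $z_2$, then $(t_0[z/z_1,z/z_2]\langle\theta,w/z\rangle\vec u,\,p)\in X$; - if $t=(t_0\langle\theta\rangle)(t_1\langle\xi\rangle)\vec u$, the variables of $\theta$ and $\xi$ are distinct, those of $\theta$ are not free in $t_1$ and those of $\xi$ are not free in $t_0$, then $((t_0t_1)\langle\theta,\xi\rangle\vec u,\,p)\in X$; - if $t=t_0\vec u$ then $((x\langle t_0/x\rangle)\vec u,\,p+3)\in X$ for every variable $x$. *Realizability.* A valuation $\eta$ maps propositional variables to saturated sets of type $o$. For $t\in\Lambda$ and a closed polynomial $p:o(A)$, define $t,p\Vdash_\eta A$ by recursion on $A$: - $t,n\Vdash_\eta\alpha$ iff $(t,n)\in\eta(\alpha)$;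 - $t,p\Vdash_\eta L\multimap A$ iff $t\Downarrow$, $TS(t)\le\downarrow p$, and $u,m\Vdash_\eta L$ implies $tu,\,p+m\Vdash_\eta A$ for all $u,m$; - $t,p\Vdash_\eta B\Rightarrow A$ iff $t\Downarrow$, $TS(t)\le\downarrow p$, and $u,q\Vdash_\eta B$ implies $tu,\,p(q)\Vdash_\eta A$ for all $u,q$; - $t,p\Vdash_\eta\forall\alpha A$ iff $t,p\Vdash_{\eta\{\alpha\leftarrow X\}}A$ for every saturated set $X$ of type $o$; - $t,p\Vdash_\eta\mu\alpha L$ iff $(t,p)\in X$ for every saturated set $X$ of type $o$ with $\{(u,q):u,q\Vdash_{\eta\{\alpha\leftarrow X\}}L\}\subseteq X$. **Theorem (Adequacy).** Suppose that $x_1:C_1,\dots,x_a:C_a;\ y_1:M_1,\dots,y_b:M_b\vdash t:A$ is derivable in DIAL. Then there is a higher order polynomial $p(x_1,\dots,x_a):o(A)$ in variables $x_i$ of type $o(C_i)$ such that: 1. for every valuation $\eta$, all terms $u_i,s_j$, all closed polynomials $q_i:o(C_i)$ and $m_j:o$, if $u_i,q_i\Vdash_\eta C_i$ for all $i\le a$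 and $s_j,m_j\Vdash_\eta M_j$ for all $j\le b$, then $$t\langle u_1/x_1,\dots,u_a/x_a,s_1/y_1,\dots,s_b/y_b\rangle,\quad p(q_1,\dots,q_a)+m_1+\cdots+m_b\ \Vdash_\eta\ A;$$ 2. if each $x_i$ occurs $c_i$ times in $t$, then for all closed polynomials $q_i:o(C_i)$ $$|t|+c_1\downarrow q_1+\cdots+c_a\downarrow q_a\ \le\ \downarrow p(q_1,\dots,q_a).$$ -/

import Mathlib

namespace DIAL

/-! ## The weak call-by-value lambda calculus with its time measure -/

/-- Lambda terms modulo `α`-equivalence. The variables are the natural numbers; a free occurrence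
of the variable `x` that lies under `d` abstractions is written `var (x + d)`, and the indices below
`d` are the bound ones. -/
inductive LTerm : Type
  | var (n : ℕ)
  | lam (t : LTerm)
  | app (t u : LTerm)

namespace LTerm

/-- Lifts a renaming under a binder. -/
def upRen (ρ : ℕ → ℕ) : ℕ → ℕ
  | 0 => 0
  | n + 1 => ρ n + 1

/-- Capture-avoiding renaming of the free variables. -/
def rename : (ℕ → ℕ) → LTerm → LTerm
  | ρ, var n => var (ρ n)
  | ρ, lam t => lam (rename (upRen ρ) t)
  | ρ, app t u => app (rename ρ t) (rename ρ u)

/-- Lifts a substitution under a binder. -/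
def upSub (s : ℕ → LTerm) : ℕ → LTerm
  | 0 => var 0
  | n + 1 => rename Nat.succ (s n)

/-- Capture-avoiding simultaneous substitution for the free variables. -/
def subst : (ℕ → LTerm) → LTerm → LTerm
  | s, var n => s n
  | s, lam t => lam (subst (upSub s) t)
  | s, app t u => app (subst s t) (subst s u)

/-- `b.inst v` replaces the variable bound by the abstraction `lam b` by `v`. -/
def inst (b v : LTerm) : LTerm :=
  subst (fun n => match n with
    | 0 => v
    | k + 1 => var k) b

/-- `abs x t` is the abstraction `λ x. t` of the variable `x`. -/
def abs (x : ℕ) (t : LTerm) : LTerm :=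
  lam (rename (fun y => if y = x then 0 else y + 1) t)

/-- The number of free occurrences of the variable `x`. -/
def occ : ℕ → LTerm → ℕ
  | x, var y => if y = x then 1 else 0
  | x, lam t => occ (x + 1) t
  | x, app t u => occ x t + occ x u

/-- The set of free variables. -/
def FV (t : LTerm) : Set ℕ := {x | occ x t ≠ 0}

/-- The size `|t|`. -/
def size : LTerm → ℕ
  | var _ => 1
  | lam t => size t + 1
  | app t u => size t + size u

/-- Values are the variables and the abstractions. -/
inductive IsValue : LTerm → Prop
  | var (n : ℕ) : IsValue (var n)
  | lam (t : LTerm) : IsValue (lam t)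

/-- Weak call-by-value reduction. -/
inductive Step : LTerm → LTerm → Prop
  | beta {b v : LTerm} : IsValue v → Step (app (lam b) v) (b.inst v)
  | left {t t' u : LTerm} : Step t t' → Step (app t u) (app t' u)
  | right {u t t' : LTerm} : Step t t' → Step (app u t) (app u t')

/-- `CostRed t n u`: the term `t` reduces to `u` with cost `n`. (The natural-number subtraction is
harmless, because of the maximum with `1`.) -/
inductive CostRed : LTerm → ℕ → LTerm → Prop
  | refl (t : LTerm) : CostRed t 0 t
  | step {t u : LTerm} : Step t u → CostRed t (max (size u - size t) 1) u
  | trans {s t u : LTerm} {n m : ℕ} : CostRed s n t → CostRed t m u → CostRed s (n + m) u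

/-- `t ⇓`: the term `t` evaluates to a value. -/
def Evaluates (t : LTerm) : Prop := ∃ v, IsValue v ∧ Relation.ReflTransGen Step t v

/-- The cost of evaluating `t` to a value. The cost does not depend on the reduction sequence, so
the set below has exactly one element if `t ⇓`. Only used together with `Evaluates t`. -/
noncomputable def time (t : LTerm) : ℕ := sInf {n | ∃ v, IsValue v ∧ CostRed t n v}

/-- `TS(t) = Time(t) + |t|`. -/
noncomputable def TS (t : LTerm) : ℕ := time t + size t

/-- `λ x₁ ⋯ xₙ. t`. -/
def lams (xs : List ℕ) (t : LTerm) : LTerm := xs.foldr abs t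

/-- `t u₁ ⋯ uₙ`. -/
def apps (t : LTerm) (us : List LTerm) : LTerm := us.foldl app t

/-- `t⟨u₁/x₁, …, uₙ/xₙ⟩ = (λ x₁ ⋯ xₙ. t) u₁ ⋯ uₙ`, where `uᵢ/xᵢ` is the pair `(uᵢ, xᵢ)`. -/
def bind (t : LTerm) (θ : List (LTerm × ℕ)) : LTerm :=
  apps (lams (θ.map Prod.snd) t) (θ.map Prod.fst)

/-- `t[z/x, z/y]`. -/
def contract (t : LTerm) (z x y : ℕ) : LTerm :=
  rename (fun w => if w = x ∨ w = y then z else w) t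

end LTerm

/-! ## Formulas and typing -/

/-- Raw formulas, modulo renaming of bound propositional variables, with the same convention for
variables as in `LTerm`. The formulas of the system are those that satisfy `Formula.WF`. -/
inductive Formula : Type
  | var (α : ℕ)
  | all (A : Formula)
  | mu (L : Formula)
  | lolli (L B : Formula)
  | imp (A B : Formula)

namespace Formula

/-- Capture-avoiding renaming of the free propositional variables. -/
def rename : (ℕ → ℕ) → Formula → Formula
  | ρ, var n => var (ρ n)
  | ρ, all A => all (rename (LTerm.upRen ρ) A)
  | ρ, mu A => mu (rename (LTerm.upRen ρ) A)
  | ρ, lolli A B => lolli (rename ρ A) (rename ρ B)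
  | ρ, imp A B => imp (rename ρ A) (rename ρ B)

/-- Lifts a substitution under a binder. -/
def upSub (s : ℕ → Formula) : ℕ → Formula
  | 0 => var 0
  | n + 1 => rename Nat.succ (s n)

/-- Capture-avoiding simultaneous substitution for the free propositional variables. -/
def subst : (ℕ → Formula) → Formula → Formula
  | s, var n => s n
  | s, all A => all (subst (upSub s) A)
  | s, mu A => mu (subst (upSub s) A)
  | s, lolli A B => lolli (subst s A) (subst s B)
  | s, imp A B => imp (subst s A) (subst s B)

/-- `A.inst L` replaces the variable bound by `all A` or by `mu A` by `L`. -/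
def inst (A L : Formula) : Formula :=
  subst (fun n => match n with
    | 0 => L
    | k + 1 => var k) A

/-- `∀ α A` for the propositional variable `α`. -/
def forallVar (α : ℕ) (A : Formula) : Formula :=
  all (rename (fun β => if β = α then 0 else β + 1) A)

/-- `α` occurs free in the formula. -/
def Occurs : ℕ → Formula → Prop
  | α, var β => β = α
  | α, all A => Occurs (α + 1) A
  | α, mu A => Occurs (α + 1) A
  | α, lolli A B => Occurs α A ∨ Occurs α B
  | α, imp A B => Occurs α A ∨ Occurs α B

/-- `OccursOnly true α A`: `α` occurs only positively in `A`;
`OccursOnly false α A`: `α` occurs only negatively in `A`. -/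
def OccursOnly : Bool → ℕ → Formula → Prop
  | b, α, var β => β = α → b = true
  | b, α, all A => OccursOnly b (α + 1) A
  | b, α, mu A => OccursOnly b (α + 1) A
  | b, α, lolli A B => OccursOnly (!b) α A ∧ OccursOnly b α B
  | b, α, imp A B => OccursOnly (!b) α A ∧ OccursOnly b α B

/-- No non-linear arrow occurs in the formula. -/
def NoImp : Formula → Prop
  | var _ => True
  | all A => NoImp A
  | mu A => NoImp A
  | lolli A B => NoImp A ∧ NoImp B
  | imp _ _ => False

/-- The formulas of the grammar: the premise of a linear arrow and the body of a type fixpoint are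
linear, and the variable of a type fixpoint occurs only positively. -/
def WF : Formula → Prop
  | var _ => True
  | all A => WF A
  | mu L => WF L ∧ NoImp L ∧ OccursOnly true 0 L
  | lolli L B => WF L ∧ NoImp L ∧ WF B
  | imp A B => WF A ∧ WF B

/-- The linear formulas of the grammar. -/
def IsLinear (L : Formula) : Prop := WF L ∧ NoImp L

end Formula

/-- Typing contexts. -/
abbrev Ctx : Type := List (ℕ × Formula)

/-- The variables declared in a context. -/
def Ctx.names (Γ : Ctx) : List ℕ := Γ.map Prod.fst

open LTerm Formula in
/-- `Derivable Γ Δ t A`: the judgment `Γ; Δ ⊢ t : A` is derivable. The order of the declarations in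
a context is immaterial, hence the rule `perm`; all declared variables are distinct. -/
inductive Derivable : Ctx → Ctx → LTerm → Formula → Prop
  | ax1 (x : ℕ) (A : Formula) : A.WF → Derivable [(x, A)] [] (.var x) A
  | ax2 (x : ℕ) (L : Formula) : L.IsLinear → Derivable [] [(x, L)] (.var x) L
  | mu_e {Γ Δ : Ctx} {t : LTerm} {L : Formula} :
      Derivable Γ Δ t (.mu L) → Derivable Γ Δ t (L.inst (.mu L))
  | mu_i {Γ Δ : Ctx} {t : LTerm} {L : Formula} :
      (Formula.mu L).WF → Derivable Γ Δ t (L.inst (.mu L)) → Derivable Γ Δ t (.mu L)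
  | all_i {Γ Δ : Ctx} {t : LTerm} {A : Formula} (α : ℕ) :
      Derivable Γ Δ t A → (∀ c ∈ Γ ++ Δ, ¬ Occurs α c.2) →
      Derivable Γ Δ t (forallVar α A)
  | all_e {Γ Δ : Ctx} {t : LTerm} {A L : Formula} :
      Derivable Γ Δ t (.all A) → L.IsLinear → Derivable Γ Δ t (A.inst L)
  | imp_e {Γ₁ Γ₂ Δ : Ctx} {t u : LTerm} {A B : Formula} :
      Derivable Γ₁ Δ t (.imp A B) → Derivable Γ₂ [] u A →
      (Ctx.names (Γ₁ ++ Γ₂ ++ Δ)).Nodup →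
      Derivable (Γ₁ ++ Γ₂) Δ (.app t u) B
  | imp_i {Γ Δ : Ctx} {t : LTerm} {A B : Formula} {z : ℕ} :
      Derivable (Γ ++ [(z, A)]) Δ t B → Derivable Γ Δ (abs z t) (.imp A B)
  | lolli_e {Γ₁ Γ₂ Δ₁ Δ₂ : Ctx} {t u : LTerm} {L B : Formula} :
      Derivable Γ₁ Δ₁ t (.lolli L B) → Derivable Γ₂ Δ₂ u L →
      (Ctx.names (Γ₁ ++ Γ₂ ++ (Δ₁ ++ Δ₂))).Nodup →
      Derivable (Γ₁ ++ Γ₂) (Δ₁ ++ Δ₂) (.app t u) B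
  | lolli_i {Γ Δ : Ctx} {t : LTerm} {L B : Formula} {z : ℕ} :
      Derivable Γ (Δ ++ [(z, L)]) t B → Derivable Γ Δ (abs z t) (.lolli L B)
  | contr {Γ Δ : Ctx} {t : LTerm} {A B : Formula} {x y z : ℕ} :
      Derivable (Γ ++ [(x, A), (y, A)]) Δ t B → z ∉ Ctx.names (Γ ++ Δ) →
      Derivable (Γ ++ [(z, A)]) Δ (t.contract z x y) B
  | derel {Γ Δ : Ctx} {t : LTerm} {L B : Formula} {x : ℕ} :
      Derivable Γ (Δ ++ [(x, L)]) t B → Derivable (Γ ++ [(x, L)]) Δ t B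
  | weak {Γ Γ' Δ Δ' : Ctx} {t : LTerm} {B : Formula} :
      Derivable Γ Δ t B → (∀ c ∈ Γ', c.2.WF) → (∀ c ∈ Δ', c.2.IsLinear) →
      (Ctx.names (Γ ++ Γ' ++ (Δ ++ Δ'))).Nodup →
      Derivable (Γ ++ Γ') (Δ ++ Δ') t B
  | perm {Γ Γ' Δ Δ' : Ctx} {t : LTerm} {B : Formula} :
      Derivable Γ Δ t B → Γ.Perm Γ' → Δ.Perm Δ' → Derivable Γ' Δ' t B

/-! ## Higher order polynomials -/

/-- Simple types over one base type. -/
inductive Ty : Type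
  | o
  | arrow (σ τ : Ty)

/-- `Idx Γ τ`: the positions of type `τ` in the list of types `Γ`. -/
inductive Idx : List Ty → Ty → Type
  | zero {Γ : List Ty} {τ : Ty} : Idx (τ :: Γ) τ
  | succ {Γ : List Ty} {σ τ : Ty} : Idx Γ τ → Idx (σ :: Γ) τ

/-- `Poly Γ τ`: the higher order polynomials of type `τ` whose free variables have the types `Γ`,
modulo `α`-equivalence. -/
inductive Poly : List Ty → Ty → Type
  | var {Γ : List Ty} {τ : Ty} : Idx Γ τ → Poly Γ τ
  | app {Γ : List Ty} {σ τ : Ty} : Poly Γ (.arrow σ τ) → Poly Γ σ → Poly Γ τ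
  | lam {Γ : List Ty} {σ τ : Ty} : Poly (σ :: Γ) τ → Poly Γ (.arrow σ τ)
  | nat {Γ : List Ty} : ℕ → Poly Γ .o
  | plus {Γ : List Ty} : Poly Γ (.arrow .o (.arrow .o .o))

namespace Poly

/-- Lifts a renaming under a binder. -/
def upRen {Γ Δ : List Ty} {σ : Ty} (ρ : ∀ τ, Idx Γ τ → Idx Δ τ) :
    ∀ τ, Idx (σ :: Γ) τ → Idx (σ :: Δ) τ
  | _, .zero => .zero
  | _, .succ i => .succ (ρ _ i)

/-- Renaming of free variables. -/
def rename : ∀ {Γ Δ : List Ty} {τ : Ty}, (∀ τ, Idx Γ τ → Idx Δ τ) → Poly Γ τ → Poly Δ τ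
  | _, _, _, ρ, var i => var (ρ _ i)
  | _, _, _, ρ, app p q => app (rename ρ p) (rename ρ q)
  | _, _, _, ρ, lam p => lam (rename (upRen ρ) p)
  | _, _, _, _, nat n => nat n
  | _, _, _, _, plus => plus

/-- Weakening by one variable. -/
def wk {Γ : List Ty} {σ τ : Ty} (p : Poly Γ τ) : Poly (σ :: Γ) τ :=
  rename (fun _ i => .succ i) p

/-- Lifts a substitution under a binder. -/
def upSub {Γ Δ : List Ty} {σ : Ty} (s : ∀ τ, Idx Γ τ → Poly Δ τ) :
    ∀ τ, Idx (σ :: Γ) τ → Poly (σ :: Δ) τ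
  | _, .zero => var .zero
  | _, .succ i => wk (s _ i)

/-- Simultaneous substitution for the free variables. -/
def subst : ∀ {Γ Δ : List Ty} {τ : Ty}, (∀ τ, Idx Γ τ → Poly Δ τ) → Poly Γ τ → Poly Δ τ
  | _, _, _, s, var i => s _ i
  | _, _, _, s, app p q => app (subst s p) (subst s q)
  | _, _, _, s, lam p => lam (subst (upSub s) p)
  | _, _, _, _, nat n => nat n
  | _, _, _, _, plus => plus

/-- The substitution of `q` for the first variable. -/
def single {Γ : List Ty} {σ : Ty} (q : Poly Γ σ) : ∀ τ, Idx (σ :: Γ) τ → Poly Γ τ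
  | _, .zero => q
  | _, .succ i => var i

/-- The sum of two polynomials of base type. -/
def plus₂ {Γ : List Ty} (p q : Poly Γ .o) : Poly Γ .o := app (app plus p) q

/-- The identification of higher order polynomials: `βη`-equivalence (`α`-equivalence is built into
`Poly`) and the laws of addition of natural numbers. -/
inductive Conv : ∀ {Γ : List Ty} {τ : Ty}, Poly Γ τ → Poly Γ τ → Prop
  | refl {Γ : List Ty} {τ : Ty} (p : Poly Γ τ) : Conv p p
  | symm {Γ : List Ty} {τ : Ty} {p q : Poly Γ τ} : Conv p q → Conv q p
  | trans {Γ : List Ty} {τ : Ty} {p q r : Poly Γ τ} : Conv p q → Conv q r → Conv p r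
  | app {Γ : List Ty} {σ τ : Ty} {p p' : Poly Γ (.arrow σ τ)} {q q' : Poly Γ σ} :
      Conv p p' → Conv q q' → Conv (p.app q) (p'.app q')
  | lam {Γ : List Ty} {σ τ : Ty} {p p' : Poly (σ :: Γ) τ} : Conv p p' → Conv p.lam p'.lam
  | beta {Γ : List Ty} {σ τ : Ty} (p : Poly (σ :: Γ) τ) (q : Poly Γ σ) :
      Conv (p.lam.app q) (p.subst (single q))
  | eta {Γ : List Ty} {σ τ : Ty} (p : Poly Γ (.arrow σ τ)) :
      Conv (Poly.lam (p.wk.app (var .zero))) p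
  | comm {Γ : List Ty} (p q : Poly Γ .o) : Conv (plus₂ p q) (plus₂ q p)
  | assoc {Γ : List Ty} (p q r : Poly Γ .o) :
      Conv (plus₂ (plus₂ p q) r) (plus₂ p (plus₂ q r))
  | zero {Γ : List Ty} (p : Poly Γ .o) : Conv (plus₂ (nat 0) p) p
  | nat {Γ : List Ty} (m n : ℕ) : Conv (plus₂ (nat m) (nat n) : Poly Γ .o) (nat (m + n))

/-- `p + q = λ x₁ ⋯ xₖ. (p x₁ ⋯ xₖ + q)` for `p : τ₁ → ⋯ → τₖ → o` and `q : o`. -/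
def add : ∀ {Γ : List Ty} {τ : Ty}, Poly Γ τ → Poly Γ .o → Poly Γ τ
  | _, .o, p, q => plus₂ p q
  | _, .arrow _ _, p, q => lam (add (app p.wk (var .zero)) q.wk)

/-- `0_τ = λ x₁ ⋯ xₖ. 0` for `τ = τ₁ → ⋯ → τₖ → o`. -/
def zeroAt : ∀ {Γ : List Ty} (τ : Ty), Poly Γ τ
  | _, .o => nat 0
  | _, .arrow _ τ => lam (zeroAt τ)

/-- The lowering `↓p = p 0_{τ₁} ⋯ 0_{τₖ}` for `p : τ₁ → ⋯ → τₖ → o`; it is `p` itself if `p : o`. -/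
def down : ∀ {Γ : List Ty} {τ : Ty}, Poly Γ τ → Poly Γ .o
  | _, .o, p => p
  | _, .arrow σ _, p => down (app p (zeroAt σ))

end Poly

/-- The functionals of a given type over the natural numbers. -/
def Ty.Den : Ty → Type
  | .o => ℕ
  | .arrow σ τ => σ.Den → τ.Den

/-- Extends an assignment by a value for a new first variable. -/
def extendEnv {Γ : List Ty} {σ : Ty} (x : σ.Den) (e : ∀ τ, Idx Γ τ → τ.Den) :
    ∀ τ, Idx (σ :: Γ) τ → τ.Den
  | _, .zero => x
  | _, .succ i => e _ i

/-- The functional denoted by a higher order polynomial. -/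
def Poly.den : ∀ {Γ : List Ty} {τ : Ty}, Poly Γ τ → (∀ τ, Idx Γ τ → τ.Den) → τ.Den
  | _, _, .var i, e => e _ i
  | _, _, .app p q, e => (p.den e) (q.den e)
  | _, _, .lam p, e => fun x => p.den (extendEnv x e)
  | _, _, .nat n, _ => n
  | _, _, .plus, _ => fun (m n : ℕ) => (m + n : ℕ)

/-- The natural number that a closed higher order polynomial of base type is. -/
def Poly.value (p : Poly [] .o) : ℕ := p.den (fun _ i => nomatch i)

/-- `↓p` as a natural number, for a closed higher order polynomial `p` of any type. -/
def Poly.lower {τ : Ty} (p : Poly [] τ) : ℕ := p.down.value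

/-- Tuples of closed higher order polynomials of the given types. -/
def Args : List Ty → Type
  | [] => Unit
  | τ :: Γ => Poly [] τ × Args Γ

/-- A component of a tuple. -/
def Args.get : ∀ {Γ : List Ty}, Args Γ → ∀ τ, Idx Γ τ → Poly [] τ
  | _ :: _, qs, _, .zero => qs.1
  | _ :: _, qs, _, .succ i => Args.get qs.2 _ i

/-- `p(q₁, …, qₙ)`: the closed polynomials `qᵢ` are substituted for the variables of `p`. -/
def Poly.eval {Γ : List Ty} {τ : Ty} (p : Poly Γ τ) (qs : Args Γ) : Poly [] τ := p.subst qs.get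

/-- `p + ↓m₁ + ⋯ + ↓mₖ`. (The lowering does nothing to the `mᵢ` of base type.) -/
def Poly.addArgs {τ : Ty} : ∀ {Γ : List Ty}, Poly [] τ → Args Γ → Poly [] τ
  | [], p, _ => p
  | _ :: _, p, ms => Poly.addArgs (p.add ms.1.down) ms.2

/-- The type `o(A)` of higher order polynomials associated with a formula. It is `o` if `A` is
linear. -/
def Formula.otype : Formula → Ty
  | .var _ => .o
  | .all A => A.otype
  | .mu _ => .o
  | .lolli _ B => B.otype
  | .imp A B => .arrow A.otype B.otype

/-- The list of the types `o(Aᵢ)` for a context `x₁ : A₁, …, xₙ : Aₙ`. -/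
def Ctx.otypes : Ctx → List Ty
  | [] => []
  | c :: Γ => c.2.otype :: Ctx.otypes Γ

/-! ## Realizability -/

open LTerm in
/-- Saturated sets of type `τ`. They consist of pairs of a term and a closed higher order polynomial
of type `τ`; `resp` says that the polynomials only matter up to their identification.
A saturated set may be empty. -/
structure IsSaturated (τ : Ty) (X : Set (LTerm × Poly [] τ)) : Prop where
  resp : ∀ t p q, Poly.Conv p q → (t, p) ∈ X → (t, q) ∈ X
  bound : ∀ t p, (t, p) ∈ X → Evaluates t ∧ TS t ≤ p.lower
  monotonicity : ∀ t p (n : ℕ), (t, p) ∈ X → (t, p.add (.nat n)) ∈ X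
  exchange : ∀ (t₀ v₁ v₂ : LTerm) (y₁ y₂ : ℕ) (θ ξ : List (LTerm × ℕ)) (vs : List LTerm) p,
    ((θ ++ (v₁, y₁) :: (v₂, y₂) :: ξ).map Prod.snd).Nodup →
    (apps (t₀.bind (θ ++ (v₁, y₁) :: (v₂, y₂) :: ξ)) vs, p) ∈ X →
    (apps (t₀.bind (θ ++ (v₂, y₂) :: (v₁, y₁) :: ξ)) vs, p) ∈ X
  weakening : ∀ (t₀ w : LTerm) (z : ℕ) (θ : List (LTerm × ℕ)) (vs : List LTerm) p,
    ((θ ++ [(w, z)]).map Prod.snd).Nodup → z ∉ FV t₀ → Evaluates w →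
    (apps (t₀.bind θ) vs, p) ∈ X →
    (apps (t₀.bind (θ ++ [(w, z)])) vs, p.add (.nat (TS w + 2))) ∈ X
  contraction : ∀ (t₀ w : LTerm) (z z₁ z₂ : ℕ) (θ : List (LTerm × ℕ)) (vs : List LTerm) p,
    ((θ ++ [(w, z₁), (w, z₂)]).map Prod.snd).Nodup →
    z ∉ θ.map Prod.snd → (z ∈ FV t₀ → z = z₁ ∨ z = z₂) →
    (apps (t₀.bind (θ ++ [(w, z₁), (w, z₂)])) vs, p) ∈ X →
    (apps ((t₀.contract z z₁ z₂).bind (θ ++ [(w, z)])) vs, p) ∈ X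
  concatenation : ∀ (t₀ t₁ : LTerm) (θ ξ : List (LTerm × ℕ)) (vs : List LTerm) p,
    ((θ ++ ξ).map Prod.snd).Nodup →
    (∀ x ∈ θ.map Prod.snd, x ∉ FV t₁) → (∀ x ∈ ξ.map Prod.snd, x ∉ FV t₀) →
    (apps (.app (t₀.bind θ) (t₁.bind ξ)) vs, p) ∈ X →
    (apps ((LTerm.app t₀ t₁).bind (θ ++ ξ)) vs, p) ∈ X
  identity : ∀ (t₀ : LTerm) (x : ℕ) (vs : List LTerm) p,
    (apps t₀ vs, p) ∈ X → (apps ((LTerm.var x).bind [(t₀, x)]) vs, p.add (.nat 3)) ∈ X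

/-- The saturated sets of type `o`. -/
def SatSet : Type := {X : Set (LTerm × Poly [] .o) // IsSaturated .o X}

/-- Valuations of the propositional variables. -/
abbrev Valuation : Type := ℕ → SatSet

/-- The valuation of the body of a binder that gives the value `X` to the bound variable. -/
def Valuation.push (X : SatSet) (η : Valuation) : Valuation
  | 0 => X
  | n + 1 => η n

open LTerm in
/-- The realizability relation `t, p ⊩_η A`. In the clauses for `lolli` and `mu`, the polynomials
`m` and `q` have base type when `L` is linear, so that they are not changed by the lowering. -/
def Realizes : (A : Formula) → Valuation → LTerm → Poly [] A.otype → Prop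
  | .var α, η, t, n => (t, n) ∈ (η α).1
  | .lolli L A, η, t, p =>
      (Evaluates t ∧ TS t ≤ Poly.lower (τ := A.otype) p) ∧
        ∀ (u : LTerm) (m : Poly [] L.otype), Realizes L η u m →
          Realizes A η (.app t u) (Poly.add (τ := A.otype) p m.down)
  | .imp B A, η, t, p =>
      (Evaluates t ∧ TS t ≤ Poly.lower (τ := .arrow B.otype A.otype) p) ∧
        ∀ (u : LTerm) (q : Poly [] B.otype), Realizes B η u q →
          Realizes A η (.app t u) (Poly.app (σ := B.otype) (τ := A.otype) p q)
  | .all A, η, t, p => ∀ X : SatSet, Realizes A (η.push X) t p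
  | .mu L, η, t, p => ∀ X : SatSet,
      (∀ (u : LTerm) (q : Poly [] L.otype), Realizes L (η.push X) u q → (u, q.down) ∈ X.1) →
        (t, p) ∈ X.1

/-- `RealizesCtx η Γ us qs`: the lists `us` and `qs` have the length of `Γ` and
`uᵢ, qᵢ ⊩_η Aᵢ` for every declaration `xᵢ : Aᵢ` of `Γ`. -/
def RealizesCtx (η : Valuation) : (Γ : Ctx) → List LTerm → Args Γ.otypes → Prop
  | [], [], _ => True
  | c :: Γ, u :: us, qs => Realizes c.2 η u qs.1 ∧ RealizesCtx η Γ us qs.2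
  | _, _, _ => False

/-- `c₁ ↓q₁ + ⋯ + cₙ ↓qₙ`, where the `i`-th variable of `Γ` occurs `cᵢ` times in `t`. -/
def occSum (t : LTerm) : (Γ : Ctx) → Args Γ.otypes → ℕ
  | [], _ => 0
  | c :: Γ, qs => t.occ c.1 * Poly.lower (τ := c.2.otype) qs.1 + occSum t Γ qs.2

end DIAL

/-! The proof is an induction on the derivation. The closure conditions on saturated sets match what
the rules do to a term t⟨θ⟩: identity serves the axioms, concatenation the applications, and
contraction, weakening and exchange the context rules. Abstraction needs no condition of its own for
the applied term, because t⟨θ,u/z⟩ and (λz.t)⟨θ⟩u are literally the same term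
(`bind_append_singleton`).

Realizers of every formula form a saturated set (`isSaturated_realizes`). The core is that the set
of all (t,p) with t⇓ and TS(t) ≤ ↓p is saturated: each transformation preserves the value and raises
TS by at most the allowed constant. This is checked on a deterministic big-step semantics with
costs, where evaluating t⟨θ⟩ splits into running the arguments of θ and evaluating the instantiated
body (`ev_bind`). Arrows inherit saturation because the conditions allow trailing arguments; ∀ and μ
inherit it as intersections. Since linear formulas have type o, their realizers are legitimate
values of a propositional variable, so substitution becomes a change of valuation
(`sameRealizers_subst`) and μ is a genuine least fixed point (`sameRealizers_mu`).

The size bound has to be carried along with realizability, because abstraction uses it: (λz.t)⟨θ⟩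
must itself evaluate within the lowered polynomial, its β-steps copy each argument once per
occurrence, and |t| + Σ cᵢ↓qᵢ pays for these copies. Linear variables occur at most once
(`Derivable.wellFormed`), so `betaCost_le` charges them no copying; the remaining overhead is a
padding that is linear in the bindings (`exists_padding`).

On the side of polynomials two facts are needed. Monotonicity of the denoted functionals gives ↓p ≤
↓(p q), for the size bound of an application (`lower_le_lower_app`). A computability argument
identifies closed polynomials of base type with numerals (`conv_nat`), so the weights of linear
arguments can be handled as numbers. -/

namespace DIAL

/-! ### Substitution, occurrence counts and sizes of terms. -/

namespace LTerm

theorem subst_ext {s s' : ℕ → LTerm} (t : LTerm) (h : ∀ x, occ x t ≠ 0 → s x = s' x) :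
    subst s t = subst s' t := by
  induction t generalizing s s' with
  | var n => exact h n (by simp [occ])
  | lam t ih =>
    simp only [subst]
    rw [ih]
    rintro (_ | x) hx
    · rfl
    · simp only [upSub]; rw [h x hx]
  | app t u iht ihu =>
    simp only [subst]
    rw [iht fun x hx => h x (by simp [occ, hx]), ihu fun x hx => h x (by simp [occ, hx])]

theorem subst_rename (s : ℕ → LTerm) (ρ : ℕ → ℕ) (t : LTerm) :
    subst s (rename ρ t) = subst (fun x => s (ρ x)) t := by
  induction t generalizing s ρ with
  | var n => rfl
  | lam t ih =>
    simp only [rename, subst, ih]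
    congr 2
    funext x
    cases x <;> rfl
  | app t u iht ihu => simp only [rename, subst, iht, ihu]

theorem subst_eq_rename (ρ : ℕ → ℕ) (t : LTerm) :
    subst (fun x => var (ρ x)) t = rename ρ t := by
  induction t generalizing ρ with
  | var n => rfl
  | lam t ih =>
    simp only [rename, subst, ← ih]
    congr 2
    funext x
    cases x <;> rfl
  | app t u iht ihu => simp only [rename, subst, iht, ihu]

theorem subst_var (t : LTerm) : subst var t = t := by
  induction t with
  | var n => rfl
  | lam t ih =>
    simp only [subst]
    conv_rhs => rw [← ih]
    congr 2
    funext x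
    cases x <;> rfl
  | app t u iht ihu => simp only [subst, iht, ihu]

theorem rename_rename (ρ ρ' : ℕ → ℕ) (t : LTerm) :
    rename ρ' (rename ρ t) = rename (fun x => ρ' (ρ x)) t := by
  rw [← subst_eq_rename ρ', subst_rename, subst_eq_rename]

theorem rename_subst (ρ : ℕ → ℕ) (s : ℕ → LTerm) (t : LTerm) :
    rename ρ (subst s t) = subst (fun x => rename ρ (s x)) t := by
  induction t generalizing s ρ with
  | var n => rfl
  | lam t ih =>
    simp only [rename, subst, ih]
    congr 2
    funext x
    cases x with
    | zero => rfl
    | succ x => simp only [upSub, rename_rename, upRen]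
  | app t u iht ihu => simp only [rename, subst, iht, ihu]

theorem subst_subst (s s' : ℕ → LTerm) (t : LTerm) :
    subst s' (subst s t) = subst (fun x => subst s' (s x)) t := by
  induction t generalizing s s' with
  | var n => rfl
  | lam t ih =>
    simp only [subst, ih]
    congr 2
    funext x
    cases x with
    | zero => rfl
    | succ x => simp only [upSub, rename_subst, subst_rename]
  | app t u iht ihu => simp only [subst, iht, ihu]

/-- Contracting an abstraction over a named variable only updates the pending substitution. This
lets a block of abstractions be unfolded one redex at a time. -/
theorem inst_subst_abs (s : ℕ → LTerm) (x : ℕ) (t v : LTerm) :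
    inst (subst (upSub s) (rename (fun y => if y = x then 0 else y + 1) t)) v =
      subst (Function.update s x v) t := by
  rw [inst, subst_subst, subst_rename]
  congr 1
  funext y
  by_cases h : y = x
  · simp [h, upSub, subst]
  · simp only [if_neg h, upSub, subst_rename, Function.update_of_ne h]
    exact subst_var _

/-- The finite set collects the preimages of z, tested only on variables that occur. Empty,
singleton and two-element sets give the counts for shifts, abstraction and contraction. -/
theorem occ_rename (t : LTerm) (ρ : ℕ → ℕ) (z : ℕ) (S : Finset ℕ)
    (h : ∀ w, occ w t ≠ 0 → (ρ w = z ↔ w ∈ S)) :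
    occ z (rename ρ t) = ∑ w ∈ S, occ w t := by
  induction t generalizing ρ z S with
  | var n =>
    have := h n (by simp [occ])
    simp only [rename, occ, Finset.sum_ite_eq, this]
  | lam t ih =>
    simp only [rename, occ]
    rw [ih (upRen ρ) (z + 1) (S.map ⟨Nat.succ, Nat.succ_injective⟩)]
    · simp
    · rintro (_ | w) hw
      · simp [upRen]
      · simpa [upRen] using h w hw
  | app t u iht ihu =>
    simp only [rename, occ, Finset.sum_add_distrib]
    rw [iht ρ z S fun w hw => h w (by simp [occ, hw]),
      ihu ρ z S fun w hw => h w (by simp [occ, hw])]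

theorem occ_rename_succ (t : LTerm) (k : ℕ) : occ (k + 1) (rename Nat.succ t) = occ k t := by
  rw [occ_rename t _ _ {k} (by simp)]
  simp

theorem occ_zero_rename_succ (t : LTerm) : occ 0 (rename Nat.succ t) = 0 := by
  rw [occ_rename t _ _ ∅ (by simp)]
  simp

theorem occ_abs_body (x : ℕ) (t : LTerm) :
    occ 0 (rename (fun y => if y = x then 0 else y + 1) t) = occ x t := by
  rw [occ_rename t _ _ {x} (by intro w _; by_cases h : w = x <;> simp [h])]
  simp

theorem occ_abs_of_ne {x y : ℕ} (h : y ≠ x) (t : LTerm) : occ y (abs x t) = occ y t := by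
  simp only [abs, occ]
  rw [occ_rename t _ _ {y} (by intro w _; by_cases h' : w = x <;> simp [h', h.symm])]
  simp

theorem occ_abs_self (x : ℕ) (t : LTerm) : occ x (abs x t) = 0 := by
  simp only [abs, occ]
  rw [occ_rename t _ _ ∅ (by intro w _; by_cases h' : w = x <;> simp [h'])]
  simp

theorem occ_contract (t : LTerm) {z x y : ℕ} (hxy : x ≠ y)
    (hz : occ z t ≠ 0 → z = x ∨ z = y) :
    occ z (t.contract z x y) = occ x t + occ y t := by
  rw [contract, occ_rename t _ _ {x, y}, Finset.sum_pair hxy]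
  intro w hw
  by_cases h : w = x ∨ w = y
  · simp [h]
  · simp only [h, if_false, Finset.mem_insert, Finset.mem_singleton, iff_false]
    rintro rfl
    exact h (hz hw)

theorem occ_contract_of_ne (t : LTerm) {w z x y : ℕ} (hz : w ≠ z) (hx : w ≠ x) (hy : w ≠ y) :
    occ w (t.contract z x y) = occ w t := by
  rw [contract, occ_rename t _ _ {w}]
  · simp
  intro w' _
  by_cases h : w' = x ∨ w' = y
  · simp only [h, if_true, Finset.mem_singleton]
    constructor
    · intro h'; exact absurd h'.symm hz
    · rintro rfl; rcases h with h | h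
      · exact absurd h hx
      · exact absurd h hy
  · simp [h]

theorem occ_subst (t : LTerm) (s : ℕ → LTerm) (k : ℕ) (hk : s k = var k)
    (h : ∀ y, y ≠ k → occ k (s y) = 0) : occ k (subst s t) = occ k t := by
  induction t generalizing s k with
  | var n =>
    by_cases hn : n = k
    · subst hn; simp [subst, hk]
    · simp [subst, h n hn, occ, hn]
  | lam t ih =>
    simp only [subst, occ]
    apply ih
    · simp [upSub, hk, rename]
    · rintro (_ | y) hy
      · simp [upSub, occ]
      · simpa only [upSub, occ_rename_succ] using h y (by simpa using hy)
  | app t u iht ihu => simp only [subst, occ, iht s k hk h, ihu s k hk h]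

/-- Values already substituted are shifted under the binder, so they add no occurrence of the bound
variable. Redex costs can therefore be read off the original body. -/
theorem occ_zero_subst_upSub (t : LTerm) (s : ℕ → LTerm) :
    occ 0 (subst (upSub s) t) = occ 0 t := by
  refine occ_subst t (upSub s) 0 rfl ?_
  rintro (_ | y) hy
  · exact absurd rfl hy
  · exact occ_zero_rename_succ _

theorem size_pos (t : LTerm) : 0 < size t := by
  induction t <;> simp only [size] <;> omega

theorem size_rename (ρ : ℕ → ℕ) (t : LTerm) : size (rename ρ t) = size t := by
  induction t generalizing ρ with
  | var n => rfl
  | lam t ih => simp [rename, size, ih]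
  | app t u iht ihu => simp [rename, size, iht, ihu]

theorem size_abs (x : ℕ) (t : LTerm) : size (abs x t) = size t + 1 := by
  simp [abs, size, size_rename]

theorem size_contract (t : LTerm) (z x y : ℕ) : size (t.contract z x y) = size t :=
  size_rename _ _

theorem size_subst (t : LTerm) (s : ℕ → LTerm) (k : ℕ) (h : ∀ y, y ≠ k → size (s y) = 1) :
    size (subst s t) = size t + occ k t * (size (s k) - 1) := by
  induction t generalizing s k with
  | var n =>
    by_cases hn : n = k
    · subst hn
      have := size_pos (s n)
      simp only [subst, size, occ, if_true]; omega
    · simp [subst, h n hn, occ, hn, size]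
  | lam t ih =>
    simp only [subst, occ, size]
    rw [ih (upSub s) (k + 1)]
    · simp only [upSub, size_rename]; omega
    · rintro (_ | y) hy
      · simp [upSub, size]
      · simpa only [upSub, size_rename] using h y (by simpa using hy)
  | app t u iht ihu => simp only [subst, size, occ, iht s k h, ihu s k h, add_mul]; omega

theorem size_inst (b v : LTerm) : size (b.inst v) = size b + occ 0 b * (size v - 1) := by
  rw [inst, size_subst b _ 0]
  rintro (_ | y) hy
  · exact absurd rfl hy
  · rfl

/-! ### Small-step costs and big-step evaluation. -/

/-- The cost of contracting a redex whose bound variable occurs `o` times and whose argument has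
size `s`. -/
def betaCost (o s : ℕ) : ℕ := max (o * (s - 1) - (1 + s)) 1

theorem step_cost_beta (b v : LTerm) :
    max (size (b.inst v) - size (app (lam b) v)) 1 = betaCost (occ 0 b) (size v) := by
  rw [betaCost, size_inst]
  congr 1
  simp only [size]
  omega

/-- Big-step evaluation with its cost. -/
inductive Ev : LTerm → ℕ → LTerm → Prop
  | value {v : LTerm} : IsValue v → Ev v 0 v
  | app {t u b v w : LTerm} {n m k : ℕ} : Ev t n (lam b) → Ev u m v → Ev (b.inst v) k w →
      Ev (app t u) (n + m + betaCost (occ 0 b) (size v) + k) w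

theorem Ev.isValue {t v : LTerm} {n : ℕ} (h : Ev t n v) : IsValue v := by
  induction h with
  | value h => exact h
  | app _ _ _ _ _ ih => exact ih

theorem ev_app_iff {t u w : LTerm} {N : ℕ} : Ev (app t u) N w ↔
    ∃ b v n m k, Ev t n (lam b) ∧ Ev u m v ∧ Ev (b.inst v) k w ∧
      N = n + m + betaCost (occ 0 b) (size v) + k := by
  constructor
  · intro h
    cases h with
    | value h => cases h
    | app h₁ h₂ h₃ => exact ⟨_, _, _, _, _, h₁, h₂, h₃, rfl⟩
  · rintro ⟨b, v, n, m, k, h₁, h₂, h₃, rfl⟩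
    exact .app h₁ h₂ h₃

theorem Ev.of_isValue {t v : LTerm} {n : ℕ} (h : Ev t n v) (ht : IsValue t) : n = 0 ∧ v = t := by
  cases h with
  | value h => exact ⟨rfl, rfl⟩
  | app _ _ _ => cases ht

theorem Ev.det {t v w : LTerm} {n m : ℕ} (h : Ev t n v) (h' : Ev t m w) : n = m ∧ v = w := by
  induction h generalizing m w with
  | value h =>
    obtain ⟨rfl, rfl⟩ := h'.of_isValue h
    exact ⟨rfl, rfl⟩
  | app h₁ h₂ h₃ ih₁ ih₂ ih₃ =>
    obtain ⟨b', v', n', m', k', h₁', h₂', h₃', rfl⟩ := ev_app_iff.1 h'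
    obtain ⟨rfl, hb⟩ := ih₁ h₁'
    obtain ⟨rfl, rfl⟩ := ih₂ h₂'
    cases hb
    obtain ⟨rfl, rfl⟩ := ih₃ h₃'
    exact ⟨rfl, rfl⟩

/-- Every step is charged at least its growth in size, so the size of the value is at most TS of the
term. This bounds the copies made by later β-steps. -/
theorem Ev.size_le {t v : LTerm} {n : ℕ} (h : Ev t n v) : size v ≤ n + size t := by
  induction h with
  | value h => simp
  | @app t u b v w n m k h₁ h₂ h₃ ih₁ ih₂ ih₃ =>
    have h₄ := step_cost_beta b v
    have h₅ : size (b.inst v) - size (LTerm.app (lam b) v) ≤ betaCost (occ 0 b) (size v) := by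
      rw [← h₄]; exact le_max_left _ _
    simp only [size] at *
    omega

theorem CostRed.app_left {t t' : LTerm} {n : ℕ} (h : CostRed t n t') (u : LTerm) :
    CostRed (app t u) n (app t' u) := by
  induction h with
  | refl t => exact .refl _
  | @step t t' h =>
    have := CostRed.step (Step.left (u := u) h)
    simp only [size] at this
    rwa [Nat.add_sub_add_right] at this
  | trans _ _ ih₁ ih₂ => exact ih₁.trans ih₂

theorem CostRed.app_right {t t' : LTerm} {n : ℕ} (h : CostRed t n t') (u : LTerm) :
    CostRed (app u t) n (app u t') := by
  induction h with
  | refl t => exact .refl _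
  | @step t t' h =>
    have := CostRed.step (Step.right (u := u) h)
    simp only [size] at this
    rwa [Nat.add_sub_add_left] at this
  | trans _ _ ih₁ ih₂ => exact ih₁.trans ih₂

theorem Ev.costRed {t v : LTerm} {n : ℕ} (h : Ev t n v) : CostRed t n v := by
  induction h with
  | value h => exact .refl _
  | @app t u b v w n m k h₁ h₂ h₃ ih₁ ih₂ ih₃ =>
    have hs := CostRed.step (Step.beta (b := b) h₂.isValue)
    rw [step_cost_beta] at hs
    exact (((ih₁.app_left u).trans (ih₂.app_right _)).trans hs).trans ih₃

/-- A small step in any position can be absorbed into a big-step derivation at its own cost.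
Together with `Ev.det` this makes the cost independent of the reduction sequence, without a
confluence argument. -/
theorem Ev.of_step {t t' v : LTerm} {k : ℕ} (h : Step t t') (h' : Ev t' k v) :
    Ev t (max (size t' - size t) 1 + k) v := by
  induction h generalizing k v with
  | @beta b w hw =>
    rw [step_cost_beta]
    simpa using Ev.app (.value (.lam b)) (.value hw) h'
  | @left t t' u h ih =>
    obtain ⟨b, v, n, m, k, h₁, h₂, h₃, rfl⟩ := ev_app_iff.1 h'
    convert Ev.app (ih h₁) h₂ h₃ using 1
    simp only [size, Nat.add_sub_add_right]
    omega
  | @right u t t' h ih =>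
    obtain ⟨b, v, n, m, k, h₁, h₂, h₃, rfl⟩ := ev_app_iff.1 h'
    convert Ev.app h₁ (ih h₂) h₃ using 1
    simp only [size, Nat.add_sub_add_left]
    omega

theorem Ev.of_costRed {t t' v : LTerm} {n k : ℕ} (h : CostRed t n t') (h' : Ev t' k v) :
    Ev t (n + k) v := by
  induction h generalizing k v with
  | refl t => simpa using h'
  | step h => exact h'.of_step h
  | trans _ _ ih₁ ih₂ => rw [add_assoc]; exact ih₁ (ih₂ h')

theorem costRed_of_reflTransGen {t t' : LTerm} (h : Relation.ReflTransGen Step t t') :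
    ∃ n, CostRed t n t' := by
  induction h with
  | refl => exact ⟨_, .refl _⟩
  | tail _ h ih =>
    obtain ⟨n, hn⟩ := ih
    exact ⟨_, hn.trans (.step h)⟩

theorem CostRed.reflTransGen {t t' : LTerm} {n : ℕ} (h : CostRed t n t') :
    Relation.ReflTransGen Step t t' := by
  induction h with
  | refl => exact .refl
  | step h => exact .single h
  | trans _ _ ih₁ ih₂ => exact ih₁.trans ih₂

theorem evaluates_iff {t : LTerm} : Evaluates t ↔ ∃ n v, Ev t n v := by
  constructor
  · rintro ⟨v, hv, h⟩
    obtain ⟨n, hn⟩ := costRed_of_reflTransGen h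
    exact ⟨_, v, .of_costRed hn (.value hv)⟩
  · rintro ⟨n, v, h⟩
    exact ⟨v, h.isValue, h.costRed.reflTransGen⟩

theorem Ev.time_eq {t v : LTerm} {n : ℕ} (h : Ev t n v) : time t = n := by
  have : {n | ∃ v, IsValue v ∧ CostRed t n v} = {n} := by
    ext m
    constructor
    · rintro ⟨w, hw, hm⟩
      exact ((Ev.of_costRed hm (.value hw)).det h).1
    · rintro rfl
      exact ⟨v, h.isValue, h.costRed⟩
  rw [time, this, csInf_singleton]

theorem Ev.TS_eq {t v : LTerm} {n : ℕ} (h : Ev t n v) : TS t = n + size t := by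
  rw [TS, h.time_eq]

/-- `t` evaluates, with `TS(t) ≤ N`. -/
def EvalBound (t : LTerm) (N : ℕ) : Prop := Evaluates t ∧ TS t ≤ N

theorem evalBound_iff {t : LTerm} {N : ℕ} :
    EvalBound t N ↔ ∃ n v, Ev t n v ∧ n + size t ≤ N := by
  constructor
  · rintro ⟨h, hN⟩
    obtain ⟨n, v, h⟩ := evaluates_iff.1 h
    exact ⟨n, v, h, by rwa [← h.TS_eq]⟩
  · rintro ⟨n, v, h, hN⟩
    exact ⟨evaluates_iff.2 ⟨n, v, h⟩, by rwa [h.TS_eq]⟩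

/-! ### Simulations and the evaluation of terms with bindings. -/

/-- `u` has the same value as `t`, with a cost that is larger by at most `k`. -/
def Simulates (t u : LTerm) (k : ℕ) : Prop :=
  ∀ n v, Ev t n v → ∃ m, Ev u m v ∧ m + size u ≤ n + size t + k

/-- Both heads reach the same abstraction, after which the evaluations coincide. Hence trailing
arguments may be ignored when a closure condition is checked. -/
theorem Simulates.apps {t u : LTerm} {k : ℕ} (h : Simulates t u k) (vs : List LTerm) :
    Simulates (apps t vs) (apps u vs) k := by
  induction vs generalizing t u with
  | nil => exact h
  | cons a vs ih =>
    apply ih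
    intro n v hv
    obtain ⟨b, w, n, m, j, h₁, h₂, h₃, rfl⟩ := ev_app_iff.1 hv
    obtain ⟨n', h₁', hn⟩ := h _ _ h₁
    refine ⟨_, .app h₁' h₂ h₃, ?_⟩
    simp only [size]
    omega

theorem Simulates.evalBound {t u : LTerm} {k N : ℕ} (h : Simulates t u k) (ht : EvalBound t N) :
    EvalBound u (N + k) := by
  obtain ⟨n, v, hv, hn⟩ := evalBound_iff.1 ht
  obtain ⟨m, hm, hle⟩ := h _ _ hv
  exact evalBound_iff.2 ⟨m, v, hm, by omega⟩

theorem apps_append (t : LTerm) (us vs : List LTerm) : apps t (us ++ vs) = apps (apps t us) vs :=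
  List.foldl_append

/-- The head redex can be contracted before the trailing arguments are evaluated. The induction
removes arguments from the right, where the big-step rule for application acts. -/
theorem ev_apps_beta (b u : LTerm) (us : List LTerm) (N : ℕ) (w : LTerm) :
    Ev (apps (app (lam b) u) us) N w ↔ ∃ c v k, Ev u c v ∧ Ev (apps (b.inst v) us) k w ∧
      N = c + betaCost (occ 0 b) (size v) + k := by
  induction us using List.reverseRecOn generalizing N w with
  | nil =>
    constructor
    · intro h
      obtain ⟨b', v, n, m, k, h₁, h₂, h₃, rfl⟩ := ev_app_iff.1 h
      obtain ⟨rfl, hb⟩ := h₁.of_isValue (.lam b)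
      cases hb
      exact ⟨m, v, k, h₂, h₃, by omega⟩
    · rintro ⟨c, v, k, h₁, h₂, rfl⟩
      simpa [apps] using Ev.app (.value (.lam b)) h₁ h₂
  | append_singleton us a ih =>
    simp only [apps_append]
    simp only [apps, List.foldl_cons, List.foldl_nil] at ih ⊢
    constructor
    · intro h
      obtain ⟨b', v, n, m, k, h₁, h₂, h₃, rfl⟩ := ev_app_iff.1 h
      obtain ⟨c, v', k', h₄, h₅, rfl⟩ := (ih _ _).1 h₁
      exact ⟨c, v', _, h₄, .app h₅ h₂ h₃, by omega⟩
    · rintro ⟨c, v, k, h₁, h₂, rfl⟩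
      obtain ⟨b', v', n, m, k, h₃, h₄, h₅, rfl⟩ := ev_app_iff.1 h₂
      convert Ev.app ((ih _ _).2 ⟨c, v, _, h₁, h₃, rfl⟩) h₄ h₅ using 1
      omega

/-- `EvArgs t s θ n s'`: the evaluation of the arguments in `θ` and the contraction of the redexes
of `t⟨θ⟩` turns the substitution `s` into `s'` at the cost `n`. -/
inductive EvArgs (t : LTerm) : (ℕ → LTerm) → List (LTerm × ℕ) → ℕ → (ℕ → LTerm) → Prop
  | nil (s : ℕ → LTerm) : EvArgs t s [] 0 s
  | cons {s s' : ℕ → LTerm} {u v : LTerm} {x c k : ℕ} {θ : List (LTerm × ℕ)} : Ev u c v →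
      EvArgs t (Function.update s x v) θ k s' →
      EvArgs t s ((u, x) :: θ) (c + betaCost (occ x t) (size v) + k) s'

theorem evArgs_nil_iff {t : LTerm} {s s' : ℕ → LTerm} {n : ℕ} :
    EvArgs t s [] n s' ↔ n = 0 ∧ s' = s := by
  constructor
  · intro h; cases h; exact ⟨rfl, rfl⟩
  · rintro ⟨rfl, rfl⟩; exact .nil _

theorem evArgs_cons_iff {t u : LTerm} {s s' : ℕ → LTerm} {x n : ℕ} {θ : List (LTerm × ℕ)} :
    EvArgs t s ((u, x) :: θ) n s' ↔ ∃ c v k, Ev u c v ∧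
      EvArgs t (Function.update s x v) θ k s' ∧ n = c + betaCost (occ x t) (size v) + k := by
  constructor
  · intro h
    cases h with
    | cons h₁ h₂ => exact ⟨_, _, _, h₁, h₂, rfl⟩
  · rintro ⟨c, v, k, h₁, h₂, rfl⟩
    exact .cons h₁ h₂

theorem evArgs_append_iff {t : LTerm} {s s' : ℕ → LTerm} {n : ℕ} {θ ξ : List (LTerm × ℕ)} :
    EvArgs t s (θ ++ ξ) n s' ↔
      ∃ n₁ n₂ s₁, EvArgs t s θ n₁ s₁ ∧ EvArgs t s₁ ξ n₂ s' ∧ n = n₁ + n₂ := by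
  induction θ generalizing s n with
  | nil => simp [evArgs_nil_iff]
  | cons a θ ih =>
    obtain ⟨u, x⟩ := a
    rw [List.cons_append, evArgs_cons_iff]
    constructor
    · rintro ⟨c, v, k, h₁, h₂, rfl⟩
      obtain ⟨n₁, n₂, s₁, h₃, h₄, rfl⟩ := ih.1 h₂
      exact ⟨_, n₂, s₁, .cons h₁ h₃, h₄, by omega⟩
    · rintro ⟨n₁, n₂, s₁, h₃, h₄, rfl⟩
      obtain ⟨c, v, k, h₁, h₂, rfl⟩ := evArgs_cons_iff.1 h₃
      exact ⟨c, v, _, h₁, ih.2 ⟨_, _, _, h₂, h₄, rfl⟩, by omega⟩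

theorem EvArgs.congr {t t' : LTerm} {s s' : ℕ → LTerm} {n : ℕ} {θ : List (LTerm × ℕ)}
    (h : EvArgs t s θ n s') (ht : ∀ x ∈ θ.map Prod.snd, occ x t = occ x t') :
    EvArgs t' s θ n s' := by
  induction h with
  | nil s => exact .nil s
  | @cons s s' u v x c k θ h₁ h₂ ih =>
    rw [ht x (by simp)]
    exact .cons h₁ (ih fun y hy => ht y (by simp at hy ⊢; tauto))

theorem EvArgs.eq_of_notMem {t : LTerm} {s s' : ℕ → LTerm} {n : ℕ} {θ : List (LTerm × ℕ)}
    (h : EvArgs t s θ n s') {x : ℕ} (hx : x ∉ θ.map Prod.snd) : s' x = s x := by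
  induction h with
  | nil s => rfl
  | @cons s s' u v y c k θ h₁ h₂ ih =>
    simp only [List.map_cons, List.mem_cons, not_or] at hx
    rw [ih hx.2, Function.update_of_ne hx.1]

/-- The arguments are evaluated independently of the pending substitution, so the same run, at the
same cost, can start from any other one. -/
theorem EvArgs.change {t : LTerm} {s s' : ℕ → LTerm} {n : ℕ} {θ : List (LTerm × ℕ)}
    (h : EvArgs t s θ n s') (r : ℕ → LTerm) :
    ∃ r', EvArgs t r θ n r' ∧ ∀ x, s x = r x ∨ x ∈ θ.map Prod.snd → s' x = r' x := by
  induction h generalizing r with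
  | nil s => exact ⟨r, .nil r, fun x hx => by simpa using hx⟩
  | @cons s s' u v y c k θ h₁ h₂ ih =>
    obtain ⟨r', h₃, h₄⟩ := ih (Function.update r y v)
    refine ⟨r', .cons h₁ h₃, fun x hx => h₄ x ?_⟩
    by_cases hxy : x = y
    · subst hxy; simp
    · simpa [hxy] using hx

theorem occ_lams {x : ℕ} {xs : List ℕ} (h : x ∉ xs) (t : LTerm) : occ x (lams xs t) = occ x t := by
  induction xs with
  | nil => rfl
  | cons y xs ih =>
    simp only [List.mem_cons, not_or] at h
    change occ x (abs y (lams xs t)) = _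
    rw [occ_abs_of_ne h.1, ih h.2]

/-- The arbitrary substitution s is what makes the induction on θ go through: after one β-step the
remaining block of abstractions carries the updated substitution. -/
theorem ev_apps_subst_lams {t w : LTerm} {s : ℕ → LTerm} {θ : List (LTerm × ℕ)} {N : ℕ}
    (hθ : (θ.map Prod.snd).Nodup) :
    Ev (apps (subst s (lams (θ.map Prod.snd) t)) (θ.map Prod.fst)) N w ↔
      ∃ n k s', EvArgs t s θ n s' ∧ Ev (subst s' t) k w ∧ N = n + k := by
  induction θ generalizing s N with
  | nil => simp [evArgs_nil_iff, apps, lams]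
  | cons a θ ih =>
    obtain ⟨u, x⟩ := a
    simp only [List.map_cons, List.nodup_cons] at hθ ih ⊢
    change Ev (apps (app (lam (subst (upSub s) (rename _ (lams (θ.map Prod.snd) t)))) u) _) _ _ ↔ _
    rw [ev_apps_beta]
    simp only [inst_subst_abs, occ_zero_subst_upSub, occ_abs_body, occ_lams hθ.1, ih hθ.2]
    constructor
    · rintro ⟨c, v, k, h₁, ⟨n, k', s', h₂, h₃, rfl⟩, rfl⟩
      exact ⟨_, k', s', .cons h₁ h₂, h₃, by omega⟩
    · rintro ⟨n, k, s', h₁, h₂, rfl⟩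
      obtain ⟨c, v, j, h₃, h₄, rfl⟩ := evArgs_cons_iff.1 h₁
      exact ⟨c, v, _, h₃, ⟨_, _, _, h₄, h₂, rfl⟩, by omega⟩

theorem ev_bind {t w : LTerm} {θ : List (LTerm × ℕ)} {N : ℕ} (hθ : (θ.map Prod.snd).Nodup) :
    Ev (t.bind θ) N w ↔ ∃ n k s, EvArgs t var θ n s ∧ Ev (subst s t) k w ∧ N = n + k := by
  rw [← ev_apps_subst_lams hθ, subst_var, bind]

theorem size_lams (xs : List ℕ) (t : LTerm) : size (lams xs t) = size t + xs.length := by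
  induction xs with
  | nil => rfl
  | cons x xs ih =>
    change size (abs x (lams xs t)) = _
    rw [size_abs, ih, List.length_cons]; omega

theorem size_apps (t : LTerm) (us : List LTerm) : size (apps t us) = size t + (us.map size).sum := by
  induction us generalizing t with
  | nil => rfl
  | cons u us ih =>
    change size (apps (app t u) us) = _
    rw [ih, List.map_cons, List.sum_cons, size]; omega

theorem size_bind (t : LTerm) (θ : List (LTerm × ℕ)) :
    size (t.bind θ) = size t + (θ.map fun a => size a.1 + 1).sum := by
  rw [bind, size_apps, size_lams, List.sum_map_add]
  simp [Function.comp_def]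
  omega

/-! ### The closure conditions on saturated sets, as simulations. -/

theorem simulates_exchange (t₀ v₁ v₂ : LTerm) (y₁ y₂ : ℕ) (θ ξ : List (LTerm × ℕ))
    (h : ((θ ++ (v₁, y₁) :: (v₂, y₂) :: ξ).map Prod.snd).Nodup) :
    Simulates (t₀.bind (θ ++ (v₁, y₁) :: (v₂, y₂) :: ξ))
      (t₀.bind (θ ++ (v₂, y₂) :: (v₁, y₁) :: ξ)) 0 := by
  have hp : (θ ++ (v₁, y₁) :: (v₂, y₂) :: ξ).Perm (θ ++ (v₂, y₂) :: (v₁, y₁) :: ξ) :=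
    (List.Perm.swap _ _ _).append_left θ
  have h' := (hp.map Prod.snd).nodup_iff.1 h
  have hne : y₂ ≠ y₁ := by
    rw [List.map_append, List.nodup_append] at h
    have := h.2.1
    simp only [List.map_cons, List.nodup_cons, List.mem_cons, not_or] at this
    exact fun e => this.1.1 e.symm
  intro N w hw
  obtain ⟨n, k, s, h₁, h₂, rfl⟩ := (ev_bind h).1 hw
  obtain ⟨n₁, n₂, s₁, h₃, h₄, rfl⟩ := evArgs_append_iff.1 h₁
  obtain ⟨c, v, k₁, h₅, h₆, rfl⟩ := evArgs_cons_iff.1 h₄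
  obtain ⟨c', v', k₂, h₇, h₈, rfl⟩ := evArgs_cons_iff.1 h₆
  rw [Function.update_comm hne.symm] at h₈
  refine ⟨_, (ev_bind h').2 ⟨_, _, s,
    evArgs_append_iff.2 ⟨_, _, _, h₃, .cons h₇ (.cons h₅ h₈), rfl⟩, h₂, rfl⟩, ?_⟩
  rw [size_bind, size_bind, (hp.map _).sum_eq]
  omega

/-- The overhead is TS(w) for the new argument, 1 for the extra abstraction, and 1 for an erasing
β-step. -/
theorem simulates_weakening (t₀ w : LTerm) (z : ℕ) (θ : List (LTerm × ℕ))
    (h : ((θ ++ [(w, z)]).map Prod.snd).Nodup) (hz : z ∉ FV t₀) (hw : Evaluates w) :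
    Simulates (t₀.bind θ) (t₀.bind (θ ++ [(w, z)])) (TS w + 2) := by
  have h' : (θ.map Prod.snd).Nodup := by
    rw [List.map_append] at h
    exact h.of_append_left
  have hz' : occ z t₀ = 0 := by simpa [FV] using hz
  intro N x hx
  obtain ⟨c, v, hv⟩ := evaluates_iff.1 hw
  obtain ⟨n, k, s, h₁, h₂, rfl⟩ := (ev_bind h').1 hx
  refine ⟨_, (ev_bind h).2 ⟨_, k, Function.update s z v,
    evArgs_append_iff.2 ⟨_, _, _, h₁, .cons hv (.nil _), rfl⟩, ?_, rfl⟩, ?_⟩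
  · rwa [subst_ext (s' := s)]
    intro y hy
    rw [Function.update_of_ne]
    rintro rfl
    exact hy hz'
  · rw [size_bind, size_bind, hv.TS_eq, hz']
    simp [betaCost]
    omega

/-- Each separate redex gets a rebate of 1 + s for disappearing, and the merged redex gets it only
once. The missing rebate is covered by no longer evaluating and storing a second copy of the
argument, which saves T + 1 with T = TS(w) ≥ s. -/
theorem betaCost_contraction (a b s T : ℕ) (h : s ≤ T) :
    betaCost (a + b) s + 1 ≤ betaCost a s + betaCost b s + 2 + T := by
  simp only [betaCost, add_mul]
  omega

theorem simulates_contraction (t₀ w : LTerm) (z z₁ z₂ : ℕ) (θ : List (LTerm × ℕ))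
    (h : ((θ ++ [(w, z₁), (w, z₂)]).map Prod.snd).Nodup)
    (hz : z ∉ θ.map Prod.snd) (hz₀ : z ∈ FV t₀ → z = z₁ ∨ z = z₂) :
    Simulates (t₀.bind (θ ++ [(w, z₁), (w, z₂)]))
      ((t₀.contract z z₁ z₂).bind (θ ++ [(w, z)])) 0 := by
  have h₀ : (θ.map Prod.snd).Nodup ∧ z₁ ≠ z₂ ∧ z₁ ∉ θ.map Prod.snd ∧ z₂ ∉ θ.map Prod.snd := by
    rw [List.map_append, List.nodup_append] at h
    refine ⟨h.1, by simpa using h.2.1, fun h' => ?_, fun h' => ?_⟩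
    · exact h.2.2 _ h' z₁ (by simp) rfl
    · exact h.2.2 _ h' z₂ (by simp) rfl
  obtain ⟨hθ, hne, hz₁, hz₂⟩ := h₀
  have h' : ((θ ++ [(w, z)]).map Prod.snd).Nodup := by
    rw [List.map_append, List.nodup_append]
    refine ⟨hθ, by simp, ?_⟩
    rintro a ha b hb rfl
    simp at hb
    exact hz (hb ▸ ha)
  intro N x hx
  obtain ⟨n, k, s, h₁, h₂, rfl⟩ := (ev_bind h).1 hx
  obtain ⟨n₁, n₂, s₁, h₃, h₄, rfl⟩ := evArgs_append_iff.1 h₁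
  obtain ⟨c, v, k₁, h₅, h₆, rfl⟩ := evArgs_cons_iff.1 h₄
  obtain ⟨c', v', k₂, h₇, h₈, rfl⟩ := evArgs_cons_iff.1 h₆
  obtain ⟨rfl, rfl⟩ := evArgs_nil_iff.1 h₈
  obtain ⟨rfl, rfl⟩ := h₅.det h₇
  have h₉ : EvArgs (t₀.contract z z₁ z₂) var θ n₁ s₁ := h₃.congr fun x hx =>
    (occ_contract_of_ne _ (ne_of_mem_of_not_mem hx hz) (ne_of_mem_of_not_mem hx hz₁)
      (ne_of_mem_of_not_mem hx hz₂)).symm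
  refine ⟨_, (ev_bind h').2 ⟨_, k, Function.update s₁ z v,
    evArgs_append_iff.2 ⟨_, _, _, h₉, .cons h₅ (.nil _), rfl⟩, ?_, rfl⟩, ?_⟩
  · rw [contract, subst_rename]
    convert h₂ using 1
    apply subst_ext
    intro y hy
    by_cases hy₂ : y = z₂
    · simp [hy₂]
    by_cases hy₁ : y = z₁
    · simp [hy₁, hne]
    have : y ≠ z := by
      rintro rfl
      rcases hz₀ hy with h | h
      · exact hy₁ h
      · exact hy₂ h
    simp [hy₁, hy₂, this]
  · rw [size_bind, size_bind, size_contract, occ_contract _ hne hz₀]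
    have := betaCost_contraction (occ z₁ t₀) (occ z₂ t₀) (size v) _ h₅.size_le
    simp only [List.map_append, List.sum_append, List.map_cons, List.map_nil, List.sum_cons,
      List.sum_nil]
    omega

theorem simulates_concatenation (t₀ t₁ : LTerm) (θ ξ : List (LTerm × ℕ))
    (h : ((θ ++ ξ).map Prod.snd).Nodup) (hθ : ∀ x ∈ θ.map Prod.snd, x ∉ FV t₁)
    (hξ : ∀ x ∈ ξ.map Prod.snd, x ∉ FV t₀) :
    Simulates (app (t₀.bind θ) (t₁.bind ξ)) ((app t₀ t₁).bind (θ ++ ξ)) 0 := by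
  have h' := h
  rw [List.map_append, List.nodup_append] at h'
  simp only [FV, Set.mem_ofPred_eq, not_not] at hθ hξ
  intro N w hw
  obtain ⟨b, v, n, m, k, h₁, h₂, h₃, rfl⟩ := ev_app_iff.1 hw
  obtain ⟨n₁, k₁, s₁, h₄, h₅, rfl⟩ := (ev_bind h'.1).1 h₁
  obtain ⟨n₂, k₂, s₂, h₆, h₇, rfl⟩ := (ev_bind h'.2.1).1 h₂
  -- The arguments of ξ are run again from the substitution left by θ. The freshness conditions make
  -- the result agree with s₁ on t₀ and with s₂ on t₁.
  obtain ⟨s₃, h₈, h₉⟩ := h₆.change s₁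
  have e₀ : subst s₃ t₀ = subst s₁ t₀ := subst_ext _ fun x hx =>
    h₈.eq_of_notMem fun hm => hx (hξ x hm)
  have e₁ : subst s₃ t₁ = subst s₂ t₁ := subst_ext _ fun x hx => by
    refine (h₉ x (Or.inl ?_)).symm
    exact (h₄.eq_of_notMem fun hm => hx (hθ x hm)).symm
  have h₄' : EvArgs (app t₀ t₁) var θ n₁ s₁ := h₄.congr fun x hx => by
    simp [occ, hθ x hx]
  have h₈' : EvArgs (app t₀ t₁) s₁ ξ n₂ s₃ := h₈.congr fun x hx => by
    simp [occ, hξ x hx]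
  refine ⟨_, (ev_bind h).2 ⟨_, k₁ + k₂ + betaCost (occ 0 b) (size v) + k, s₃,
    evArgs_append_iff.2 ⟨_, _, _, h₄', h₈', rfl⟩, ?_, rfl⟩, ?_⟩
  · rw [subst, e₀, e₁]
    exact .app h₅ h₇ h₃
  · simp only [size, size_bind, List.map_append, List.sum_append]
    omega

/-- The term λx.x adds 2 to the size and its β-step costs 1. -/
theorem simulates_identity (t₀ : LTerm) (x : ℕ) :
    Simulates t₀ ((var x).bind [(t₀, x)]) 3 := by
  intro n v hv
  refine ⟨_, (ev_bind (by simp)).2 ⟨_, 0, Function.update var x v, .cons hv (.nil _), ?_, rfl⟩, ?_⟩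
  · simpa [subst] using Ev.value hv.isValue
  · have : betaCost 1 (size v) = 1 := by simp only [betaCost]; omega
    simp [size_bind, size, occ, this]
    omega

/-! ### Evaluation of an abstraction under bindings. -/

/-- The first copy is paid for by the argument of the vanishing redex. With the truncated o - 1, a
variable that occurs at most once costs a single unit. -/
theorem betaCost_le (o s T : ℕ) (h : s ≤ T) : betaCost o s ≤ (o - 1) * T + 1 := by
  cases o with
  | zero => simp [betaCost]
  | succ o =>
    have : o * (s - 1) ≤ o * T := Nat.mul_le_mul_left _ (by omega)
    simp only [betaCost, Nat.succ_mul, Nat.add_sub_cancel]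
    omega

/-- The bindings of the variables `l` to their values under `σ`. -/
def binds (σ : ℕ → LTerm) (l : List ℕ) : List (LTerm × ℕ) := l.map fun x => (σ x, x)

@[simp]
theorem map_snd_binds (σ : ℕ → LTerm) (l : List ℕ) : (binds σ l).map Prod.snd = l := by
  simp [binds, Function.comp_def]

theorem binds_append (σ : ℕ → LTerm) (l l' : List ℕ) :
    binds σ (l ++ l') = binds σ l ++ binds σ l' := List.map_append

theorem binds_congr {σ σ' : ℕ → LTerm} {l : List ℕ} (h : ∀ x ∈ l, σ x = σ' x) :
    binds σ l = binds σ' l :=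
  List.map_congr_left fun x hx => by rw [h x hx]

theorem exists_evArgs {ι : Type*} (t : LTerm) (s : ℕ → LTerm) (l : List ι) (f : ι → ℕ)
    (σ : ℕ → LTerm) (T : ι → ℕ) (h : ∀ i ∈ l, EvalBound (σ (f i)) (T i)) :
    ∃ n s', EvArgs t s (binds σ (l.map f)) n s' ∧
      n + (l.map fun i => size (σ (f i)) + 1).sum ≤
        (l.map fun i => (occ (f i) t - 1) * T i + (T i + 2)).sum := by
  induction l generalizing s with
  | nil => exact ⟨0, s, .nil s, le_rfl⟩
  | cons x l ih =>
    obtain ⟨c, v, hv, hc⟩ := evalBound_iff.1 (h x (by simp))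
    obtain ⟨n, s', h₁, h₂⟩ := ih (Function.update s (f x) v) fun y hy => h y (by simp [hy])
    refine ⟨_, s', .cons hv h₁, ?_⟩
    have := betaCost_le (occ (f x) t) (size v) (T x) (hv.size_le.trans hc)
    simp only [List.map_cons, List.sum_cons]
    omega

/-- Once all bindings have been substituted the term is an abstraction, so there is nothing left to
evaluate. Besides the copies, each binding costs T for its argument, 1 for the β-step and 1 for its
λ. -/
theorem evalBound_bind_abs {ι : Type*} (t : LTerm) (z : ℕ) (l : List ι) (f : ι → ℕ)
    (σ : ℕ → LTerm) (T : ι → ℕ) (hl : (l.map f).Nodup)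
    (h : ∀ i ∈ l, EvalBound (σ (f i)) (T i)) :
    EvalBound ((abs z t).bind (binds σ (l.map f)))
      (size t + 1 + (l.map fun i => (occ (f i) (abs z t) - 1) * T i + (T i + 2)).sum) := by
  obtain ⟨n, s', h₁, h₂⟩ := exists_evArgs (abs z t) var l f σ T h
  refine evalBound_iff.2 ⟨_, _, (ev_bind (by simpa using hl)).2
    ⟨n, 0, s', h₁, .value (.lam _), rfl⟩, ?_⟩
  rw [size_bind, size_abs]
  simp only [binds, List.map_map, Function.comp_def]
  omega

theorem bind_append_singleton (t u : LTerm) (θ : List (LTerm × ℕ)) (z : ℕ) :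
    t.bind (θ ++ [(u, z)]) = app ((abs z t).bind θ) u := by
  simp [bind, apps, lams]

end LTerm

/-! ### Renaming, substitution and addition of higher order polynomials. -/

namespace Poly

theorem upRen_comp {Γ Δ Ξ : List Ty} {σ : Ty} (ρ : ∀ τ, Idx Γ τ → Idx Δ τ)
    (ρ' : ∀ τ, Idx Δ τ → Idx Ξ τ) :
    (fun τ i => upRen (σ := σ) ρ' τ (upRen ρ τ i)) = upRen fun τ i => ρ' τ (ρ τ i) := by
  funext τ i
  cases i <;> rfl

theorem rename_rename {Γ Δ Ξ : List Ty} {τ : Ty} (p : Poly Γ τ) (ρ : ∀ τ, Idx Γ τ → Idx Δ τ)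
    (ρ' : ∀ τ, Idx Δ τ → Idx Ξ τ) :
    rename ρ' (rename ρ p) = rename (fun τ i => ρ' τ (ρ τ i)) p := by
  induction p generalizing Δ Ξ with
  | var i => rfl
  | app p q ihp ihq => simp only [rename, ihp, ihq]
  | lam p ih => simp only [rename, ih, upRen_comp]
  | nat n => rfl
  | plus => rfl

theorem subst_rename {Γ Δ Ξ : List Ty} {τ : Ty} (p : Poly Γ τ) (ρ : ∀ τ, Idx Γ τ → Idx Δ τ)
    (s : ∀ τ, Idx Δ τ → Poly Ξ τ) :
    subst s (rename ρ p) = subst (fun τ i => s τ (ρ τ i)) p := by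
  induction p generalizing Δ Ξ with
  | var i => rfl
  | app p q ihp ihq => simp only [rename, subst, ihp, ihq]
  | lam p ih =>
    simp only [rename, subst, ih]
    congr 2
    funext τ i
    cases i <;> rfl
  | nat n => rfl
  | plus => rfl

theorem rename_subst {Γ Δ Ξ : List Ty} {τ : Ty} (p : Poly Γ τ) (s : ∀ τ, Idx Γ τ → Poly Δ τ)
    (ρ : ∀ τ, Idx Δ τ → Idx Ξ τ) :
    rename ρ (subst s p) = subst (fun τ i => rename ρ (s τ i)) p := by
  induction p generalizing Δ Ξ with
  | var i => rfl
  | app p q ihp ihq => simp only [rename, subst, ihp, ihq]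
  | lam p ih =>
    simp only [rename, subst, ih]
    congr 2
    funext τ i
    cases i with
    | zero => rfl
    | succ i => simp only [upSub, wk, rename_rename, upRen]
  | nat n => rfl
  | plus => rfl

theorem subst_subst {Γ Δ Ξ : List Ty} {τ : Ty} (p : Poly Γ τ) (s : ∀ τ, Idx Γ τ → Poly Δ τ)
    (s' : ∀ τ, Idx Δ τ → Poly Ξ τ) :
    subst s' (subst s p) = subst (fun τ i => subst s' (s τ i)) p := by
  induction p generalizing Δ Ξ with
  | var i => rfl
  | app p q ihp ihq => simp only [subst, ihp, ihq]
  | lam p ih =>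
    simp only [subst, ih]
    congr 2
    funext τ i
    cases i with
    | zero => rfl
    | succ i => simp only [upSub, wk, rename_subst, subst_rename]
  | nat n => rfl
  | plus => rfl

theorem subst_var {Γ : List Ty} {τ : Ty} (p : Poly Γ τ) : subst (fun _ i => var i) p = p := by
  induction p with
  | var i => rfl
  | app p q ihp ihq => simp only [subst, ihp, ihq]
  | lam p ih =>
    simp only [subst]
    conv_rhs => rw [← ih]
    congr 2
    funext τ i
    cases i <;> rfl
  | nat n => rfl
  | plus => rfl

theorem rename_wk {Γ Δ : List Ty} {σ τ : Ty} (p : Poly Γ τ) (ρ : ∀ τ, Idx Γ τ → Idx Δ τ) :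
    rename (upRen (σ := σ) ρ) p.wk = (rename ρ p).wk := by
  simp only [wk, rename_rename, upRen]

theorem subst_wk {Γ Δ : List Ty} {σ τ : Ty} (p : Poly Γ τ) (s : ∀ τ, Idx Γ τ → Poly Δ τ) :
    subst (upSub (σ := σ) s) p.wk = (subst s p).wk := by
  simp only [wk, subst_rename, upSub, rename_subst]

theorem subst_single_wk {Γ : List Ty} {σ τ : Ty} (p : Poly Γ τ) (q : Poly Γ σ) :
    subst (single q) p.wk = p := by
  simp only [wk, subst_rename, single, subst_var]

theorem rename_single {Γ Δ : List Ty} {σ τ : Ty} (p : Poly (σ :: Γ) τ) (q : Poly Γ σ)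
    (ρ : ∀ τ, Idx Γ τ → Idx Δ τ) :
    rename ρ (subst (single q) p) = subst (single (rename ρ q)) (rename (upRen ρ) p) := by
  rw [rename_subst, subst_rename]
  congr 1
  funext τ i
  cases i <;> rfl

theorem subst_single_upSub {Γ Δ : List Ty} {σ τ : Ty} (p : Poly (σ :: Γ) τ) (q : Poly Δ σ)
    (s : ∀ τ, Idx Γ τ → Poly Δ τ) (s' : ∀ τ, Idx (σ :: Γ) τ → Poly Δ τ)
    (h₀ : s' σ .zero = q) (h : ∀ τ (i : Idx Γ τ), s' τ i.succ = s τ i) :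
    subst (single q) (subst (upSub s) p) = subst s' p := by
  rw [subst_subst]
  congr 1
  funext τ i
  cases i with
  | zero => exact h₀.symm
  | succ i => rw [upSub, subst_single_wk, h]

theorem Conv.rename {Γ Δ : List Ty} {τ : Ty} {p q : Poly Γ τ} (h : Conv p q)
    (ρ : ∀ τ, Idx Γ τ → Idx Δ τ) : Conv (p.rename ρ) (q.rename ρ) := by
  induction h generalizing Δ with
  | refl p => exact .refl _
  | symm _ ih => exact (ih ρ).symm
  | trans _ _ ih₁ ih₂ => exact (ih₁ ρ).trans (ih₂ ρ)
  | app _ _ ih₁ ih₂ => exact .app (ih₁ ρ) (ih₂ ρ)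
  | lam _ ih => exact .lam (ih _)
  | beta p q =>
    rw [rename_single]
    exact .beta _ _
  | eta p =>
    simp only [Poly.rename, rename_wk, Poly.upRen]
    exact .eta _
  | comm p q => exact .comm _ _
  | assoc p q r => exact .assoc _ _ _
  | zero p => exact .zero _
  | nat m n => exact .nat _ _

theorem Conv.of_eq {Γ : List Ty} {τ : Ty} {p q : Poly Γ τ} (h : p = q) : Conv p q := h ▸ .refl p

theorem Conv.plus₂ {Γ : List Ty} {p p' q q' : Poly Γ .o} (h : Conv p p') (h' : Conv q q') :
    Conv (p.plus₂ q) (p'.plus₂ q') :=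
  .app (.app (.refl _) h) h'

theorem Conv.add {Γ : List Ty} {τ : Ty} {p p' : Poly Γ τ} {q q' : Poly Γ .o} (h : Conv p p')
    (h' : Conv q q') : Conv (p.add q) (p'.add q') := by
  induction τ generalizing Γ with
  | o => exact h.plus₂ h'
  | arrow σ τ _ ih => exact .lam (ih (.app (h.rename _) (.refl _)) (h'.rename _))

theorem rename_add {Γ Δ : List Ty} {τ : Ty} (p : Poly Γ τ) (q : Poly Γ .o)
    (ρ : ∀ τ, Idx Γ τ → Idx Δ τ) : (p.add q).rename ρ = (p.rename ρ).add (q.rename ρ) := by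
  induction τ generalizing Γ Δ with
  | o => rfl
  | arrow σ τ _ ih => simp only [Poly.add, rename, ih, rename_wk, upRen]

theorem subst_add {Γ Δ : List Ty} {τ : Ty} (p : Poly Γ τ) (q : Poly Γ .o)
    (s : ∀ τ, Idx Γ τ → Poly Δ τ) : (p.add q).subst s = (p.subst s).add (q.subst s) := by
  induction τ generalizing Γ Δ with
  | o => rfl
  | arrow σ τ _ ih => simp only [Poly.add, subst, ih, subst_wk, upSub]

theorem subst_zeroAt {Γ Δ : List Ty} (τ : Ty) (s : ∀ τ, Idx Γ τ → Poly Δ τ) :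
    (zeroAt τ).subst s = zeroAt τ := by
  induction τ generalizing Γ Δ with
  | o => rfl
  | arrow σ τ _ ih => simp only [zeroAt, subst, ih]

theorem subst_down {Γ Δ : List Ty} {τ : Ty} (p : Poly Γ τ) (s : ∀ τ, Idx Γ τ → Poly Δ τ) :
    p.down.subst s = (p.subst s).down := by
  induction τ generalizing Γ Δ with
  | o => rfl
  | arrow σ τ _ ih => simp only [Poly.down, ih, subst, subst_zeroAt]

theorem app_add {Γ : List Ty} {σ τ : Ty} (p : Poly Γ (.arrow σ τ)) (q : Poly Γ .o)
    (r : Poly Γ σ) : Conv (app (p.add q) r) ((app p r).add q) := by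
  refine (Conv.beta _ _).trans (.of_eq ?_)
  simp only [subst_add, subst, subst_single_wk, single]

theorem add_add {Γ : List Ty} {τ : Ty} (p : Poly Γ τ) (q r : Poly Γ .o) :
    Conv ((p.add q).add r) (p.add (q.plus₂ r)) := by
  induction τ generalizing Γ with
  | o => exact .assoc _ _ _
  | arrow σ τ _ ih =>
    refine .lam (Conv.trans (.add ?_ (.refl _)) (ih _ _ _))
    rw [wk, rename_add]
    exact app_add _ _ _

theorem add_zero {Γ : List Ty} {τ : Ty} (p : Poly Γ τ) : Conv (p.add (nat 0)) p := by
  induction τ generalizing Γ with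
  | o => exact (Conv.comm _ _).trans (.zero _)
  | arrow σ τ _ ih => exact (Conv.lam (ih _)).trans (.eta _)

theorem add_right_comm {Γ : List Ty} {τ : Ty} (p : Poly Γ τ) (q r : Poly Γ .o) :
    Conv ((p.add q).add r) ((p.add r).add q) :=
  ((add_add p q r).trans (.add (.refl _) (.comm _ _))).trans (add_add p r q).symm

theorem add_nat_add_nat {Γ : List Ty} {τ : Ty} (p : Poly Γ τ) (a b : ℕ) :
    Conv ((p.add (nat a)).add (nat b)) (p.add (nat (a + b))) :=
  (add_add _ _ _).trans (.add (.refl _) (.nat _ _))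

end Poly

/-! ### Denotations of polynomials and their monotonicity. -/

theorem extendEnv_upRen {Γ Δ : List Ty} {σ : Ty} (ρ : ∀ τ, Idx Γ τ → Idx Δ τ)
    (e : ∀ τ, Idx Δ τ → τ.Den) (x : σ.Den) :
    (fun τ i => extendEnv x e τ (Poly.upRen ρ τ i)) = extendEnv x fun τ i => e τ (ρ τ i) := by
  funext τ i
  cases i <;> rfl

namespace Poly

theorem den_rename {Γ Δ : List Ty} {τ : Ty} (p : Poly Γ τ) (ρ : ∀ τ, Idx Γ τ → Idx Δ τ)
    (e : ∀ τ, Idx Δ τ → τ.Den) : (p.rename ρ).den e = p.den fun τ i => e τ (ρ τ i) := by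
  induction p generalizing Δ with
  | var i => rfl
  | app p q ihp ihq => simp only [rename, den, ihp, ihq]
  | lam p ih =>
    funext x
    simp only [rename, den, ih, extendEnv_upRen]
  | nat n => rfl
  | plus => rfl

theorem den_subst {Γ Δ : List Ty} {τ : Ty} (p : Poly Γ τ) (s : ∀ τ, Idx Γ τ → Poly Δ τ)
    (e : ∀ τ, Idx Δ τ → τ.Den) : (p.subst s).den e = p.den fun τ i => (s τ i).den e := by
  induction p generalizing Δ with
  | var i => rfl
  | app p q ihp ihq => simp only [subst, den, ihp, ihq]
  | lam p ih =>
    funext x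
    simp only [subst, den, ih]
    congr 1
    funext τ i
    cases i with
    | zero => rfl
    | succ i => simp only [upSub, wk, den_rename]; rfl
  | nat n => rfl
  | plus => rfl

theorem Conv.den_eq {Γ : List Ty} {τ : Ty} {p q : Poly Γ τ} (h : Conv p q)
    (e : ∀ τ, Idx Γ τ → τ.Den) : p.den e = q.den e := by
  induction h with
  | refl p => rfl
  | symm _ ih => exact (ih e).symm
  | trans _ _ ih₁ ih₂ => exact (ih₁ e).trans (ih₂ e)
  | app _ _ ih₁ ih₂ => simp only [den, ih₁, ih₂]
  | lam _ ih => funext x; exact ih _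
  | beta p q =>
    simp only [den, den_subst]
    congr 1
    funext τ i
    cases i <;> rfl
  | eta p =>
    funext x
    simp only [den, wk, den_rename]
    rfl
  | comm p q => exact Nat.add_comm _ _
  | assoc p q r => exact Nat.add_assoc _ _ _
  | zero p => exact Nat.zero_add _
  | nat m n => rfl

end Poly

/-- The functional that is constantly `0`. -/
def Ty.zeroDen : ∀ τ : Ty, τ.Den
  | .o => (0 : ℕ)
  | .arrow _ τ => fun _ => τ.zeroDen

/-- The value of a functional at zero arguments. -/
def Ty.lowDen : ∀ τ : Ty, τ.Den → ℕ
  | .o, n => n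
  | .arrow σ τ, f => τ.lowDen (f σ.zeroDen)

/-- The pointwise order on functionals that respect it. -/
def Ty.Mono : ∀ τ : Ty, τ.Den → τ.Den → Prop
  | .o, m, n => LE.le (α := ℕ) m n
  | .arrow σ τ, f, g => ∀ x y, σ.Mono x y → σ.Mono x x → σ.Mono y y → τ.Mono (f x) (g y)

theorem Ty.mono_zero (τ : Ty) (x : τ.Den) (h : τ.Mono x x) : τ.Mono τ.zeroDen x := by
  induction τ with
  | o => exact Nat.zero_le _
  | arrow σ τ _ ih => exact fun a b _ _ hb => ih _ (h b b hb hb hb)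

theorem Ty.mono_zero_zero (τ : Ty) : τ.Mono τ.zeroDen τ.zeroDen := by
  induction τ with
  | o => exact Nat.le_refl _
  | arrow σ τ _ ih => exact fun a b _ _ hb => ih

theorem Ty.Mono.lowDen_le {τ : Ty} {x y : τ.Den} (h : τ.Mono x y) : τ.lowDen x ≤ τ.lowDen y := by
  induction τ with
  | o => exact h
  | arrow σ τ _ ih =>
    exact ih (h _ _ σ.mono_zero_zero σ.mono_zero_zero σ.mono_zero_zero)

namespace Poly

/-- The fundamental lemma of the logical relation `Ty.Mono`. The relation is reflexive only on
monotone functionals, hence the two extra hypotheses on the assignments. -/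
theorem den_mono {Γ : List Ty} {τ : Ty} (p : Poly Γ τ) (e e' : ∀ τ, Idx Γ τ → τ.Den)
    (h : ∀ (τ : Ty) i, τ.Mono (e τ i) (e' τ i)) (h₁ : ∀ (τ : Ty) i, τ.Mono (e τ i) (e τ i))
    (h₂ : ∀ (τ : Ty) i, τ.Mono (e' τ i) (e' τ i)) : τ.Mono (p.den e) (p.den e') := by
  induction p with
  | var i => exact h _ i
  | app p q ihp ihq =>
    exact ihp e e' h h₁ h₂ _ _ (ihq e e' h h₁ h₂) (ihq e e h₁ h₁ h₁) (ihq e' e' h₂ h₂ h₂)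
  | lam p ih =>
    intro x y hxy hx hy
    apply ih
    · intro τ i; cases i with
      | zero => exact hxy
      | succ i => exact h _ i
    · intro τ i; cases i with
      | zero => exact hx
      | succ i => exact h₁ _ i
    · intro τ i; cases i with
      | zero => exact hy
      | succ i => exact h₂ _ i
  | nat n => exact Nat.le_refl _
  | plus => exact fun a b hab _ _ c d hcd _ _ => Nat.add_le_add hab hcd

theorem den_zeroAt {Γ : List Ty} (τ : Ty) (e : ∀ τ, Idx Γ τ → τ.Den) :
    (zeroAt τ).den e = τ.zeroDen := by
  induction τ generalizing Γ with
  | o => rfl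
  | arrow σ τ _ ih => funext x; exact ih _

theorem den_down {Γ : List Ty} {τ : Ty} (p : Poly Γ τ) (e : ∀ τ, Idx Γ τ → τ.Den) :
    p.down.den e = τ.lowDen (p.den e) := by
  induction τ with
  | o => rfl
  | arrow σ τ _ ih => rw [down, ih, den, den_zeroAt]; rfl

theorem lowDen_add {Γ : List Ty} {τ : Ty} (p : Poly Γ τ) (q : Poly Γ .o)
    (e : ∀ τ, Idx Γ τ → τ.Den) :
    τ.lowDen ((p.add q).den e) = τ.lowDen (p.den e) + Ty.lowDen .o (q.den e) := by
  induction τ generalizing Γ with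
  | o => rfl
  | arrow σ τ _ ih =>
    simp only [Ty.lowDen, add, den]
    rw [ih]
    simp only [den, wk, den_rename]
    rfl

/-- The assignment for closed polynomials. -/
def emptyEnv : ∀ τ, Idx [] τ → τ.Den := fun _ i => nomatch i

theorem lower_eq {τ : Ty} (p : Poly [] τ) :
    p.lower = τ.lowDen (p.den emptyEnv) := by
  rw [← den_down]
  rfl

theorem value_down {τ : Ty} (p : Poly [] τ) : p.down.value = p.lower := rfl

theorem lower_add {τ : Ty} (p : Poly [] τ) (q : Poly [] .o) :
    (p.add q).lower = p.lower + q.value := by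
  rw [lower_eq, lower_eq, lowDen_add]
  rfl

theorem Conv.lower_eq {τ : Ty} {p q : Poly [] τ} (h : Conv p q) : p.lower = q.lower := by
  rw [Poly.lower_eq, Poly.lower_eq, h.den_eq]

/-- Lowering p feeds it the zero functional, which lies below every monotone argument, in particular
below the one denoted by q. -/
theorem lower_le_lower_app {σ τ : Ty} (p : Poly [] (.arrow σ τ)) (q : Poly [] σ) :
    p.lower ≤ (app p q).lower := by
  rw [lower_eq, lower_eq]
  refine Ty.Mono.lowDen_le (τ := τ) ?_
  have hq : σ.Mono (q.den emptyEnv) (q.den emptyEnv) := den_mono q _ _ nofun nofun nofun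
  exact den_mono p emptyEnv _ nofun nofun nofun _ _ (σ.mono_zero _ hq)
    σ.mono_zero_zero hq

/-! ### Closed polynomials of base type are numerals. -/

/-- Hereditarily computable closed polynomials. -/
def Computable : ∀ {τ : Ty}, Poly [] τ → Prop
  | .o, p => Conv p (nat p.value)
  | .arrow _ _, p => ∀ q, Computable q → Computable (app p q)

theorem Computable.conv {τ : Ty} {p q : Poly [] τ} (hp : Computable p) (h : Conv p q) :
    Computable q := by
  induction τ with
  | o =>
    have : p.value = q.value := h.lower_eq
    simp only [Computable] at hp ⊢
    rw [← this]
    exact h.symm.trans hp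
  | arrow σ τ _ ih => exact fun r hr => ih (hp r hr) (.app h (.refl _))

/-- Tait's argument. An abstraction is treated by extending the substitution with a computable
argument and going back along β. -/
theorem computable_subst {Γ : List Ty} {τ : Ty} (p : Poly Γ τ) (s : ∀ τ, Idx Γ τ → Poly [] τ)
    (hs : ∀ τ i, Computable (s τ i)) : Computable (p.subst s) := by
  induction p with
  | var i => exact hs _ i
  | app p q ihp ihq => exact ihp s hs _ (ihq s hs)
  | @lam Γ σ τ p ih =>
    intro q hq
    let s' : ∀ τ, Idx (σ :: Γ) τ → Poly [] τ := fun _ i => match i with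
      | .zero => q
      | .succ i => s _ i
    refine (ih s' ?_).conv ?_
    · intro τ i
      cases i with
      | zero => exact hq
      | succ i => exact hs _ i
    · refine (Conv.of_eq ?_).trans (Conv.beta _ _).symm
      exact (subst_single_upSub p q s s' rfl fun _ _ => rfl).symm
  | nat n => exact .refl _
  | plus => exact fun a ha b hb => (Conv.plus₂ ha hb).trans (.nat _ _)

theorem conv_nat (p : Poly [] .o) : Conv p (nat p.value) := by
  have := computable_subst p (fun _ i => var i) nofun
  rwa [subst_var] at this

theorem add_conv_nat {τ : Ty} (p : Poly [] τ) (q : Poly [] .o) :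
    Conv (p.add q) (p.add (nat q.value)) :=
  .add (.refl _) (conv_nat q)

end Poly

/-! ### Polynomials as functions of named variables. -/

/-- An assignment of closed polynomials of all types to all variables. -/
abbrev PolyEnv : Type := ℕ → ∀ τ, Poly [] τ

namespace PolyEnv

open Classical in
/-- Changes the value of the variable `z` at the type `σ` to `q`. -/
noncomputable def set (ρ : PolyEnv) (z : ℕ) (σ : Ty) (q : Poly [] σ) : PolyEnv := fun x τ =>
  if x = z then if h : σ = τ then h ▸ q else Poly.zeroAt τ else ρ x τ

@[simp]
theorem set_self (ρ : PolyEnv) (z : ℕ) (σ : Ty) (q : Poly [] σ) : ρ.set z σ q z σ = q := by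
  simp [set]

theorem set_of_ne (ρ : PolyEnv) {x z : ℕ} (h : x ≠ z) (σ : Ty) (q : Poly [] σ) :
    ρ.set z σ q x = ρ x := by
  funext τ
  simp [set, h]

/-- The values of the variables of a context. -/
def args (ρ : PolyEnv) : (Γ : Ctx) → Args Γ.otypes
  | [] => ()
  | c :: Γ => (ρ c.1 c.2.otype, args ρ Γ)

/-- Gives the components of a tuple to the variables of a context. -/
noncomputable def ofArgs (ρ : PolyEnv) : (Γ : Ctx) → Args Γ.otypes → PolyEnv
  | [], _ => ρ
  | c :: Γ, qs => (ofArgs ρ Γ qs.2).set c.1 c.2.otype qs.1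

theorem args_congr {ρ ρ' : PolyEnv} {Γ : Ctx} (h : ∀ x ∈ Γ.names, ρ x = ρ' x) :
    ρ.args Γ = ρ'.args Γ := by
  induction Γ with
  | nil => rfl
  | cons c Γ ih =>
    simp only [Ctx.names, List.map_cons, List.mem_cons, forall_eq_or_imp] at h
    simp only [args, h.1]
    rw [ih h.2]

theorem ofArgs_of_notMem (ρ : PolyEnv) (Γ : Ctx) (qs : Args Γ.otypes) {x : ℕ}
    (h : x ∉ Γ.names) : ρ.ofArgs Γ qs x = ρ x := by
  induction Γ with
  | nil => rfl
  | cons c Γ ih =>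
    simp only [Ctx.names, List.map_cons, List.mem_cons, not_or] at h
    rw [ofArgs, set_of_ne _ h.1, ih _ h.2]

theorem args_ofArgs (ρ : PolyEnv) (Γ : Ctx) (qs : Args Γ.otypes) (h : Γ.names.Nodup) :
    (ρ.ofArgs Γ qs).args Γ = qs := by
  induction Γ with
  | nil => rfl
  | cons c Γ ih =>
    simp only [Ctx.names, List.map_cons, List.nodup_cons] at h
    simp only [args, ofArgs, set_self]
    rw [args_congr (ρ' := ρ.ofArgs Γ qs.2), ih _ h.2]
    · rfl
    · intro x hx
      exact set_of_ne _ (ne_of_mem_of_not_mem hx h.1) _ _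

theorem exists_idx {Γ : Ctx} {c : ℕ × Formula} (h : c ∈ Γ) :
    ∃ i : Idx Γ.otypes c.2.otype, ∀ ρ : PolyEnv, (ρ.args Γ).get _ i = ρ c.1 c.2.otype := by
  induction Γ with
  | nil => cases h
  | cons d Γ ih =>
    rcases List.mem_cons.1 h with rfl | h
    · exact ⟨.zero, fun ρ => rfl⟩
    · obtain ⟨i, hi⟩ := ih h
      exact ⟨.succ i, fun ρ => hi ρ⟩

theorem get_args {Γ : Ctx} {τ : Ty} (i : Idx Γ.otypes τ) :
    ∃ c ∈ Γ, c.2.otype = τ ∧ ∀ ρ : PolyEnv, (ρ.args Γ).get _ i = ρ c.1 τ := by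
  induction Γ with
  | nil => cases i
  | cons d Γ ih =>
    match i with
    | .zero => exact ⟨d, by simp, rfl, fun ρ => rfl⟩
    | .succ i =>
      obtain ⟨c, hc, h, hi⟩ := ih i
      exact ⟨c, by simp [hc], h, fun ρ => hi ρ⟩

end PolyEnv

/-- `F` is given by a polynomial in the variables of the context `Γ`. -/
def Definable (Γ : Ctx) (τ : Ty) (F : PolyEnv → Poly [] τ) : Prop :=
  ∃ p : Poly Γ.otypes τ, ∀ ρ, F ρ = p.eval (ρ.args Γ)

namespace Definable

variable {Γ Γ' : Ctx} {σ τ : Ty}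

/-- Variables are addressed by name, so a context behaves like a set of declarations. The identity
covers permutation and weakening; an f that is not injective covers contraction. -/
theorem rename {F : PolyEnv → Poly [] τ} (hF : Definable Γ τ F) (f : ℕ → ℕ)
    (h : ∀ c ∈ Γ, (f c.1, c.2) ∈ Γ') : Definable Γ' τ fun ρ => F fun x => ρ (f x) := by
  have : ∀ τ (i : Idx Γ.otypes τ), ∃ j : Idx Γ'.otypes τ, ∀ ρ : PolyEnv,
      (ρ.args Γ').get _ j = (PolyEnv.args (fun x => ρ (f x)) Γ).get _ i := by
    intro τ i
    obtain ⟨c, hc, rfl, hi⟩ := PolyEnv.get_args i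
    obtain ⟨j, hj⟩ := PolyEnv.exists_idx (h c hc)
    exact ⟨j, fun ρ => (hj ρ).trans (hi fun x => ρ (f x)).symm⟩
  choose r hr using this
  obtain ⟨p, hp⟩ := hF
  refine ⟨p.rename r, fun ρ => ?_⟩
  dsimp only
  rw [hp, Poly.eval, Poly.eval, Poly.subst_rename]
  congr 1
  funext τ i
  exact (hr τ i ρ).symm

theorem mono {F : PolyEnv → Poly [] τ} (hF : Definable Γ τ F) (h : ∀ c ∈ Γ, c ∈ Γ') :
    Definable Γ' τ F :=
  hF.rename id h

theorem var {c : ℕ × Formula} (h : c ∈ Γ) : Definable Γ c.2.otype fun ρ => ρ c.1 c.2.otype := by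
  obtain ⟨i, hi⟩ := PolyEnv.exists_idx h
  exact ⟨.var i, fun ρ => (hi ρ).symm⟩

theorem nat (n : ℕ) : Definable Γ .o fun _ => .nat n := ⟨.nat n, fun _ => rfl⟩

theorem app {F : PolyEnv → Poly [] (.arrow σ τ)} {G : PolyEnv → Poly [] σ}
    (hF : Definable Γ _ F) (hG : Definable Γ σ G) :
    Definable Γ τ fun ρ => (F ρ).app (G ρ) := by
  obtain ⟨p, hp⟩ := hF
  obtain ⟨q, hq⟩ := hG
  exact ⟨p.app q, fun ρ => by dsimp only; rw [hp, hq]; rfl⟩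

theorem add {F : PolyEnv → Poly [] τ} {G : PolyEnv → Poly [] .o}
    (hF : Definable Γ _ F) (hG : Definable Γ _ G) :
    Definable Γ τ fun ρ => (F ρ).add (G ρ) := by
  obtain ⟨p, hp⟩ := hF
  obtain ⟨q, hq⟩ := hG
  exact ⟨p.add q, fun ρ => by
    dsimp only; rw [hp, hq, Poly.eval, Poly.eval, Poly.eval, Poly.subst_add]⟩

theorem down {F : PolyEnv → Poly [] τ} (hF : Definable Γ _ F) :
    Definable Γ .o fun ρ => (F ρ).down := by
  obtain ⟨p, hp⟩ := hF
  exact ⟨p.down, fun ρ => by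
    dsimp only; rw [hp, Poly.eval, Poly.eval, Poly.subst_down]⟩

/-- Abstraction over a named variable; its defining property is a β-step, hence holds only up to
conversion. -/
theorem lam {A : Formula} {z : ℕ} {F : PolyEnv → Poly [] τ} (hF : Definable ((z, A) :: Γ) τ F)
    (hz : z ∉ Γ.names) : ∃ G, Definable Γ (.arrow A.otype τ) G ∧
      ∀ ρ q, Poly.Conv ((G ρ).app q) (F (ρ.set z A.otype q)) := by
  obtain ⟨p, hp⟩ := hF
  let G : PolyEnv → Poly [] (.arrow A.otype τ) := fun ρ =>
    Poly.eval (Γ := Γ.otypes) (Poly.lam p) (ρ.args Γ)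
  refine ⟨G, ⟨Poly.lam p, fun ρ => rfl⟩, fun ρ q => ?_⟩
  refine (Poly.Conv.beta _ _).trans (.of_eq ?_)
  rw [hp, Poly.eval]
  apply Poly.subst_single_upSub
  · exact PolyEnv.set_self _ _ _ _
  · intro τ i
    change ((ρ.set z A.otype q).args Γ).get τ i = _
    rw [PolyEnv.args_congr (ρ' := ρ)]
    exact fun x hx => PolyEnv.set_of_ne _ (ne_of_mem_of_not_mem hx hz) _ _

/-- The fee for a list of bindings. It is used with k = 2: one unit for the λ and one for the β-step
of each binding. -/
theorem sum_down (l : Ctx) (h : ∀ c ∈ l, c ∈ Γ) (k : ℕ) : ∃ F, Definable Γ .o F ∧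
    ∀ ρ, (F ρ).value = (l.map fun c => (ρ c.1 c.2.otype).lower + k).sum := by
  induction l with
  | nil => exact ⟨_, nat 0, fun ρ => rfl⟩
  | cons c l ih =>
    obtain ⟨F, hF, hv⟩ := ih fun d hd => h d (by simp [hd])
    refine ⟨_, ((var (h c (by simp))).down.add (nat k)).add hF, fun ρ => ?_⟩
    rw [List.map_cons, List.sum_cons, ← hv]
    rfl

end Definable

theorem addArgs_conv (ρ : PolyEnv) (Δ : Ctx) {τ : Ty} (p : Poly [] τ) :
    Poly.Conv (p.addArgs (ρ.args Δ))
      (p.add (.nat (Δ.map fun c => (ρ c.1 c.2.otype).lower).sum)) := by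
  induction Δ generalizing p with
  | nil => exact (Poly.add_zero p).symm
  | cons c Δ ih =>
    refine (ih _).trans ?_
    refine (Poly.Conv.add (Poly.add_conv_nat _ _) (.refl _)).trans ?_
    exact Poly.add_nat_add_nat _ _ _

open LTerm

/-! ## Saturated sets -/

theorem isSaturated_evalBound (τ : Ty) :
    IsSaturated τ {x : LTerm × Poly [] τ | EvalBound x.1 x.2.lower} where
  resp t p q hpq h := by
    change EvalBound t q.lower
    rw [← hpq.lower_eq]; exact h
  bound t p h := h
  monotonicity t p n h := by
    change EvalBound t (p.add (.nat n)).lower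
    rw [Poly.lower_add]
    exact ⟨h.1, h.2.trans (Nat.le_add_right _ _)⟩
  exchange t₀ v₁ v₂ y₁ y₂ θ ξ vs p hn h :=
    ((simulates_exchange t₀ v₁ v₂ y₁ y₂ θ ξ hn).apps vs).evalBound h
  weakening t₀ w z θ vs p hn hz hw h := by
    change EvalBound _ (p.add (.nat _)).lower
    rw [Poly.lower_add]
    exact ((simulates_weakening t₀ w z θ hn hz hw).apps vs).evalBound h
  contraction t₀ w z z₁ z₂ θ vs p hn hz hz₀ h :=
    ((simulates_contraction t₀ w z z₁ z₂ θ hn hz hz₀).apps vs).evalBound h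
  concatenation t₀ t₁ θ ξ vs p hn hθ hξ h :=
    ((simulates_concatenation t₀ t₁ θ ξ hn hθ hξ).apps vs).evalBound h
  identity t₀ x vs p h := by
    change EvalBound _ (p.add (.nat _)).lower
    rw [Poly.lower_add]
    exact ((simulates_identity t₀ x).apps vs).evalBound h

theorem isSaturated_forall {ι : Type*} {τ : Ty} (P : ι → Prop)
    (X : ι → Set (LTerm × Poly [] τ)) (h : ∀ i, P i → IsSaturated τ (X i)) (hP : ∃ i, P i) :
    IsSaturated τ {x | ∀ i, P i → x ∈ X i} where
  resp t p q hpq hx i hi := (h i hi).resp t p q hpq (hx i hi)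
  bound t p hx := let ⟨i, hi⟩ := hP; (h i hi).bound t p (hx i hi)
  monotonicity t p n hx i hi := (h i hi).monotonicity t p n (hx i hi)
  exchange _ _ _ _ _ _ _ _ _ hn hx i hi := (h i hi).exchange _ _ _ _ _ _ _ _ _ hn (hx i hi)
  weakening _ _ _ _ _ _ hn hz hw hx i hi := (h i hi).weakening _ _ _ _ _ _ hn hz hw (hx i hi)
  contraction _ _ _ _ _ _ _ _ hn hz hz₀ hx i hi :=
    (h i hi).contraction _ _ _ _ _ _ _ _ hn hz hz₀ (hx i hi)
  concatenation _ _ _ _ _ _ hn hθ hξ hx i hi :=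
    (h i hi).concatenation _ _ _ _ _ _ hn hθ hξ (hx i hi)
  identity _ _ _ _ hx i hi := (h i hi).identity _ _ _ _ (hx i hi)

theorem app_apps (t u : LTerm) (vs : List LTerm) : app (apps t vs) u = apps t (vs ++ [u]) := by
  simp [apps]

/-- Since every closure condition allows trailing arguments, it can be applied with u appended to
them. The map f i is addition of a number for the linear arrow and application to a polynomial for
the other arrow; both commute with adding constants. -/
theorem isSaturated_arrow {ι : Type*} {σ τ : Ty} {X : Set (LTerm × Poly [] τ)}
    (hX : IsSaturated τ X) (u : ι → LTerm) (f : ι → Poly [] σ → Poly [] τ)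
    (hf : ∀ i p q, Poly.Conv p q → Poly.Conv (f i p) (f i q))
    (hf' : ∀ i p n, Poly.Conv ((f i p).add (.nat n)) (f i (p.add (.nat n)))) :
    IsSaturated σ {x | EvalBound x.1 x.2.lower ∧ ∀ i, (app x.1 (u i), f i x.2) ∈ X} where
  resp t p q hpq h :=
    ⟨(isSaturated_evalBound σ).resp t p q hpq h.1, fun i => hX.resp _ _ _ (hf i p q hpq) (h.2 i)⟩
  bound t p h := h.1
  monotonicity t p n h :=
    ⟨(isSaturated_evalBound σ).monotonicity t p n h.1, fun i =>
      hX.resp _ _ _ (hf' i p n) (hX.monotonicity _ _ n (h.2 i))⟩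
  exchange t₀ v₁ v₂ y₁ y₂ θ ξ vs p hn h := by
    refine ⟨(isSaturated_evalBound σ).exchange _ _ _ _ _ _ _ _ p hn h.1, fun i => ?_⟩
    have := h.2 i
    rw [app_apps] at this ⊢
    exact hX.exchange _ _ _ _ _ _ _ _ _ hn this
  weakening t₀ w z θ vs p hn hz hw h := by
    refine ⟨(isSaturated_evalBound σ).weakening _ _ _ _ _ p hn hz hw h.1, fun i => ?_⟩
    have := h.2 i
    rw [app_apps] at this ⊢
    exact hX.resp _ _ _ (hf' i p _) (hX.weakening _ _ _ _ _ _ hn hz hw this)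
  contraction t₀ w z z₁ z₂ θ vs p hn hz hz₀ h := by
    refine ⟨(isSaturated_evalBound σ).contraction _ _ _ _ _ _ _ p hn hz hz₀ h.1, fun i => ?_⟩
    have := h.2 i
    rw [app_apps] at this ⊢
    exact hX.contraction _ _ _ _ _ _ _ _ hn hz hz₀ this
  concatenation t₀ t₁ θ ξ vs p hn hθ hξ h := by
    refine ⟨(isSaturated_evalBound σ).concatenation _ _ _ _ _ p hn hθ hξ h.1, fun i => ?_⟩
    have := h.2 i
    rw [app_apps] at this ⊢
    exact hX.concatenation _ _ _ _ _ _ hn hθ hξ this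
  identity t₀ x vs p h := by
    refine ⟨(isSaturated_evalBound σ).identity _ _ _ p h.1, fun i => ?_⟩
    have := h.2 i
    rw [app_apps] at this ⊢
    exact hX.resp _ _ _ (hf' i p _) (hX.identity _ _ _ _ this)

/-- The largest saturated set of type `o`. -/
def topSat : SatSet := ⟨_, isSaturated_evalBound .o⟩

theorem isSaturated_realizes (A : Formula) (η : Valuation) :
    IsSaturated A.otype {x | Realizes A η x.1 x.2} := by
  induction A generalizing η with
  | var α => exact (η α).2
  | all A ih =>
    have := isSaturated_forall (fun _ : SatSet => True) _ (fun X _ => ih (η.push X))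
      ⟨topSat, trivial⟩
    simp only [true_imp_iff] at this
    exact this
  | mu L ih =>
    exact isSaturated_forall (fun X : SatSet => ∀ (u : LTerm) (q : Poly [] L.otype),
      Realizes L (η.push X) u q → (u, q.down) ∈ X.1) (fun X => X.1) (fun X _ => X.2)
      -- The family to be intersected is nonempty: the largest saturated set is closed under L,
      -- since all realizers satisfy the time bound.
      ⟨topSat, fun u q hq => (ih _).bound u q hq⟩
  | lolli L A _ ihA =>
    have := isSaturated_arrow (ι := {x : LTerm × Poly [] L.otype // Realizes L η x.1 x.2})
      (σ := A.otype) (ihA η) (fun i => i.1.1) (fun i p => p.add i.1.2.down)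
      (fun i p q h => .add h (.refl _)) (fun i p n => Poly.add_right_comm _ _ _)
    simp only [Subtype.forall, Prod.forall] at this
    exact this
  | imp B A _ ihA =>
    have := isSaturated_arrow (ι := {x : LTerm × Poly [] B.otype // Realizes B η x.1 x.2})
      (σ := .arrow B.otype A.otype) (ihA η) (fun i => i.1.1) (fun i p => p.app i.1.2)
      (fun i p q h => .app h (.refl _)) (fun i p n => (Poly.app_add _ _ _).symm)
    simp only [Subtype.forall, Prod.forall] at this
    exact this

/-! ## Monotonicity and substitution -/

open Formula in
-- Each inclusion may be replaced by the polarity that makes it irrelevant. A variable that does not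
-- occur has both polarities, so the same lemma says that its value does not matter.
theorem Realizes.mono {A : Formula} {η η' : Valuation}
    (h : ∀ α, ((η α).1 ⊆ (η' α).1 ∨ OccursOnly false α A) ∧
      ((η' α).1 ⊆ (η α).1 ∨ OccursOnly true α A)) {t : LTerm} {p : Poly [] A.otype}
    (ht : Realizes A η t p) : Realizes A η' t p := by
  induction A generalizing η η' t with
  | var α =>
    rcases (h α).1 with h | h
    · exact h ht
    · exact absurd (h rfl) (by simp)
  | all A ih =>
    intro X
    refine ih (fun α => ?_) (ht X)
    cases α with
    | zero => exact ⟨.inl subset_rfl, .inl subset_rfl⟩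
    | succ α => exact h α
  | mu L ih =>
    intro X hX
    refine ht X fun u q hq => hX u q (ih (fun α => ?_) hq)
    cases α with
    | zero => exact ⟨.inl subset_rfl, .inl subset_rfl⟩
    | succ α => exact h α
  | lolli L A ihL ihA =>
    refine ⟨ht.1, fun u m hu => ihA (fun α => ?_) (ht.2 u m (ihL (fun α => ?_) hu))⟩
    · exact ⟨(h α).1.imp_right fun h => h.2, (h α).2.imp_right fun h => h.2⟩
    · exact ⟨(h α).2.imp_right fun h => h.1, (h α).1.imp_right fun h => h.1⟩
  | imp L A ihL ihA =>
    refine ⟨ht.1, fun u m hu => ihA (fun α => ?_) (ht.2 u m (ihL (fun α => ?_) hu))⟩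
    · exact ⟨(h α).1.imp_right fun h => h.2, (h α).2.imp_right fun h => h.2⟩
    · exact ⟨(h α).2.imp_right fun h => h.1, (h α).1.imp_right fun h => h.1⟩

/-! ### Formulas with the same realizers. -/

namespace Poly

/-- The types o(A[L/α]) and o(A) agree only propositionally, so polynomials attached to them are
compared by heterogeneous equality. -/
theorem lower_congr {σ τ : Ty} (h : σ = τ) {p : Poly [] σ} {q : Poly [] τ} (hpq : HEq p q) :
    p.lower = q.lower := by
  subst h; cases hpq; rfl

theorem down_congr {σ τ : Ty} (h : σ = τ) {p : Poly [] σ} {q : Poly [] τ} (hpq : HEq p q) :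
    p.down = q.down := by
  subst h; cases hpq; rfl

theorem down_heq {τ : Ty} (h : τ = .o) (p : Poly [] τ) : HEq p.down p := by
  subst h; rfl

theorem add_congr {σ τ : Ty} (h : σ = τ) {p : Poly [] σ} {q : Poly [] τ} (hpq : HEq p q)
    {r s : Poly [] .o} (hrs : r = s) : HEq (p.add r) (q.add s) := by
  subst h; cases hpq; cases hrs; rfl

theorem app_congr {σ σ' τ τ' : Ty} (hσ : σ = σ') (hτ : τ = τ') {p : Poly [] (.arrow σ τ)}
    {p' : Poly [] (.arrow σ' τ')} (hp : HEq p p') {q : Poly [] σ} {q' : Poly [] σ'}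
    (hq : HEq q q') : HEq (p.app q) (p'.app q') := by
  subst hσ; subst hτ; cases hp; cases hq; rfl

end Poly

/-- `A` under `η` and `A'` under `η'` have the same realizers. -/
def SameRealizers (A : Formula) (η : Valuation) (A' : Formula) (η' : Valuation) : Prop :=
  A.otype = A'.otype ∧ ∀ (t : LTerm) (p : Poly [] A.otype) (p' : Poly [] A'.otype), HEq p p' →
    (Realizes A η t p ↔ Realizes A' η' t p')

namespace SameRealizers

variable {A A' B B' : Formula} {η η' : Valuation}

theorem symm (h : SameRealizers A η A' η') : SameRealizers A' η' A η :=
  ⟨h.1.symm, fun t p p' hp => (h.2 t p' p hp.symm).symm⟩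

theorem mp (h : SameRealizers A η A' η') {t : LTerm} {p : Poly [] A.otype}
    (ht : Realizes A η t p) : Realizes A' η' t (cast (congrArg (Poly []) h.1) p) :=
  (h.2 t p _ (cast_heq _ _).symm).1 ht

theorem all (h : ∀ X, SameRealizers A (η.push X) A' (η'.push X)) :
    SameRealizers (.all A) η (.all A') η' :=
  ⟨(h topSat).1, fun t p p' hp => forall_congr' fun X => (h X).2 t p p' hp⟩

theorem mu_of_imp (h : ∀ X, SameRealizers A (η.push X) A' (η'.push X)) {t : LTerm}
    {p : Poly [] .o} (ht : Realizes (.mu A) η t p) : Realizes (.mu A') η' t p := by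
  intro X hX
  refine ht X fun u q hq => ?_
  rw [Poly.down_congr (h X).1 (cast_heq (congrArg (Poly []) (h X).1) q).symm]
  exact hX u _ ((h X).mp hq)

theorem mu (h : ∀ X, SameRealizers A (η.push X) A' (η'.push X)) :
    SameRealizers (.mu A) η (.mu A') η' := by
  refine ⟨rfl, fun t p p' hp => ?_⟩
  cases hp
  exact ⟨mu_of_imp h, mu_of_imp fun X => (h X).symm⟩

theorem lolli_mp (hA : SameRealizers A η A' η') (hB : SameRealizers B η B' η') (t : LTerm)
    (p : Poly [] B.otype) (p' : Poly [] B'.otype) (hp : HEq p p')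
    (ht : Realizes (.lolli A B) η t p) : Realizes (.lolli A' B') η' t p' := by
  refine ⟨?_, fun u m hu => ?_⟩
  · rw [← Poly.lower_congr hB.1 hp]; exact ht.1
  · refine (hB.2 _ _ _ (Poly.add_congr hB.1 hp ?_)).1 (ht.2 u _ (hA.symm.mp hu))
    exact Poly.down_congr hA.1 (cast_heq _ _)

theorem lolli (hA : SameRealizers A η A' η') (hB : SameRealizers B η B' η') :
    SameRealizers (.lolli A B) η (.lolli A' B') η' :=
  ⟨hB.1, fun t p p' hp => ⟨lolli_mp hA hB t p p' hp, lolli_mp hA.symm hB.symm t p' p hp.symm⟩⟩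

theorem imp_mp (hA : SameRealizers A η A' η') (hB : SameRealizers B η B' η') (t : LTerm)
    (p : Poly [] (.arrow A.otype B.otype)) (p' : Poly [] (.arrow A'.otype B'.otype))
    (hp : HEq p p') (ht : Realizes (.imp A B) η t p) : Realizes (.imp A' B') η' t p' := by
  refine ⟨?_, fun u m hu => ?_⟩
  · rw [← Poly.lower_congr (congrArg₂ Ty.arrow hA.1 hB.1) hp]; exact ht.1
  · exact (hB.2 _ _ _ (Poly.app_congr hA.1 hB.1 hp (cast_heq _ _))).1 (ht.2 u _ (hA.symm.mp hu))

theorem imp (hA : SameRealizers A η A' η') (hB : SameRealizers B η B' η') :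
    SameRealizers (.imp A B) η (.imp A' B') η' :=
  ⟨congrArg₂ Ty.arrow hA.1 hB.1,
    fun t p p' hp => ⟨imp_mp hA hB t p p' hp, imp_mp hA.symm hB.symm t p' p hp.symm⟩⟩

theorem refl (A : Formula) (η : Valuation) : SameRealizers A η A η :=
  ⟨rfl, fun t p p' hp => by cases hp; rfl⟩

end SameRealizers

theorem sameRealizers_rename (A : Formula) (f : ℕ → ℕ) (η : Valuation) :
    SameRealizers (A.rename f) η A fun α => η (f α) := by
  have push : ∀ (f : ℕ → ℕ) (η : Valuation) (X : SatSet),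
      (fun α => η.push X (upRen f α)) = Valuation.push X fun α => η (f α) := by
    intro f η X
    funext α
    cases α <;> rfl
  induction A generalizing f η with
  | var α => exact .refl (.var (f α)) η
  | all A ih => exact .all fun X => push f η X ▸ ih (upRen f) (η.push X)
  | mu A ih => exact .mu fun X => push f η X ▸ ih (upRen f) (η.push X)
  | lolli A B ihA ihB => exact .lolli (ihA f η) (ihB f η)
  | imp A B ihA ihB => exact .imp (ihA f η) (ihB f η)

/-- The saturated set of the realizers of a formula of base type. -/
def satOf (L : Formula) (h : L.otype = .o) (η : Valuation) : SatSet :=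
  ⟨{x | Realizes L η x.1 (cast (congrArg (Poly []) h.symm) x.2)}, by
    have key : ∀ {σ τ : Ty} (h : τ = σ) (X : Set (LTerm × Poly [] σ)), IsSaturated σ X →
        IsSaturated τ {x | (x.1, cast (congrArg (Poly []) h) x.2) ∈ X} := by
      intro σ τ h X hX
      subst h
      exact hX
    exact key h.symm _ (isSaturated_realizes L η)⟩

theorem mem_satOf {L : Formula} {h : L.otype = .o} {η : Valuation} {t : LTerm} {p : Poly [] .o} :
    (t, p) ∈ (satOf L h η).1 ↔ Realizes L η t (cast (congrArg (Poly []) h.symm) p) := Iff.rfl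

theorem SameRealizers.satOf_eq {L L' : Formula} {η η' : Valuation}
    (h : SameRealizers L η L' η') (h₁ : L.otype = .o) (h₂ : L'.otype = .o) :
    satOf L h₁ η = satOf L' h₂ η' := by
  apply Subtype.ext
  ext ⟨t, p⟩
  exact h.2 t _ _ ((cast_heq _ _).trans (cast_heq _ _).symm)

theorem otype_upSub {s : ℕ → Formula} (hs : ∀ α, (s α).otype = .o) (α : ℕ) :
    (Formula.upSub s α).otype = .o := by
  cases α with
  | zero => rfl
  | succ α => exact (sameRealizers_rename (s α) Nat.succ fun _ => topSat).1.trans (hs α)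

/-- Formulas of type o have saturated sets of type o as their realizers, and these are exactly the
values that a valuation may take. -/
theorem sameRealizers_subst (A : Formula) (s : ℕ → Formula) (hs : ∀ α, (s α).otype = .o)
    (η : Valuation) : SameRealizers (A.subst s) η A fun α => satOf (s α) (hs α) η := by
  have push : ∀ (s : ℕ → Formula) (hs : ∀ α, (s α).otype = .o) (η : Valuation) (X : SatSet),
      (fun α => satOf (Formula.upSub s α) (otype_upSub hs α) (η.push X)) =
        Valuation.push X fun α => satOf (s α) (hs α) η := by
    intro s hs η X
    funext α
    cases α with
    | zero => rfl
    | succ α => exact (sameRealizers_rename (s α) Nat.succ (η.push X)).satOf_eq _ (hs α)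
  induction A generalizing s η with
  | var α =>
    refine ⟨hs α, fun t p p' hp => ?_⟩
    change _ ↔ Realizes (s α) η t (cast _ p')
    rw [eq_of_heq (hp.trans (cast_heq (congrArg (Poly []) (hs α).symm) p').symm)]
    exact Iff.rfl
  | all A ih => exact .all fun X => push s hs η X ▸ ih (Formula.upSub s) (otype_upSub hs) (η.push X)
  | mu A ih => exact .mu fun X => push s hs η X ▸ ih (Formula.upSub s) (otype_upSub hs) (η.push X)
  | lolli A B ihA ihB => exact .lolli (ihA s hs η) (ihB s hs η)
  | imp A B ihA ihB => exact .imp (ihA s hs η) (ihB s hs η)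

theorem sameRealizers_inst (A L : Formula) (h : L.otype = .o) (η : Valuation) :
    SameRealizers (A.inst L) η A (η.push (satOf L h η)) := by
  have hs : ∀ α, ((fun n => match n with
    | 0 => L
    | k + 1 => .var k : ℕ → Formula) α).otype = .o := by
    rintro (_ | α)
    · exact h
    · rfl
  have key := sameRealizers_subst A _ hs η
  rw [show (fun α => satOf _ (hs α) η) = η.push (satOf L h η) from
    funext (by rintro (_ | α) <;> rfl)] at key
  exact key

open Formula in
-- Knaster–Tarski. By positivity, L(μ) lies in every set closed under L, hence in μ; then L(μ) is
-- itself closed under L, and μ, being least, lies in it.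
theorem sameRealizers_mu (L : Formula) (h : L.otype = .o) (hL : OccursOnly true 0 L)
    (η : Valuation) : SameRealizers L (η.push (satOf (.mu L) rfl η)) (.mu L) η := by
  have le : ∀ (u : LTerm) (q : Poly [] L.otype),
      Realizes L (η.push (satOf (.mu L) rfl η)) u q → Realizes (.mu L) η u q.down := by
    intro u q hq X hX
    refine hX u q (hq.mono fun α => ?_)
    cases α with
    | zero => exact ⟨.inl fun x hx => hx X hX, .inr hL⟩
    | succ α => exact ⟨.inl subset_rfl, .inl subset_rfl⟩
  refine ⟨h, fun t p p' hp => ?_⟩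
  obtain rfl : p.down = p' := eq_of_heq ((Poly.down_heq h p).trans hp)
  refine ⟨le t p, fun ht => ?_⟩
  -- Leastness is applied to the saturated set L(μ); the remaining goal says that it is closed under
  -- L.
  have := ht (satOf L h (η.push (satOf (.mu L) rfl η))) fun u q hq => ?_
  · replace this : Realizes L _ t (cast _ p.down) := this
    rwa [eq_of_heq ((cast_heq _ _).trans (Poly.down_heq h p))] at this
  · rw [mem_satOf, eq_of_heq ((cast_heq _ _).trans (Poly.down_heq h q))]
    refine hq.mono fun α => ?_
    cases α with
    | zero =>
      refine ⟨.inl ?_, .inr hL⟩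
      rintro ⟨v, r⟩ hr
      have := le _ _ ((mem_satOf (h := h)).1 hr)
      rw [eq_of_heq ((Poly.down_heq h _).trans (cast_heq _ _))] at this
      exact this
    | succ α => exact ⟨.inl subset_rfl, .inl subset_rfl⟩

/-! ## Invariants of derivations -/

namespace Formula

theorem NoImp.otype_eq {L : Formula} (h : NoImp L) : L.otype = .o := by
  induction L with
  | var α => rfl
  | all A ih => exact ih h
  | mu L _ => rfl
  | lolli A B _ ihB => exact ihB h.2
  | imp A B _ _ => exact h.elim

theorem IsLinear.otype_eq {L : Formula} (h : L.IsLinear) : L.otype = .o := h.2.otype_eq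

theorem occursOnly_of_not_occurs {A : Formula} {k : ℕ} (h : ¬ Occurs k A) (b : Bool) :
    OccursOnly b k A := by
  induction A generalizing k b with
  | var α => exact fun e => absurd e h
  | all A ih => exact ih h b
  | mu L ih => exact ih h b
  | lolli A B ihA ihB => exact ⟨ihA (fun e => h (.inl e)) _, ihB (fun e => h (.inr e)) _⟩
  | imp A B ihA ihB => exact ⟨ihA (fun e => h (.inl e)) _, ihB (fun e => h (.inr e)) _⟩

theorem upRen_eq_succ {f : ℕ → ℕ} {j k : ℕ} (h : upRen f j = k + 1) :
    ∃ i, j = i + 1 ∧ f i = k := by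
  cases j with
  | zero => cases h
  | succ i => exact ⟨i, rfl, Nat.succ.inj h⟩

theorem Occurs.of_rename {A : Formula} {f : ℕ → ℕ} {k : ℕ} (h : Occurs k (A.rename f)) :
    ∃ j, f j = k ∧ Occurs j A := by
  induction A generalizing f k with
  | var α => exact ⟨α, h, rfl⟩
  | all A ih =>
    obtain ⟨j, hj, ho⟩ := ih h
    obtain ⟨i, rfl, hi⟩ := upRen_eq_succ hj
    exact ⟨i, hi, ho⟩
  | mu A ih =>
    obtain ⟨j, hj, ho⟩ := ih h
    obtain ⟨i, rfl, hi⟩ := upRen_eq_succ hj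
    exact ⟨i, hi, ho⟩
  | lolli A B ihA ihB =>
    rcases h with h | h
    · obtain ⟨j, hj, ho⟩ := ihA h
      exact ⟨j, hj, .inl ho⟩
    · obtain ⟨j, hj, ho⟩ := ihB h
      exact ⟨j, hj, .inr ho⟩
  | imp A B ihA ihB =>
    rcases h with h | h
    · obtain ⟨j, hj, ho⟩ := ihA h
      exact ⟨j, hj, .inl ho⟩
    · obtain ⟨j, hj, ho⟩ := ihB h
      exact ⟨j, hj, .inr ho⟩

theorem OccursOnly.rename {A : Formula} {f : ℕ → ℕ} {k k' : ℕ} {b : Bool}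
    (h : OccursOnly b k A) (hf : ∀ j, f j = k' → j = k) : OccursOnly b k' (A.rename f) := by
  have up : ∀ {f : ℕ → ℕ} {k k' : ℕ}, (∀ j, f j = k' → j = k) →
      ∀ j, upRen f j = k' + 1 → j = k + 1 := by
    intro f k k' hf j hj
    obtain ⟨i, rfl, hi⟩ := upRen_eq_succ hj
    rw [hf i hi]
  induction A generalizing f k k' b with
  | var α => exact fun e => h (hf α e)
  | all A ih => exact ih h (up hf)
  | mu L ih => exact ih h (up hf)
  | lolli A B ihA ihB => exact ⟨ihA h.1 hf, ihB h.2 hf⟩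
  | imp A B ihA ihB => exact ⟨ihA h.1 hf, ihB h.2 hf⟩

/-- Under a binder, the substituted formulas are shifted and avoid the bound variable. Substitution
therefore preserves the positivity required of a fixpoint. -/
theorem OccursOnly.subst {A : Formula} {s : ℕ → Formula} {k : ℕ} {b : Bool}
    (h : OccursOnly b k A) (hk : s k = var k) (hs : ∀ j, j ≠ k → ¬ Occurs k (s j)) :
    OccursOnly b k (A.subst s) := by
  have up : ∀ {s : ℕ → Formula} {k : ℕ}, (∀ j, j ≠ k → ¬ Occurs k (s j)) →
      ∀ j, j ≠ k + 1 → ¬ Occurs (k + 1) (upSub s j) := by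
    rintro s k hs (_ | j) hj ho
    · cases ho
    · obtain ⟨i, hi, ho⟩ := Occurs.of_rename ho
      cases hi
      exact hs j (by simpa using hj) ho
  have up' : ∀ {s : ℕ → Formula} {k : ℕ}, s k = var k → upSub s (k + 1) = var (k + 1) := by
    intro s k hk
    rw [upSub, hk]; rfl
  induction A generalizing s k b with
  | var α =>
    by_cases hα : α = k
    · subst hα
      rw [Formula.subst, hk]; exact h
    · exact occursOnly_of_not_occurs (hs α hα) b
  | all A ih => exact ih h (up' hk) (up hs)
  | mu L ih => exact ih h (up' hk) (up hs)
  | lolli A B ihA ihB => exact ⟨ihA h.1 hk hs, ihB h.2 hk hs⟩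
  | imp A B ihA ihB => exact ⟨ihA h.1 hk hs, ihB h.2 hk hs⟩

theorem NoImp.rename {A : Formula} (h : NoImp A) (f : ℕ → ℕ) : NoImp (A.rename f) := by
  induction A generalizing f with
  | var α => trivial
  | all A ih => exact ih h _
  | mu L ih => exact ih h _
  | lolli A B ihA ihB => exact ⟨ihA h.1 f, ihB h.2 f⟩
  | imp A B _ _ => exact h.elim

theorem WF.rename {A : Formula} (h : WF A) (f : ℕ → ℕ) : WF (A.rename f) := by
  induction A generalizing f with
  | var α => trivial
  | all A ih => exact ih h _
  | mu L ih =>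
    refine ⟨ih h.1 _, h.2.1.rename _, h.2.2.rename fun j hj => ?_⟩
    cases j with
    | zero => rfl
    | succ j => cases hj
  | lolli A B ihA ihB => exact ⟨ihA h.1 f, h.2.1.rename f, ihB h.2.2 f⟩
  | imp A B ihA ihB => exact ⟨ihA h.1 f, ihB h.2 f⟩

theorem IsLinear.upSub {s : ℕ → Formula} (hs : ∀ α, (s α).IsLinear) (α : ℕ) :
    (Formula.upSub s α).IsLinear := by
  cases α with
  | zero => exact ⟨trivial, trivial⟩
  | succ α => exact ⟨(hs α).1.rename _, (hs α).2.rename _⟩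

theorem NoImp.subst {A : Formula} (h : NoImp A) {s : ℕ → Formula} (hs : ∀ α, (s α).IsLinear) :
    NoImp (A.subst s) := by
  induction A generalizing s with
  | var α => exact (hs α).2
  | all A ih => exact ih h (IsLinear.upSub hs)
  | mu L ih => exact ih h (IsLinear.upSub hs)
  | lolli A B ihA ihB => exact ⟨ihA h.1 hs, ihB h.2 hs⟩
  | imp A B _ _ => exact h.elim

theorem WF.subst {A : Formula} (h : WF A) {s : ℕ → Formula} (hs : ∀ α, (s α).IsLinear) :
    WF (A.subst s) := by
  induction A generalizing s with
  | var α => exact (hs α).1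
  | all A ih => exact ih h (IsLinear.upSub hs)
  | mu L ih =>
    refine ⟨ih h.1 (IsLinear.upSub hs), h.2.1.subst (IsLinear.upSub hs), h.2.2.subst rfl ?_⟩
    rintro (_ | j) hj ho
    · exact hj rfl
    · obtain ⟨i, hi, _⟩ := Occurs.of_rename ho
      cases hi
  | lolli A B ihA ihB => exact ⟨ihA h.1 hs, h.2.1.subst hs, ihB h.2.2 hs⟩
  | imp A B ihA ihB => exact ⟨ihA h.1 hs, ihB h.2 hs⟩

theorem WF.inst {A L : Formula} (h : WF A) (hL : L.IsLinear) : WF (A.inst L) := by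
  apply h.subst
  rintro (_ | α)
  · exact hL
  · exact ⟨trivial, trivial⟩

end Formula

namespace LTerm

theorem exists_of_occ_rename {t : LTerm} {f : ℕ → ℕ} {k : ℕ} (h : occ k (rename f t) ≠ 0) :
    ∃ j, f j = k ∧ occ j t ≠ 0 := by
  by_contra! h'
  refine h ?_
  rw [occ_rename t f k ∅]
  · rfl
  · intro w hw
    simp only [Finset.notMem_empty, iff_false]
    exact fun e => hw (h' w e)

end LTerm

theorem Ctx.names_append (Γ Δ : Ctx) : Ctx.names (Γ ++ Δ) = Γ.names ++ Δ.names := List.map_append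

theorem Ctx.names_cons (c : ℕ × Formula) (Γ : Ctx) : Ctx.names (c :: Γ) = c.1 :: Γ.names := rfl

theorem Ctx.names_nil : Ctx.names [] = [] := rfl

theorem Ctx.mem_names {c : ℕ × Formula} {Γ : Ctx} (h : c ∈ Γ) : c.1 ∈ Γ.names :=
  List.mem_map_of_mem h

/-- The properties of derivable judgments that concern variables and the grammar of formulas. -/
structure WellFormed (Γ Δ : Ctx) (t : LTerm) (A : Formula) : Prop where
  nodup : (Γ.names ++ Δ.names).Nodup
  mem_names : ∀ x, occ x t ≠ 0 → x ∈ Γ.names ++ Δ.names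
  wf : A.WF
  wf_left : ∀ c ∈ Γ, c.2.WF
  linear_right : ∀ c ∈ Δ, c.2.IsLinear
  occ_le : ∀ x ∈ Δ.names, occ x t ≤ 1

theorem occ_abs_ne_zero {x z : ℕ} {t : LTerm} (h : occ x (abs z t) ≠ 0) :
    x ≠ z ∧ occ x t ≠ 0 := by
  have : x ≠ z := by
    rintro rfl
    exact h (occ_abs_self _ _)
  rw [occ_abs_of_ne this] at h
  exact ⟨this, h⟩

theorem WellFormed.app {Γ₁ Γ₂ Δ₁ Δ₂ : Ctx} {t u : LTerm} {A B C : Formula}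
    (ht : WellFormed Γ₁ Δ₁ t A) (hu : WellFormed Γ₂ Δ₂ u B)
    (hn : (Ctx.names (Γ₁ ++ Γ₂ ++ (Δ₁ ++ Δ₂))).Nodup) (hC : C.WF) :
    WellFormed (Γ₁ ++ Γ₂) (Δ₁ ++ Δ₂) (.app t u) C := by
  have h₁ := ht.mem_names
  have h₂ := hu.mem_names
  simp only [Ctx.names_append] at hn
  refine ⟨by simpa [Ctx.names_append] using hn, fun x hx => ?_, hC, ?_, ?_, fun x hx => ?_⟩
  · have := h₁ x
    have := h₂ x
    simp only [occ, Ctx.names_append, List.mem_append] at *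
    by_cases h : occ x t = 0
    · have := h₂ x (by omega); tauto
    · have := h₁ x h; tauto
  · intro c hc
    rcases List.mem_append.1 hc with hc | hc
    · exact ht.wf_left c hc
    · exact hu.wf_left c hc
  · intro c hc
    rcases List.mem_append.1 hc with hc | hc
    · exact ht.linear_right c hc
    · exact hu.linear_right c hc
  · rw [Ctx.names_append] at hx
    simp only [occ]
    rcases List.mem_append.1 hx with hx | hx
    · have h₃ := ht.occ_le x hx
      have : occ x u = 0 := by
        by_contra h
        have := h₂ x h
        grind
      omega
    · have h₃ := hu.occ_le x hx
      have : occ x t = 0 := by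
        by_contra h
        have := h₁ x h
        grind
      omega

/-- Contraction merges only variables of Γ, and the premises of an application have disjoint
contexts. Hence no rule gives a linear variable a second occurrence. -/
theorem Derivable.wellFormed {Γ Δ : Ctx} {t : LTerm} {A : Formula} (h : Derivable Γ Δ t A) :
    WellFormed Γ Δ t A := by
  induction h with
  | ax1 x A hA =>
    exact ⟨by simp [Ctx.names], fun y hy => by simp [Ctx.names, occ] at *; exact hy.symm, hA,
      by simpa using hA, by simp, by simp [Ctx.names]⟩
  | ax2 x L hL =>
    exact ⟨by simp [Ctx.names], fun y hy => by simp [Ctx.names, occ] at *; exact hy.symm, hL.1,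
      by simp, by simpa using hL, by simp [Ctx.names, occ]⟩
  | mu_e _ ih => exact { ih with wf := ih.wf.1.inst ⟨ih.wf, ih.wf.2.1⟩ }
  | mu_i hL _ ih => exact { ih with wf := hL }
  | all_i α _ _ ih => exact { ih with wf := ih.wf.rename _ }
  | all_e _ hL ih => exact { ih with wf := Formula.WF.inst ih.wf hL }
  | imp_e _ _ hn ih₁ ih₂ =>
    have := ih₁.app ih₂ (by simpa using hn) ih₁.wf.2
    simpa using this
  | lolli_e _ _ hn ih₁ ih₂ => exact ih₁.app ih₂ hn ih₁.wf.2.2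
  | @imp_i Γ Δ t A B z _ ih =>
    have h₁ := ih.nodup
    have h₂ := ih.mem_names
    have h₃ := ih.occ_le
    simp only [Ctx.names_append, Ctx.names_cons, Ctx.names_nil] at h₁ h₂ h₃
    refine ⟨by grind, fun x hx => ?_, ⟨ih.wf_left (z, A) (by simp), ih.wf⟩,
      fun c hc => ih.wf_left c (by simp [hc]), ih.linear_right, fun x hx => ?_⟩
    · obtain ⟨hz, hx⟩ := occ_abs_ne_zero hx
      have := h₂ x hx
      grind
    · rw [occ_abs_of_ne (by grind)]
      exact h₃ x hx
  | @lolli_i Γ Δ t A B z _ ih =>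
    have h₁ := ih.nodup
    have h₂ := ih.mem_names
    have h₃ := ih.occ_le
    simp only [Ctx.names_append, Ctx.names_cons, Ctx.names_nil] at h₁ h₂ h₃
    have hL := ih.linear_right (z, A) (by simp)
    refine ⟨by grind, fun x hx => ?_, ⟨hL.1, hL.2, ih.wf⟩, ih.wf_left,
      fun c hc => ih.linear_right c (by simp [hc]), fun x hx => ?_⟩
    · obtain ⟨hz, hx⟩ := occ_abs_ne_zero hx
      have := h₂ x hx
      grind
    · rw [occ_abs_of_ne (by grind)]
      exact h₃ x (by simp [hx])
  | @contr Γ Δ t A B x y z _ hz ih =>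
    have h₁ := ih.nodup
    have h₂ := ih.mem_names
    have h₃ := ih.occ_le
    simp only [Ctx.names_append, Ctx.names_cons, Ctx.names_nil] at h₁ h₂ h₃ hz
    have hA := ih.wf_left (x, A) (by simp)
    refine ⟨?_, fun w hw => ?_, ih.wf, fun c hc => ?_, ih.linear_right, fun w hw => ?_⟩
    · simp only [Ctx.names_append, Ctx.names_cons, Ctx.names_nil]
      grind
    · obtain ⟨j, hj, ho⟩ := exists_of_occ_rename hw
      have := h₂ j ho
      simp only [Ctx.names_append, Ctx.names_cons, Ctx.names_nil]
      grind
    · rcases List.mem_append.1 hc with hc | hc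
      · exact ih.wf_left c (by simp [hc])
      · rw [List.mem_singleton.1 hc]; exact hA
    · rw [occ_contract_of_ne _ (by grind) (by grind) (by grind)]
      exact h₃ w hw
  | @derel Γ Δ t L B x _ ih =>
    have h₁ := ih.nodup
    have h₂ := ih.mem_names
    have h₃ := ih.occ_le
    simp only [Ctx.names_append, Ctx.names_cons, Ctx.names_nil] at h₁ h₂ h₃
    have hL := ih.linear_right (x, L) (by simp)
    refine ⟨?_, fun w hw => ?_, ih.wf, fun c hc => ?_,
      fun c hc => ih.linear_right c (by simp [hc]), fun w hw => h₃ w (by simp [hw])⟩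
    · simp only [Ctx.names_append, Ctx.names_cons, Ctx.names_nil]
      grind
    · have := h₂ w hw
      simp only [Ctx.names_append, Ctx.names_cons, Ctx.names_nil]
      grind
    · rcases List.mem_append.1 hc with hc | hc
      · exact ih.wf_left c hc
      · rw [List.mem_singleton.1 hc]; exact hL.1
  | @weak Γ Γ' Δ Δ' t B _ hΓ hΔ hn ih =>
    have h₂ := ih.mem_names
    have h₃ := ih.occ_le
    simp only [Ctx.names_append] at hn
    refine ⟨by simpa [Ctx.names_append] using hn, fun w hw => ?_, ih.wf, fun c hc => ?_,
      fun c hc => ?_, fun w hw => ?_⟩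
    · have := h₂ w hw
      simp only [Ctx.names_append]
      grind
    · rcases List.mem_append.1 hc with hc | hc
      · exact ih.wf_left c hc
      · exact hΓ c hc
    · rcases List.mem_append.1 hc with hc | hc
      · exact ih.linear_right c hc
      · exact hΔ c hc
    · rw [Ctx.names_append] at hw
      rcases List.mem_append.1 hw with hw | hw
      · exact h₃ w hw
      · by_contra! h
        have := h₂ w (by omega)
        grind
  | perm _ hΓ hΔ ih =>
    have hp := (hΓ.map Prod.fst).append (hΔ.map Prod.fst)
    exact ⟨hp.nodup_iff.1 ih.nodup, fun x hx => hp.mem_iff.1 (ih.mem_names x hx), ih.wf,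
      fun c hc => ih.wf_left c (hΓ.mem_iff.2 hc), fun c hc => ih.linear_right c (hΔ.mem_iff.2 hc),
      fun x hx => ih.occ_le x ((hΔ.map Prod.fst).mem_iff.2 hx)⟩

/-! ### Structural operations on realizers, weights and assignments. -/

namespace Poly

theorem add_conv_of_value {τ : Ty} (p : Poly [] τ) {q r : Poly [] .o} (h : q.value = r.value) :
    Conv (p.add q) (p.add r) :=
  (add_conv_nat p q).trans (h ▸ (add_conv_nat p r).symm)

theorem add_add_conv {τ : Ty} (p : Poly [] τ) (q r : Poly [] .o) {n : ℕ}
    (h : q.value + r.value = n) : Conv ((p.add q).add r) (p.add (nat n)) :=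
  (add_add p q r).trans (add_conv_of_value p h)

theorem conv_of_lower_eq {τ : Ty} (h : τ = .o) {p q : Poly [] τ} (hpq : p.lower = q.lower) :
    Conv p q := by
  subst h
  have : p.value = q.value := hpq
  exact (conv_nat p).trans (this ▸ (conv_nat q).symm)

theorem lower_zeroAt (τ : Ty) : (zeroAt τ : Poly [] τ).lower = 0 := by
  rw [lower_eq, den_zeroAt]
  induction τ with
  | o => rfl
  | arrow σ τ _ ih => exact ih

end Poly

namespace Realizes

variable {A : Formula} {η : Valuation} {t : LTerm} {p q : Poly [] A.otype}

theorem conv (h : Realizes A η t p) (hpq : Poly.Conv p q) : Realizes A η t q :=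
  (isSaturated_realizes A η).resp t p q hpq h

theorem add_nat (h : Realizes A η t p) (n : ℕ) : Realizes A η t (p.add (.nat n)) :=
  (isSaturated_realizes A η).monotonicity t p n h

theorem evalBound (h : Realizes A η t p) : EvalBound t p.lower :=
  (isSaturated_realizes A η).bound t p h

/-- A permutation is a composite of adjacent swaps; the prefix θ accumulates the bindings to the
left of the swap. -/
theorem bind_perm_append {l l' : List (LTerm × ℕ)} (hl : l.Perm l') (θ : List (LTerm × ℕ))
    (hn : ((θ ++ l).map Prod.snd).Nodup) (h : Realizes A η (t.bind (θ ++ l)) p) :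
    Realizes A η (t.bind (θ ++ l')) p := by
  induction hl generalizing θ with
  | nil => exact h
  | cons a hl ih =>
    simpa using ih (θ ++ [a]) (by simpa using hn) (by simpa using h)
  | swap a b l =>
    exact (isSaturated_realizes A η).exchange t b.1 a.1 b.2 a.2 θ l [] p hn h
  | trans h₁ h₂ ih₁ ih₂ =>
    refine ih₂ θ ?_ (ih₁ θ hn h)
    exact (((h₁.append_left θ).map Prod.snd).nodup_iff).1 hn

theorem perm {l l' : List ℕ} {σ : ℕ → LTerm} (h : Realizes A η (t.bind (binds σ l)) p)
    (hl : l.Perm l') (hn : l'.Nodup) : Realizes A η (t.bind (binds σ l')) p :=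
  bind_perm_append (hl.map fun x => (σ x, x)) [] (by
    rw [List.nil_append]
    change ((binds σ l).map Prod.snd).Nodup
    rw [map_snd_binds]
    exact hl.nodup_iff.2 hn) h

theorem weaken {l : List ℕ} {σ : ℕ → LTerm} (L : Ctx) (T : ℕ × Formula → ℕ)
    (h : Realizes A η (t.bind (binds σ l)) p) (hn : (l ++ L.names).Nodup)
    (hL : ∀ c ∈ L, occ c.1 t = 0 ∧ EvalBound (σ c.1) (T c)) :
    Realizes A η (t.bind (binds σ (l ++ L.names))) (p.add (.nat (L.map fun c => T c + 2).sum)) := by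
  induction L generalizing l p with
  | nil =>
    simp only [Ctx.names_nil, List.append_nil]
    exact h.add_nat 0
  | cons c L ih =>
    obtain ⟨ho, he⟩ := hL c (by simp)
    have hn' : (l ++ [c.1] ++ Ctx.names L).Nodup := by simpa [Ctx.names] using hn
    have h₁ : Realizes A η (t.bind (binds σ (l ++ [c.1]))) (p.add (.nat (TS (σ c.1) + 2))) := by
      rw [binds_append]
      refine (isSaturated_realizes A η).weakening t (σ c.1) c.1 (binds σ l) [] p ?_ ?_ he.1 h
      · simpa using hn'.of_append_left
      · exact fun h => h ho
    have h₂ := ih h₁ hn' fun d hd => hL d (by simp [hd])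
    -- The closure condition charges the exact TS of the argument; monotonicity makes up the
    -- difference to its bound.
    have h₃ := h₂.add_nat (T c - TS (σ c.1))
    rw [List.append_assoc] at h₃
    refine h₃.conv ((Poly.Conv.add (Poly.add_nat_add_nat _ _ _) (.refl _)).trans
      ((Poly.add_nat_add_nat _ _ _).trans (.of_eq ?_)))
    have := he.2
    rw [List.map_cons, List.sum_cons]
    congr 2
    omega

end Realizes

/-- The sum of the lowered values of the variables of a context. -/
def PolyEnv.weight (ρ : PolyEnv) (Δ : Ctx) : ℕ := (Δ.map fun c => (ρ c.1 c.2.otype).lower).sum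

/-- The sum of the lowered values of the variables of a context, counted for each occurrence. -/
def PolyEnv.occWeight (ρ : PolyEnv) (t : LTerm) (Γ : Ctx) : ℕ :=
  (Γ.map fun c => occ c.1 t * (ρ c.1 c.2.otype).lower).sum

namespace PolyEnv

theorem weight_append (ρ : PolyEnv) (Δ Δ' : Ctx) :
    ρ.weight (Δ ++ Δ') = ρ.weight Δ + ρ.weight Δ' := by simp [weight]

theorem occWeight_append (ρ : PolyEnv) (t : LTerm) (Γ Γ' : Ctx) :
    ρ.occWeight t (Γ ++ Γ') = ρ.occWeight t Γ + ρ.occWeight t Γ' := by simp [occWeight]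

theorem weight_singleton (ρ : PolyEnv) (x : ℕ) (A : Formula) :
    ρ.weight [(x, A)] = (ρ x A.otype).lower := by simp [weight]

theorem occWeight_singleton (ρ : PolyEnv) (t : LTerm) (x : ℕ) (A : Formula) :
    ρ.occWeight t [(x, A)] = occ x t * (ρ x A.otype).lower := by simp [occWeight]

theorem weight_congr {ρ ρ' : PolyEnv} {Δ : Ctx} (h : ∀ x ∈ Δ.names, ρ x = ρ' x) :
    ρ.weight Δ = ρ'.weight Δ := by
  rw [weight, weight]
  congr 1
  exact List.map_congr_left fun c hc => by rw [h _ (Ctx.mem_names hc)]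

theorem occWeight_congr {ρ ρ' : PolyEnv} {t t' : LTerm} {Γ : Ctx}
    (h : ∀ x ∈ Γ.names, occ x t = occ x t' ∧ ρ x = ρ' x) :
    ρ.occWeight t Γ = ρ'.occWeight t' Γ := by
  rw [occWeight, occWeight]
  congr 1
  exact List.map_congr_left fun c hc => by
    rw [(h _ (Ctx.mem_names hc)).1, (h _ (Ctx.mem_names hc)).2]

theorem occWeight_app (ρ : PolyEnv) (t u : LTerm) (Γ : Ctx) :
    ρ.occWeight (.app t u) Γ = ρ.occWeight t Γ + ρ.occWeight u Γ := by
  rw [occWeight, occWeight, occWeight, ← List.sum_map_add]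
  congr 2
  funext c
  rw [occ, add_mul]

theorem occWeight_eq_zero {ρ : PolyEnv} {t : LTerm} {Γ : Ctx}
    (h : ∀ x ∈ Γ.names, occ x t = 0) : ρ.occWeight t Γ = 0 := by
  rw [occWeight]
  apply List.sum_eq_zero
  intro n hn
  obtain ⟨c, hc, rfl⟩ := List.mem_map.1 hn
  rw [h _ (Ctx.mem_names hc), zero_mul]

end PolyEnv

namespace Definable

variable {Γ : Ctx} {τ τ' : Ty}

theorem congr {F : PolyEnv → Poly [] τ} (hF : Definable Γ τ F) {ρ ρ' : PolyEnv}
    (h : ∀ x ∈ Γ.names, ρ x = ρ' x) : F ρ = F ρ' := by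
  obtain ⟨p, hp⟩ := hF
  rw [hp, hp, PolyEnv.args_congr h]

theorem zeroAt (τ : Ty) : Definable Γ τ fun _ => Poly.zeroAt τ :=
  ⟨Poly.zeroAt τ, fun _ => (Poly.subst_zeroAt τ _).symm⟩

theorem cast {F : PolyEnv → Poly [] τ} (hF : Definable Γ τ F) (h : τ = τ') :
    Definable Γ τ' fun ρ => _root_.cast (congrArg (Poly []) h) (F ρ) := by
  subst h
  exact hF

end Definable

/-- Under `η`, the terms given by `σ` and the polynomials given by `ρ` realize the context `Γ`. -/
def RealizesAll (η : Valuation) (σ : ℕ → LTerm) (ρ : PolyEnv) (Γ : Ctx) : Prop :=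
  ∀ c ∈ Γ, Realizes c.2 η (σ c.1) (ρ c.1 c.2.otype)

namespace RealizesAll

variable {η : Valuation} {σ σ' : ℕ → LTerm} {ρ ρ' : PolyEnv} {Γ Γ' : Ctx}

theorem mono (h : RealizesAll η σ ρ Γ) (hΓ : ∀ c ∈ Γ', c ∈ Γ) : RealizesAll η σ ρ Γ' :=
  fun c hc => h c (hΓ c hc)

theorem congr (h : RealizesAll η σ ρ Γ) (hσ : ∀ x ∈ Γ.names, σ' x = σ x)
    (hρ : ∀ x ∈ Γ.names, ρ' x = ρ x) : RealizesAll η σ' ρ' Γ := fun c hc => by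
  rw [hσ _ (Ctx.mem_names hc), hρ _ (Ctx.mem_names hc)]
  exact h c hc

theorem append (h : RealizesAll η σ ρ Γ) (h' : RealizesAll η σ ρ Γ') :
    RealizesAll η σ ρ (Γ ++ Γ') := fun c hc =>
  (List.mem_append.1 hc).elim (h c) (h' c)

theorem singleton {x : ℕ} {A : Formula} (h : Realizes A η (σ x) (ρ x A.otype)) :
    RealizesAll η σ ρ [(x, A)] := fun c hc => by
  rw [List.mem_singleton.1 hc]
  exact h

theorem update (h : RealizesAll η σ ρ Γ) {z : ℕ} {A : Formula} {u : LTerm} {q : Poly [] A.otype}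
    (hz : z ∉ Γ.names) (hu : Realizes A η u q) :
    RealizesAll η (Function.update σ z u) (ρ.set z A.otype q) (Γ ++ [(z, A)]) := by
  refine (h.congr (fun x hx => ?_) fun x hx => ?_).append (.singleton ?_)
  · exact Function.update_of_ne (ne_of_mem_of_not_mem hx hz) _ _
  · exact PolyEnv.set_of_ne _ (ne_of_mem_of_not_mem hx hz) _ _
  · rw [Function.update_self, PolyEnv.set_self]
    exact hu

end RealizesAll

/-! ### Adequacy, rule by rule. -/

/-- The conclusion of the adequacy theorem, in terms of assignments for the declared variables. -/
def Adequate (Γ Δ : Ctx) (t : LTerm) (A : Formula) : Prop :=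
  ∃ F : PolyEnv → Poly [] A.otype, Definable Γ A.otype F ∧
    (∀ η σ ρ, RealizesAll η σ ρ (Γ ++ Δ) →
      Realizes A η (t.bind (binds σ (Γ.names ++ Δ.names))) ((F ρ).add (.nat (ρ.weight Δ)))) ∧
    ∀ ρ, t.size + ρ.occWeight t Γ ≤ (F ρ).lower

namespace Adequate

variable {Γ Γ₁ Γ₂ Γ' Δ Δ₁ Δ₂ Δ' : Ctx} {t u : LTerm} {A A' B L : Formula} {x y z : ℕ}

theorem ax1 (x : ℕ) (A : Formula) : Adequate [(x, A)] [] (.var x) A := by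
  refine ⟨_, (Definable.var (c := (x, A)) (by simp) : Definable [(x, A)] A.otype fun ρ => ρ x A.otype).add
    (.nat 3), fun η σ ρ h => ?_, fun ρ => ?_⟩
  · refine Realizes.add_nat ?_ 0
    exact (isSaturated_realizes A η).identity (σ x) x [] _ (h (x, A) (by simp))
  · rw [Poly.lower_add, PolyEnv.occWeight_singleton]
    simp only [size, occ, if_true, one_mul, Poly.value, Poly.den]
    omega

theorem ax2 (x : ℕ) (h : L.otype = .o) : Adequate [] [(x, L)] (.var x) L := by
  refine ⟨_, (Definable.zeroAt L.otype).add (.nat 3), fun η σ ρ hr => ?_, fun ρ => ?_⟩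
  · refine Realizes.conv ((isSaturated_realizes L η).identity (σ x) x [] _ (hr (x, L) (by simp))) ?_
    apply Poly.conv_of_lower_eq h
    rw [Poly.lower_add, Poly.lower_add, Poly.lower_add, Poly.lower_zeroAt,
      PolyEnv.weight_singleton]
    simp only [Poly.value, Poly.den]
    omega
  · rw [Poly.lower_add]
    simp [size, PolyEnv.occWeight, Poly.value, Poly.den]

/-- For rules that change only the formula. The valuation may be changed on the way, as
generalization requires, provided that the context stays realized. -/
theorem of_realizes (ht : Adequate Γ Δ t A) (hA : A.otype = A'.otype)
    (h : ∀ η s (p : Poly [] A.otype) (p' : Poly [] A'.otype), HEq p p' →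
      (∀ η', (∀ c ∈ Γ ++ Δ, ∀ u q, Realizes c.2 η u q → Realizes c.2 η' u q) →
        Realizes A η' s p) → Realizes A' η s p') :
    Adequate Γ Δ t A' := by
  obtain ⟨F, hF, hr, hs⟩ := ht
  refine ⟨_, hF.cast hA, fun η σ ρ hσ => ?_, fun ρ => ?_⟩
  · refine h η _ ((F ρ).add (.nat (ρ.weight Δ))) _ ?_ fun η' hη => ?_
    · exact Poly.add_congr hA (cast_heq _ _).symm rfl
    · exact hr η' σ ρ fun c hc => hη c hc _ _ (hσ c hc)
  · rw [← Poly.lower_congr hA (cast_heq (congrArg (Poly []) hA) (F ρ)).symm]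
    exact hs ρ

theorem of_sameRealizers (ht : Adequate Γ Δ t A) (h : ∀ η, SameRealizers A η A' η) :
    Adequate Γ Δ t A' :=
  ht.of_realizes (h fun _ => topSat).1 fun η s p p' hp hA =>
    ((h η).2 s p p' hp).1 (hA η fun _ _ _ _ h => h)

theorem sameRealizers_unfold (hL : (Formula.mu L).WF) (η : Valuation) :
    SameRealizers (.mu L) η (L.inst (.mu L)) η := by
  have h₁ := sameRealizers_mu L hL.2.1.otype_eq hL.2.2 η
  have h₂ := sameRealizers_inst L (.mu L) rfl η
  refine ⟨h₁.1.symm.trans h₂.1.symm, fun s p p' hp => ?_⟩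
  have hc := cast_heq (congrArg (Poly []) h₁.1.symm) p
  exact (h₁.symm.2 s p _ hc.symm).trans (h₂.symm.2 s _ p' (hc.trans hp))

theorem all_i (ht : Adequate Γ Δ t A) (α : ℕ) (hα : ∀ c ∈ Γ ++ Δ, ¬ Formula.Occurs α c.2) :
    Adequate Γ Δ t (A.forallVar α) := by
  have hs := fun η => sameRealizers_rename A (fun β => if β = α then 0 else β + 1) η
  refine ht.of_realizes (hs fun _ => topSat).1.symm fun η s p p' hp hA X => ?_
  refine ((hs (η.push X)).2 s p' p hp.symm).2 (hA _ fun c hc u q hq => hq.mono fun β => ?_)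
  by_cases hβ : β = α
  · subst hβ
    exact ⟨.inr (Formula.occursOnly_of_not_occurs (hα c hc) _),
      .inr (Formula.occursOnly_of_not_occurs (hα c hc) _)⟩
  · simp only [if_neg hβ]
    exact ⟨.inl subset_rfl, .inl subset_rfl⟩

theorem all_e (ht : Adequate Γ Δ t (.all A)) (hL : L.otype = .o) : Adequate Γ Δ t (A.inst L) :=
  ht.of_realizes (sameRealizers_inst A L hL fun _ => topSat).1.symm fun η s p p' hp hA =>
    ((sameRealizers_inst A L hL η).2 s p' p hp.symm).2 (hA η (fun _ _ _ _ h => h) _)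

/-- Concatenation lists the bindings of t before those of u; a permutation restores the order of the
conclusion. Its freshness conditions hold because the variables are disjoint. -/
theorem realizes_app {η : Valuation} {σ : ℕ → LTerm} {l₁ l₂ l : List ℕ} {p : Poly [] B.otype}
    (h : Realizes B η (.app (t.bind (binds σ l₁)) (u.bind (binds σ l₂))) p)
    (h₁ : ∀ x, occ x t ≠ 0 → x ∈ l₁) (h₂ : ∀ x, occ x u ≠ 0 → x ∈ l₂)
    (hl : (l₁ ++ l₂).Perm l) (hn : l.Nodup) :
    Realizes B η ((LTerm.app t u).bind (binds σ l)) p := by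
  have hn' := hl.nodup_iff.2 hn
  have hd := List.nodup_append.1 hn'
  refine Realizes.perm ?_ hl hn
  rw [binds_append]
  refine (isSaturated_realizes B η).concatenation t u (binds σ l₁) (binds σ l₂) [] p ?_ ?_ ?_ h
  · simpa using hn'
  · rw [map_snd_binds]
    exact fun x hx ho => hd.2.2 x hx x (h₂ x ho) rfl
  · rw [map_snd_binds]
    exact fun x hx ho => hd.2.2 x (h₁ x ho) x hx rfl

theorem occWeight_app_eq (ht : WellFormed Γ₁ Δ₁ t A) (hu : WellFormed Γ₂ Δ₂ u B)
    (hn : (Ctx.names (Γ₁ ++ Γ₂ ++ (Δ₁ ++ Δ₂))).Nodup) (ρ : PolyEnv) :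
    ρ.occWeight (.app t u) (Γ₁ ++ Γ₂) = ρ.occWeight t Γ₁ + ρ.occWeight u Γ₂ := by
  have h₁ := ht.mem_names
  have h₂ := hu.mem_names
  simp only [Ctx.names_append] at hn
  rw [PolyEnv.occWeight_app, PolyEnv.occWeight_append, PolyEnv.occWeight_append,
    PolyEnv.occWeight_eq_zero (t := t) (Γ := Γ₂), PolyEnv.occWeight_eq_zero (t := u) (Γ := Γ₁)]
  · omega
  · intro x hx
    by_contra h
    have := h₂ x h
    grind
  · intro x hx
    by_contra h
    have := h₁ x h
    grind

theorem imp_e (ht : Adequate Γ₁ Δ t (.imp A B)) (hu : Adequate Γ₂ [] u A)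
    (wt : WellFormed Γ₁ Δ t (.imp A B)) (wu : WellFormed Γ₂ [] u A)
    (hn : (Ctx.names (Γ₁ ++ Γ₂ ++ Δ)).Nodup) : Adequate (Γ₁ ++ Γ₂) Δ (.app t u) B := by
  obtain ⟨F, hF, hr, hs⟩ := ht
  obtain ⟨G, hG, kr, ks⟩ := hu
  replace hF : Definable Γ₁ (.arrow A.otype B.otype) F := hF
  have hF' := hF.mono (Γ' := Γ₁ ++ Γ₂) fun c hc => by simp [hc]
  have hG' := hG.mono (Γ' := Γ₁ ++ Γ₂) fun c hc => by simp [hc]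
  -- Realizability would need only F applied to G. The summand ↓G pays for the size of u, while ↓F ≤
  -- ↓(F G) pays for t.
  refine ⟨_, (hF'.app hG').add hG'.down, fun η σ ρ h => ?_, fun ρ => ?_⟩
  · have h₁ := hr η σ ρ (h.mono fun c hc => by simp at hc ⊢; tauto)
    have h₂ := (kr η σ ρ (h.mono fun c hc => by simp at hc ⊢; tauto)).conv (Poly.add_zero _)
    have h₃ : Realizes B η _ _ := h₁.2 _ _ h₂
    have h₄ := h₃.conv (Poly.app_add (σ := A.otype) (τ := B.otype) _ _ _)
    have h₅ := h₄.add_nat (G ρ).lower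
    refine realizes_app (h₅.conv ((Poly.add_right_comm _ _ _).trans (.add ?_ (.refl _))))
      wt.mem_names wu.mem_names ?_ ?_
    · exact Poly.add_conv_of_value _ rfl
    · simp only [Ctx.names_append, Ctx.names_nil, List.append_nil]
      rw [List.append_assoc, List.append_assoc]
      exact List.perm_append_comm.append_left _
    · rwa [Ctx.names_append] at hn
  · rw [occWeight_app_eq wt wu (by simpa using hn), Poly.lower_add, Poly.value_down, size]
    have := hs ρ
    have := ks ρ
    have := Poly.lower_le_lower_app (σ := A.otype) (τ := B.otype) (F ρ) (G ρ)
    change _ ≤ (Poly.app (σ := A.otype) (τ := B.otype) (F ρ) (G ρ)).lower + _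
    have e : Poly.lower (τ := (Formula.imp A B).otype) (F ρ) =
      Poly.lower (τ := .arrow A.otype B.otype) (F ρ) := rfl
    omega

theorem lolli_e (ht : Adequate Γ₁ Δ₁ t (.lolli L B)) (hu : Adequate Γ₂ Δ₂ u L)
    (wt : WellFormed Γ₁ Δ₁ t (.lolli L B)) (wu : WellFormed Γ₂ Δ₂ u L)
    (hn : (Ctx.names (Γ₁ ++ Γ₂ ++ (Δ₁ ++ Δ₂))).Nodup) :
    Adequate (Γ₁ ++ Γ₂) (Δ₁ ++ Δ₂) (.app t u) B := by
  obtain ⟨F, hF, hr, hs⟩ := ht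
  obtain ⟨G, hG, kr, ks⟩ := hu
  replace hF : Definable Γ₁ B.otype F := hF
  have hF' := hF.mono (Γ' := Γ₁ ++ Γ₂) fun c hc => by simp [hc]
  have hG' := hG.mono (Γ' := Γ₁ ++ Γ₂) fun c hc => by simp [hc]
  refine ⟨_, hF'.add hG'.down, fun η σ ρ h => ?_, fun ρ => ?_⟩
  · have h₁ := hr η σ ρ (h.mono fun c hc => by simp at hc ⊢; tauto)
    have h₂ := kr η σ ρ (h.mono fun c hc => by simp at hc ⊢; tauto)
    have h₃ : Realizes B η _ _ := h₁.2 _ _ h₂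
    refine realizes_app (h₃.conv ((Poly.add_add_conv (τ := B.otype) _ _ _ rfl).trans
      (Poly.add_add_conv (τ := B.otype) _ _ _ ?_).symm)) wt.mem_names wu.mem_names ?_ ?_
    · rw [Poly.value_down, Poly.value_down, Poly.lower_add, PolyEnv.weight_append]
      simp only [Poly.value, Poly.den]
      omega
    · simp only [Ctx.names_append]
      rw [List.append_assoc, List.append_assoc]
      refine List.Perm.append_left _ ?_
      rw [← List.append_assoc, ← List.append_assoc]
      exact List.perm_append_comm.append_right _
    · rwa [Ctx.names_append] at hn
  · refine le_of_le_of_eq ?_ (Poly.lower_add (τ := B.otype) (F ρ) (G ρ).down).symm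
    rw [occWeight_app_eq wt wu hn, Poly.value_down, size]
    have := hs ρ
    have := ks ρ
    have e : Poly.lower (τ := (Formula.lolli L B).otype) (F ρ) =
      Poly.lower (τ := B.otype) (F ρ) := rfl
    omega

/-- A polynomial that pays for the evaluation of the arguments of an abstraction. -/
theorem exists_padding (Γ Δ : Ctx) (t : LTerm) (z : ℕ) (hn : (Γ.names ++ Δ.names).Nodup)
    (hz : z ∉ Γ.names ++ Δ.names) (ho : ∀ x ∈ Δ.names, occ x t ≤ 1) :
    ∃ P, Definable Γ .o P ∧ (∀ ρ, 1 ≤ (P ρ).value) ∧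
      ∀ η σ ρ, RealizesAll η σ ρ (Γ ++ Δ) →
        EvalBound ((abs z t).bind (binds σ (Γ.names ++ Δ.names)))
          (t.size + ρ.occWeight t Γ + (P ρ).value + ρ.weight Δ) := by
  -- The padding is ↓x + 2 for each declaration in Γ, 2 for each in Δ, and 1 for the new λ. The
  -- argument costs for Δ are already in its weight, since its variables occur at most once.
  obtain ⟨S, hS, hv⟩ := Definable.sum_down (Γ := Γ) Γ (fun c hc => hc) 2
  have value : ∀ ρ, ((S ρ).add (.nat (2 * Δ.length + 1))).value =
      (Γ.map fun c => (ρ c.1 c.2.otype).lower + 2).sum + (2 * Δ.length + 1) := by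
    intro ρ
    rw [← hv]
    rfl
  refine ⟨_, hS.add (.nat (2 * Δ.length + 1)), fun ρ => ?_, fun η σ ρ h => ?_⟩
  · rw [value]
    omega
  · have h₁ := evalBound_bind_abs t z (Γ ++ Δ) Prod.fst σ (fun c => (ρ c.1 c.2.otype).lower)
      (by simpa [Ctx.names] using hn) fun c hc => (h c hc).evalBound
    rw [List.map_append] at h₁
    refine ⟨h₁.1, h₁.2.trans ?_⟩
    rw [value, List.map_append, List.sum_append]
    have e₁ : (Γ.map fun c => (occ c.1 (abs z t) - 1) * (ρ c.1 c.2.otype).lower +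
        ((ρ c.1 c.2.otype).lower + 2)).sum ≤
        ρ.occWeight t Γ + (Γ.map fun c => (ρ c.1 c.2.otype).lower + 2).sum := by
      rw [PolyEnv.occWeight, ← List.sum_map_add]
      refine List.sum_le_sum fun c hc => ?_
      rw [occ_abs_of_ne (by rintro rfl; exact hz (by simp [Ctx.mem_names hc]))]
      exact Nat.add_le_add_right (Nat.mul_le_mul_right _ (Nat.sub_le _ _)) _
    have e₂ : (Δ.map fun c => (occ c.1 (abs z t) - 1) * (ρ c.1 c.2.otype).lower +
        ((ρ c.1 c.2.otype).lower + 2)).sum ≤ ρ.weight Δ + 2 * Δ.length := by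
      have : 2 * Δ.length = (Δ.map fun _ => 2).sum := by simp [mul_comm]
      rw [PolyEnv.weight, this, ← List.sum_map_add]
      refine List.sum_le_sum fun c hc => ?_
      have hc' := Ctx.mem_names hc
      rw [occ_abs_of_ne (by rintro rfl; exact hz (by simp [hc'])),
        Nat.sub_eq_zero_of_le (ho _ hc')]
      omega
    omega

/-- Once the binding of z is moved to the end, the two terms are identical. -/
theorem realizes_app_abs {η : Valuation} {σ : ℕ → LTerm} {l l' : List ℕ} {p : Poly [] B.otype}
    (h : Realizes B η (t.bind (binds (Function.update σ z u) l')) p) (hl : l'.Perm (l ++ [z]))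
    (hz : z ∉ l) (hn : l.Nodup) : Realizes B η (.app ((abs z t).bind (binds σ l)) u) p := by
  have h₁ := h.perm hl (List.perm_append_comm.nodup_iff.2 (List.nodup_cons.2 ⟨hz, hn⟩))
  rw [binds_append, binds_congr fun x hx =>
    Function.update_of_ne (ne_of_mem_of_not_mem hx hz) u σ] at h₁
  rw [← bind_append_singleton]
  simpa [binds] using h₁

theorem imp_i (ht : Adequate (Γ ++ [(z, A)]) Δ t B) (wt : WellFormed (Γ ++ [(z, A)]) Δ t B) :
    Adequate Γ Δ (abs z t) (.imp A B) := by
  have hn : (Γ.names ++ z :: Δ.names).Nodup := by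
    simpa [Ctx.names_append, Ctx.names_cons, Ctx.names_nil] using wt.nodup
  have hn' : (z :: (Γ.names ++ Δ.names)).Nodup := List.perm_middle.nodup_iff.1 hn
  rw [List.nodup_cons] at hn'
  obtain ⟨hz, hΓΔ⟩ := hn'
  have hzΓ : z ∉ Γ.names := fun h => hz (by simp [h])
  have hzΔ : z ∉ Δ.names := fun h => hz (by simp [h])
  obtain ⟨F, hF, hr, hs⟩ := ht
  obtain ⟨G, hG, hFG⟩ := (hF.mono (Γ' := (z, A) :: Γ) fun c hc => by simp at hc ⊢; tauto).lam hzΓ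
  obtain ⟨P, hP, hP₁, hPe⟩ := exists_padding Γ Δ t z hΓΔ hz wt.occ_le
  have hsize : ∀ ρ, t.size + ρ.occWeight t Γ ≤ (G ρ).lower := by
    intro ρ
    -- Lowering G puts zero for z, so the bound for F is used there; the occurrences of z then
    -- contribute nothing.
    have h₁ := hs (ρ.set z A.otype (.zeroAt _))
    rw [PolyEnv.occWeight_append, PolyEnv.occWeight_singleton, PolyEnv.set_self,
      Poly.lower_zeroAt, ← (hFG ρ (.zeroAt _)).lower_eq,
      PolyEnv.occWeight_congr (ρ' := ρ) (t' := t)] at h₁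
    · exact h₁
    · exact fun x hx => ⟨rfl, PolyEnv.set_of_ne _ (ne_of_mem_of_not_mem hx hzΓ) _ _⟩
  refine ⟨_, hG.add hP, fun η σ ρ h => ⟨?_, fun u q hu => ?_⟩, fun ρ => ?_⟩
  · have h₁ := hPe η σ ρ h
    refine ⟨h₁.1, h₁.2.trans ?_⟩
    have h₂ := hsize ρ
    change _ ≤ (Poly.add (Poly.add (G ρ) (P ρ)) (.nat (ρ.weight Δ))).lower
    rw [Poly.lower_add, Poly.lower_add]
    simp only [Poly.value, Poly.den] at h₁ ⊢
    omega
  · have h₁ := hr η (Function.update σ z u) (ρ.set z A.otype q)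
      ((h.update (by rwa [Ctx.names_append]) hu).mono fun c hc => by simp at hc ⊢; tauto)
    rw [PolyEnv.weight_congr (ρ' := ρ) fun x hx =>
      PolyEnv.set_of_ne _ (ne_of_mem_of_not_mem hx hzΔ) _ _] at h₁
    have h₂ := (h₁.conv (.add (hFG ρ q).symm (.refl _))).add_nat (P ρ).value
    refine realizes_app_abs (h₂.conv ?_) ?_ hz hΓΔ
    · refine (Poly.add_right_comm _ _ _).trans ?_
      refine .trans (.add ?_ (.refl _)) (Poly.app_add (σ := A.otype) (τ := B.otype) _ _ _).symm
      refine .trans ?_ (Poly.app_add (σ := A.otype) (τ := B.otype) _ _ _).symm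
      exact Poly.add_conv_of_value _ rfl
    · simp only [Ctx.names_append, Ctx.names_cons, Ctx.names_nil, List.append_assoc]
      exact List.perm_append_comm.append_left _
  · have h₁ := hsize ρ
    have h₂ := hP₁ ρ
    change _ ≤ (Poly.add (G ρ) (P ρ)).lower
    rw [Poly.lower_add, size_abs, PolyEnv.occWeight_congr (ρ' := ρ) (t' := t)]
    · omega
    · exact fun x hx => ⟨occ_abs_of_ne (ne_of_mem_of_not_mem hx hzΓ) _, rfl⟩

theorem lolli_i (ht : Adequate Γ (Δ ++ [(z, L)]) t B) (wt : WellFormed Γ (Δ ++ [(z, L)]) t B) :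
    Adequate Γ Δ (abs z t) (.lolli L B) := by
  have hn : ((Γ.names ++ Δ.names) ++ [z]).Nodup := by
    simpa [Ctx.names_append, Ctx.names_cons, Ctx.names_nil] using wt.nodup
  have hn' : (z :: (Γ.names ++ Δ.names)).Nodup := List.perm_append_comm.nodup_iff.1 hn
  rw [List.nodup_cons] at hn'
  obtain ⟨hz, hΓΔ⟩ := hn'
  have hzΓ : z ∉ Γ.names := fun h => hz (by simp [h])
  have hzΔ : z ∉ Δ.names := fun h => hz (by simp [h])
  obtain ⟨F, hF, hr, hs⟩ := ht
  obtain ⟨P, hP, hP₁, hPe⟩ := exists_padding Γ Δ t z hΓΔ hz fun x hx =>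
    wt.occ_le x (by simp [Ctx.names_append, hx])
  -- F does not depend on the linear variable z, whose weight enters only as a summand, so no
  -- abstraction of polynomials is needed.
  refine ⟨_, hF.add hP, fun η σ ρ h => ⟨?_, fun u m hu => ?_⟩, fun ρ => ?_⟩
  · have h₁ := hPe η σ ρ h
    refine ⟨h₁.1, h₁.2.trans ?_⟩
    have h₂ := hs ρ
    change _ ≤ (Poly.add (Poly.add (F ρ) (P ρ)) (.nat (ρ.weight Δ))).lower
    rw [Poly.lower_add, Poly.lower_add]
    simp only [Poly.value, Poly.den] at h₁ ⊢
    omega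
  · have h₁ := hr η (Function.update σ z u) (ρ.set z L.otype m)
      ((h.update (by rwa [Ctx.names_append]) hu).mono fun c hc => by simp at hc ⊢; tauto)
    rw [PolyEnv.weight_append, PolyEnv.weight_singleton, PolyEnv.set_self,
      PolyEnv.weight_congr (ρ' := ρ) fun x hx =>
      PolyEnv.set_of_ne _ (ne_of_mem_of_not_mem hx hzΔ) _ _,
      hF.congr (ρ' := ρ) fun x hx =>
      PolyEnv.set_of_ne _ (ne_of_mem_of_not_mem hx hzΓ) _ _] at h₁
    have h₂ := h₁.add_nat (P ρ).value
    refine realizes_app_abs (h₂.conv ?_) ?_ hz hΓΔ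
    · refine (Poly.add_nat_add_nat _ _ _).trans (.symm ?_)
      refine (Poly.add_add_conv (τ := B.otype) _ _ _ rfl).trans ?_
      refine (Poly.add_add_conv (τ := B.otype) _ _ _ rfl).trans (.of_eq ?_)
      rw [Poly.value_down]
      simp only [Poly.value, Poly.den]
      congr 2
      omega
    · simp only [Ctx.names_append, Ctx.names_cons, Ctx.names_nil, List.append_assoc]
      rfl
  · have h₁ := hs ρ
    have h₂ := hP₁ ρ
    change _ ≤ (Poly.add (F ρ) (P ρ)).lower
    rw [Poly.lower_add, size_abs, PolyEnv.occWeight_congr (ρ' := ρ) (t' := t)]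
    · omega
    · exact fun x hx => ⟨occ_abs_of_ne (ne_of_mem_of_not_mem hx hzΓ) _, rfl⟩

theorem contr (ht : Adequate (Γ ++ [(x, A), (y, A)]) Δ t B)
    (wt : WellFormed (Γ ++ [(x, A), (y, A)]) Δ t B) (hz : z ∉ Ctx.names (Γ ++ Δ)) :
    Adequate (Γ ++ [(z, A)]) Δ (t.contract z x y) B := by
  have hn := wt.nodup
  have hfv := wt.mem_names
  simp only [Ctx.names_append, Ctx.names_cons, Ctx.names_nil] at hn hfv hz
  have hxy : x ≠ y := by grind
  have hxΓ : ∀ w ∈ Γ.names ++ Δ.names, w ≠ x ∧ w ≠ y ∧ w ≠ z := by grind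
  have hzt : occ z t ≠ 0 → z = x ∨ z = y := by
    intro h
    have := hfv z h
    grind
  have hn₁ : (Γ.names ++ Δ.names ++ [x, y]).Nodup := by grind
  have hn₂ : (Γ.names ++ [z] ++ Δ.names).Nodup := by grind
  obtain ⟨F, hF, hr, hs⟩ := ht
  let f : ℕ → ℕ := fun w => if w = x ∨ w = y then z else w
  have hf : ∀ w ∈ Γ.names ++ Δ.names, f w = w := fun w hw => by
    simp [f, (hxΓ w hw).1, (hxΓ w hw).2.1]
  have hfx : f x = z := by simp [f]
  have hfy : f y = z := by simp [f]
  -- The polynomial is F with both x and y read as z. The premise is used at the terms and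
  -- polynomials precomposed with f, so x and y get the same binding, as contraction demands.
  refine ⟨_, hF.rename f fun c hc => ?_, fun η σ ρ h => ?_, fun ρ => ?_⟩
  · rcases List.mem_append.1 hc with hc | hc
    · rw [hf _ (by simp [Ctx.mem_names hc])]
      simp [hc]
    · simp only [List.mem_cons, List.not_mem_nil, or_false] at hc
      rcases hc with rfl | rfl
      · simp [hfx]
      · simp [hfy]
  · have hΓΔ : RealizesAll η (fun w => σ (f w)) (fun w => ρ (f w)) (Γ ++ Δ) := by
      refine (h.mono (Γ' := Γ ++ Δ) fun c hc => by simp at hc ⊢; tauto).congr ?_ ?_ <;>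
      · intro w hw
        rw [Ctx.names_append] at hw
        rw [hf w hw]
    have hA : Realizes A η (σ z) (ρ z A.otype) := h (z, A) (by simp)
    have h₁ := hr η (fun w => σ (f w)) (fun w => ρ (f w)) (by
      refine ((hΓΔ.append (.singleton (x := x) (A := A) ?_)).append
        (.singleton (x := y) (A := A) ?_)).mono ?_
      · simpa only [hfx] using hA
      · simpa only [hfy] using hA
      · intro c hc
        simp at hc ⊢; tauto)
    have h₂ := h₁.perm (l' := Γ.names ++ Δ.names ++ [x, y]) (by
      simp only [Ctx.names_append, Ctx.names_cons, Ctx.names_nil, List.append_assoc]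
      exact List.perm_append_comm.append_left _) hn₁
    rw [PolyEnv.weight_congr (ρ' := ρ) fun w hw => by rw [hf w (by simp [hw])], binds_append,
      binds_congr (σ' := σ) fun w hw => by rw [hf w hw]] at h₂
    have e : binds (fun w => σ (f w)) [x, y] = [(σ z, x), (σ z, y)] := by
      simp [binds, hfx, hfy]
    rw [e] at h₂
    have h₃ := (isSaturated_realizes B η).contraction t (σ z) z x y _ [] _
      (by simpa using hn₁) (by simpa using hz) hzt h₂
    refine Realizes.perm (l := Γ.names ++ Δ.names ++ [z]) ?_ ?_ ?_
    · rw [binds_append]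
      exact h₃
    · simp only [Ctx.names_append, Ctx.names_cons, Ctx.names_nil, List.append_assoc]
      exact List.perm_append_comm.append_left _
    · simpa only [Ctx.names_append, Ctx.names_cons, Ctx.names_nil] using hn₂
  · have h₁ := hs fun w => ρ (f w)
    rw [PolyEnv.occWeight_append] at h₁ ⊢
    rw [size_contract, PolyEnv.occWeight_singleton, occ_contract t hxy hzt,
      PolyEnv.occWeight_congr (ρ' := fun w => ρ (f w)) (t' := t)]
    · have e : PolyEnv.occWeight (fun w => ρ (f w)) t [(x, A), (y, A)] =
          (occ x t + occ y t) * (ρ z A.otype).lower := by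
        simp [PolyEnv.occWeight, hfx, hfy, add_mul]
      rwa [e] at h₁
    · intro w hw
      have hw' := hxΓ w (by simp [hw])
      exact ⟨occ_contract_of_ne t hw'.2.2 hw'.1 hw'.2.1, by rw [hf w (by simp [hw])]⟩

theorem derel (ht : Adequate Γ (Δ ++ [(x, L)]) t B) (wt : WellFormed Γ (Δ ++ [(x, L)]) t B) :
    Adequate (Γ ++ [(x, L)]) Δ t B := by
  obtain ⟨F, hF, hr, hs⟩ := ht
  have hp : (Γ.names ++ (Δ ++ [(x, L)]).names).Perm (Ctx.names (Γ ++ [(x, L)]) ++ Δ.names) := by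
    simp only [Ctx.names_append, Ctx.names_cons, Ctx.names_nil, List.append_assoc]
    exact List.perm_append_comm.append_left _
  -- The weight of x, formerly added from outside, becomes the summand ↓x. It covers the occurrences
  -- of x in the size bound because there is at most one.
  refine ⟨_, (hF.mono (Γ' := Γ ++ [(x, L)]) fun c hc => by simp [hc]).add
    (Definable.var (c := (x, L)) (by simp)).down, fun η σ ρ h => ?_, fun ρ => ?_⟩
  · have h₁ := hr η σ ρ (h.mono fun c hc => by simp at hc ⊢; tauto)
    refine (h₁.perm hp (hp.nodup_iff.1 wt.nodup)).conv (.symm ?_)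
    refine Poly.add_add_conv _ _ _ ?_
    rw [PolyEnv.weight_append, PolyEnv.weight_singleton, Poly.value_down]
    exact Nat.add_comm _ _
  · rw [Poly.lower_add, PolyEnv.occWeight_append, PolyEnv.occWeight_singleton, Poly.value_down]
    have h₁ := hs ρ
    have h₂ := Nat.mul_le_mul_right (ρ x L.otype).lower
      (wt.occ_le x (by simp [Ctx.names_append, Ctx.names_cons]))
    simp only at h₂ ⊢
    omega

theorem weak (ht : Adequate Γ Δ t B) (wt : WellFormed Γ Δ t B)
    (hn : (Ctx.names (Γ ++ Γ' ++ (Δ ++ Δ'))).Nodup) : Adequate (Γ ++ Γ') (Δ ++ Δ') t B := by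
  have hfv := wt.mem_names
  simp only [Ctx.names_append] at hn
  have hocc : ∀ x ∈ Γ'.names ++ Δ'.names, occ x t = 0 := by
    intro x hx
    by_contra h
    have := hfv x h
    grind
  obtain ⟨F, hF, hr, hs⟩ := ht
  obtain ⟨S, hS, hv⟩ := Definable.sum_down (Γ := Γ ++ Γ') Γ' (fun c hc => by simp [hc]) 2
  have hp : (Γ.names ++ Δ.names ++ (Γ' ++ Δ').names).Perm
      (Ctx.names (Γ ++ Γ') ++ Ctx.names (Δ ++ Δ')) := by
    simp only [Ctx.names_append, List.append_assoc]
    refine List.Perm.append_left _ ?_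
    rw [← List.append_assoc, ← List.append_assoc]
    exact List.perm_append_comm.append_right _
  have hn' : (Ctx.names (Γ ++ Γ') ++ Ctx.names (Δ ++ Δ')).Nodup := by
    simpa only [Ctx.names_append] using hn
  -- Each new binding costs its TS plus 2. For Γ' all of this goes into the polynomial; for Δ' only
  -- the 2 does, the rest being in the weight.
  refine ⟨_, (hF.mono (Γ' := Γ ++ Γ') fun c hc => by simp [hc]).add
    (hS.add (.nat (2 * Δ'.length))), fun η σ ρ h => ?_, fun ρ => ?_⟩
  · have h₁ := hr η σ ρ (h.mono fun c hc => by simp at hc ⊢; tauto)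
    have h₂ := h₁.weaken (Γ' ++ Δ') (fun c => (ρ c.1 c.2.otype).lower) (hp.nodup_iff.2 hn')
      fun c hc => ⟨hocc _ ?_, (h c ?_).evalBound⟩
    · refine (h₂.perm hp hn').conv ((Poly.add_nat_add_nat _ _ _).trans (.symm ?_))
      refine Poly.add_add_conv _ _ _ ?_
      have e : ((S ρ).add (.nat (2 * Δ'.length))).value = (S ρ).value + 2 * Δ'.length := rfl
      have e' : (Δ'.map fun c => (ρ c.1 c.2.otype).lower + 2).sum =
          ρ.weight Δ' + 2 * Δ'.length := by
        rw [List.sum_map_add, PolyEnv.weight]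
        simp [mul_comm]
      rw [e, hv, PolyEnv.weight_append, List.map_append, List.sum_append, e']
      simp only [Poly.value, Poly.den]
      omega
    · rw [← Ctx.names_append]
      exact Ctx.mem_names hc
    · simp at hc ⊢; tauto
  · rw [Poly.lower_add, PolyEnv.occWeight_append,
      PolyEnv.occWeight_eq_zero (Γ := Γ') fun x hx => hocc x (by simp [hx])]
    exact (hs ρ).trans (Nat.le_add_right _ _)

theorem perm (ht : Adequate Γ Δ t A) (wt : WellFormed Γ Δ t A) (hΓ : Γ.Perm Γ')
    (hΔ : Δ.Perm Δ') : Adequate Γ' Δ' t A := by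
  obtain ⟨F, hF, hr, hs⟩ := ht
  have hp := (hΓ.map Prod.fst).append (hΔ.map Prod.fst)
  refine ⟨F, hF.mono fun c hc => hΓ.mem_iff.1 hc, fun η σ ρ h => ?_, fun ρ => ?_⟩
  · have h₁ := hr η σ ρ (h.mono fun c hc => (hΓ.append hΔ).mem_iff.1 hc)
    rw [PolyEnv.weight, (hΔ.map _).sum_eq] at h₁
    exact h₁.perm hp (hp.nodup_iff.1 wt.nodup)
  · have h₁ := hs ρ
    rwa [PolyEnv.occWeight, (hΓ.map _).sum_eq] at h₁

end Adequate

/-! ### The induction, and the return from assignments to tuples. -/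

theorem Derivable.adequate {Γ Δ : Ctx} {t : LTerm} {A : Formula} (h : Derivable Γ Δ t A) :
    Adequate Γ Δ t A := by
  induction h with
  | ax1 x A _ => exact .ax1 x A
  | ax2 x L hL => exact .ax2 x hL.otype_eq
  | mu_e h ih => exact ih.of_sameRealizers (Adequate.sameRealizers_unfold h.wellFormed.wf)
  | mu_i hL _ ih => exact ih.of_sameRealizers fun η => (Adequate.sameRealizers_unfold hL η).symm
  | all_i α _ hα ih => exact ih.all_i α hα
  | all_e _ hL ih => exact ih.all_e hL.otype_eq
  | imp_e ht hu hn iht ihu => exact iht.imp_e ihu ht.wellFormed hu.wellFormed hn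
  | lolli_e ht hu hn iht ihu => exact iht.lolli_e ihu ht.wellFormed hu.wellFormed hn
  | imp_i ht ih => exact ih.imp_i ht.wellFormed
  | lolli_i ht ih => exact ih.lolli_i ht.wellFormed
  | contr ht hz ih => exact ih.contr ht.wellFormed hz
  | derel ht ih => exact ih.derel ht.wellFormed
  | weak ht _ _ hn ih => exact ih.weak ht.wellFormed hn
  | perm ht hΓ hΔ ih => exact ih.perm ht.wellFormed hΓ hΔ

/-- The assignments extend given ones, so that those for Δ can be built first and survive the
extension by Γ. -/
theorem RealizesCtx.exists_assignment {η : Valuation} {Γ : Ctx} {us : List LTerm}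
    {qs : Args Γ.otypes} (h : RealizesCtx η Γ us qs) (hn : Γ.names.Nodup) (σ : ℕ → LTerm)
    (ρ : PolyEnv) : ∃ σ', (∀ x ∉ Γ.names, σ' x = σ x) ∧ RealizesAll η σ' (ρ.ofArgs Γ qs) Γ ∧
      us.zip Γ.names = binds σ' Γ.names := by
  induction Γ generalizing us with
  | nil => exact ⟨σ, fun _ _ => rfl, nofun, by simp [Ctx.names, binds]⟩
  | cons c Γ ih =>
    cases us with
    | nil => exact h.elim
    | cons u us =>
      have hn' : c.1 ∉ Ctx.names Γ ∧ (Ctx.names Γ).Nodup := List.nodup_cons.1 hn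
      obtain ⟨σ', h₁, h₂, h₃⟩ := ih h.2 hn'.2
      have hne : ∀ x ∈ Ctx.names Γ, x ≠ c.1 := fun x hx => ne_of_mem_of_not_mem hx hn'.1
      refine ⟨Function.update σ' c.1 u, fun x hx => ?_, fun d hd => ?_, ?_⟩
      · simp only [Ctx.names_cons, List.mem_cons, not_or] at hx
        rw [Function.update_of_ne hx.1, h₁ x hx.2]
      · exact (h₂.update hn'.1 h.1) d (by simp at hd ⊢; tauto)
      · rw [Ctx.names_cons, List.zip_cons_cons, h₃,
          binds_congr fun x hx => (Function.update_of_ne (hne x hx) u σ').symm]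
        simp [binds]

theorem occSum_args (t : LTerm) (Γ : Ctx) (ρ : PolyEnv) :
    occSum t Γ (ρ.args Γ) = ρ.occWeight t Γ := by
  induction Γ with
  | nil => rfl
  | cons c Γ ih =>
    rw [occSum, PolyEnv.occWeight, List.map_cons, List.sum_cons, ← PolyEnv.occWeight, ← ih]
    rfl

end DIAL

theorem theorem3 (Γ Δ : DIAL.Ctx) (t : DIAL.LTerm) (A : DIAL.Formula)
    (h : DIAL.Derivable Γ Δ t A) :
    ∃ p : DIAL.Poly Γ.otypes A.otype,
      (∀ (η : DIAL.Valuation) (us ss : List DIAL.LTerm)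
        (qs : DIAL.Args Γ.otypes) (ms : DIAL.Args Δ.otypes),
        DIAL.RealizesCtx η Γ us qs → DIAL.RealizesCtx η Δ ss ms →
        DIAL.Realizes A η (t.bind (us.zip Γ.names ++ ss.zip Δ.names))
          ((p.eval qs).addArgs ms)) ∧
      ∀ qs : DIAL.Args Γ.otypes, t.size + DIAL.occSum t Γ qs ≤ (p.eval qs).lower := by
  obtain ⟨F, ⟨p, hp⟩, hr, hs⟩ := h.adequate
  have hn := List.nodup_append.1 h.wellFormed.nodup
  -- An arbitrary default: only the values of declared variables are ever read.
  let ρ₀ : DIAL.PolyEnv := fun _ τ => .zeroAt τ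
  refine ⟨p, fun η us ss qs ms hus hss => ?_, fun qs => ?_⟩
  · obtain ⟨σ₁, -, h₂, h₃⟩ := hss.exists_assignment hn.2.1 .var ρ₀
    obtain ⟨σ, h₄, h₅, h₆⟩ := hus.exists_assignment hn.1 σ₁ (ρ₀.ofArgs Δ ms)
    have hd : ∀ x ∈ Δ.names, x ∉ Γ.names := fun x hx hx' => hn.2.2 x hx' x hx rfl
    have hρ : ∀ x ∈ Δ.names, (ρ₀.ofArgs Δ ms).ofArgs Γ qs x = ρ₀.ofArgs Δ ms x :=
      fun x hx => DIAL.PolyEnv.ofArgs_of_notMem _ _ _ (hd x hx)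
    have h₇ := hr η σ _ (h₅.append (h₂.congr (fun x hx => h₄ x (hd x hx)) hρ))
    rw [h₃, h₆, ← DIAL.LTerm.binds_congr fun x hx => h₄ x (hd x hx), ← DIAL.LTerm.binds_append]
    refine h₇.conv ?_
    rw [hp, DIAL.PolyEnv.args_ofArgs _ _ _ hn.1, DIAL.PolyEnv.weight_congr hρ]
    have := DIAL.addArgs_conv (ρ₀.ofArgs Δ ms) Δ (p.eval qs)
    rw [DIAL.PolyEnv.args_ofArgs _ _ _ hn.2.1] at this
    exact this.symm
  · have h₁ := hs (ρ₀.ofArgs Γ qs)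
    rwa [← DIAL.occSum_args, hp, DIAL.PolyEnv.args_ofArgs _ _ _ hn.1] at h₁
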